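/- For $x\in\mathbb R$ write $e(x)=e^{2\pi i x}$ and $F(x)=\sum_{n=1}^{\infty}\frac{e(n^2x)}{n}$, the limit of the partial sums $\sum_{n\le N}$; this series converges for almost every $x$, and $F$ is integrable on $[0,1)$. Let $p/q$ be an irreducible fraction with $0\le p\le q$, $q\ge 1$, and fix one of its (at most two) continued fraction expansions $p/q=[0;a_1,\dots,a_{j}]$ with positive integers $a_i$ ($j=0$ is allowed and gives $0/1$). Let $I=I_{p/q}\subset[0,1)$ be the interval of the numbers $x=[0;a_1,\dots,a_{j},\dots]$ in $[0,1)$, i.e. of those $x\in[0,1)$ whose $j$-th convergent is $p/q$. Let $|\cdot|$ denote Lebesgue measure for sets, and let $F_I=\frac1{|I|}\int_I F$. Then there exists an absolute constant $C>0$ such that for every such $I$ (every irreducible $p/q$ and either choice of the expansion) and every $\lambda>0$ \[ \big|\{x\in I : |F(x)-F_I|>\lambda\}\big|\ \ge\ C\,|I|\,e^{-c_q\lambda\sqrt q}, \] where $c_q=\sqrt2$ if $4\mid q$, $c_q=2$ if $2\nmid q$, and $c_q=2\sqrt2$ otherwise. Moreover, there are absolute constants $c_1,c_2>0$ such that for every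 such $I$ with $4\mid q$ and every $\lambda>0$ \[ c_1\,|I|\,e^{-\lambda\sqrt{2q}}\ \le\ \big|\{x\in I : |F(x)-F_I|>\lambda\}\big|\ \le\ c_2\,|I|\,e^{-\lambda\sqrt{2q}}. \] -/

import Mathlib

open MeasureTheory Filter Topology

noncomputable section

namespace SquareSeries

/-- The partial sum `∑_{1 ≤ n ≤ N} e(n² x) / n`, where `e(t) = exp (2 π i t)`. -/
def partialSum (N : ℕ) (x : ℝ) : ℂ :=
  ∑ n ∈ Finset.Icc 1 N, Complex.exp (2 * Real.pi * Complex.I * ((n : ℂ) ^ 2 * (x : ℂ))) / (n : ℂ)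

/-- The function `F(x) = ∑_{n ≥ 1} e(n² x) / n`, the limit of the partial sums (in their natural
order) wherever they converge; its values at the points of divergence are irrelevant. -/
def F (x : ℝ) : ℂ :=
  limUnder atTop (fun N : ℕ => partialSum N x)

/-- The interval `I_{p/q}` for the choice `j` of the length of the continued fraction of `p/q`:
the set of `x ∈ [0, 1)` having `p/q` as their `j`-th convergent (the zeroth convergent is `0/1`).
If `p/q = [0; a₁, …, a_j]`, it consists of the `x = [0; a₁, …, a_j, …]`, and it always contains
`p/q` itself unless `p/q = 1`. If `p/q` has no continued fraction of length `j`,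
it has at most one point. -/
def I (p q j : ℕ) : Set ℝ :=
  {x : ℝ | x ∈ Set.Ico (0 : ℝ) 1 ∧ (GenContFract.of x).convs j = (p : ℝ) / (q : ℝ)}

/-- The average `F_I` of `F` on `I_{p/q}`. -/
def avg (p q j : ℕ) : ℂ :=
  ⨍ x in I p q j, F x

/-- The level set `{x ∈ I : |F(x) - F_I| > lam}` for `I = I_{p/q}`. -/
def levelSet (p q j : ℕ) (lam : ℝ) : Set ℝ :=
  {x : ℝ | x ∈ I p q j ∧ lam < ‖F x - avg p q j‖}

/-- The constant `c_q`. -/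
def c (q : ℕ) : ℝ :=
  if 4 ∣ q then √2 else if ¬ 2 ∣ q then 2 else 2 * √2

end SquareSeries

end

namespace SquareSeries

/-! Write θ(z) = ∑_{n ∈ ℤ} e(n² z). Since θ(x+iy) - 1 = 2 ∑_{n ≥ 1} e(n²x) e^{-2πn²y}, integrating
it against y^{-1/2}/√2 over y > 0 formally gives F(x). The truncation `thetaInt y₀ x` to heights
above y₀ is a regular summation method for the series, so it tends to F(x) as y₀ → 0 wherever the
series converges (`tendsto_thetaInt`). Convergence almost everywhere and integrability come
separately from orthogonality of the terms.

The gain is that θ is explicit near rationals: by Poisson summation θ(p/q + h + iy) is close to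
G/(√2 q √(y - ih)), with G the quadratic Gauss sum (`theta_near_rational`). Let p/q be a convergent
of x = p/q + h and q' the next denominator, so |h| is comparable to 1/(qq'). The heights between
1/q'² and 1/q² then contribute (G/2q) log(q'/q) + O(q^{-1/2}) (`thetaInt_step`). The heights above
1/q² give a quantity that is constant on the cylinder up to O(q^{-1/2}), its `center`
(`thetaInt_sub_center`).

Parametrise the cylinder of p/q by t in (0,1), let T be the Gauss map and q_k the successive
denominators, q_0 = q. Adding up all scales (`Cylinder.exists_expansion`), √(2q)(F - center) equals
∑_k γ_k (-log T^k t) + O(1), where |γ_k| = √(2q) |G_k|/(2q_k) ≤ √(q/q_k) decays geometrically. The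
average F_I differs from the center by O(q^{-1/2}) (`Cylinder.exists_average_sub_center_le`), so it
may replace the center.

The size of γ_0 decides the exponent: |γ_0| is 1 if 4 ∣ q and 1/√2 if q is odd. For q ≡ 2 mod 4 the
leading term is of no use, and one passes to the subcylinder with next partial quotient 1, whose
denominator is odd and at most 2q. This yields the three values of c_q.

For the lower bound, -log t is made large while the rest of the Birkhoff sum stays bounded, which
still has probability of the order of P(t < 1/A) (`le_volume_logSum_le`). For the upper bound with 4
∣ q, every later coefficient is at most 1/√2: the next denominator is odd, and afterwards q_k ≥ 2q.
The later terms therefore have a bounded exponential moment of order 5/4 > 1 and cannot spoil the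
tail e^{-D} of -log t (`volume_log_add_logSum_gt_le`). Both facts rest on exponential moments of
weighted Birkhoff sums, obtained by iterating the transfer operator on the Gauss density
(`lintegral_exp_logSum_le`). -/

/-! ### Quadratic Gauss sums -/

/-- The quadratic Gauss sum `∑_{r mod q} e((p r² + m r) / q)`. -/
noncomputable def gaussSum (q : ℕ) [NeZero q] (p m : ℤ) : ℂ :=
  ∑ r : ZMod q, ZMod.stdAddChar ((p : ZMod q) * r ^ 2 + (m : ZMod q) * r)

lemma conj_stdAddChar {q : ℕ} [NeZero q] (a : ZMod q) :
    (starRingEnd ℂ) (ZMod.stdAddChar a) = ZMod.stdAddChar (-a) := by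
  rw [ZMod.stdAddChar_apply, ZMod.stdAddChar_apply, AddChar.map_neg_eq_inv, Circle.coe_inv_eq_conj]

lemma norm_stdAddChar {q : ℕ} [NeZero q] (a : ZMod q) :
    ‖(ZMod.stdAddChar a : ℂ)‖ = 1 := by
  rw [ZMod.stdAddChar_apply]; exact Circle.norm_coe _

/-- Weyl differencing: with r = s + d the phase is linear in s, and summing over s leaves only the d
with 2pd = 0. There are at most two such d, so all norms of Gauss sums can be read off. -/
lemma gaussSum_mul_conj {q : ℕ} [NeZero q] {p : ℤ} (hp : IsUnit (p : ZMod q)) (m : ℤ) :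
    gaussSum q p m * (starRingEnd ℂ) (gaussSum q p m) =
      q * ∑ d : ZMod q with 2 * d = 0,
        ZMod.stdAddChar ((p : ZMod q) * d ^ 2 + (m : ZMod q) * d) := by
  have h1 : gaussSum q p m * (starRingEnd ℂ) (gaussSum q p m) =
      ∑ s : ZMod q, ∑ d : ZMod q, (ZMod.stdAddChar ((p : ZMod q) * d ^ 2 + (m : ZMod q) * d) : ℂ) *
        ZMod.stdAddChar (s * (2 * (p : ZMod q) * d)) := by
    rw [gaussSum, map_sum, Finset.sum_mul_sum, Finset.sum_comm]
    refine Finset.sum_congr rfl fun s _ => ?_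
    -- Substitute r = d + s in the outer variable.
    rw [← Equiv.sum_comp (Equiv.addRight s)]
    refine Finset.sum_congr rfl fun d _ => ?_
    rw [conj_stdAddChar, ← AddChar.map_add_eq_mul, ← AddChar.map_add_eq_mul]
    congr 1
    simp only [Equiv.coe_addRight]
    ring
  rw [h1, Finset.sum_comm, Finset.mul_sum, Finset.sum_filter]
  refine Finset.sum_congr rfl fun d _ => ?_
  rw [← Finset.mul_sum, AddChar.sum_mulShift _ (ZMod.isPrimitive_stdAddChar q), ZMod.card]
  have : (2 * (p : ZMod q) * d = 0) ↔ 2 * d = 0 := by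
    rw [mul_comm (2 : ZMod q), mul_assoc, hp.mul_right_eq_zero]
  simp only [this]
  split_ifs
  · rw [mul_comm]
  · simp

lemma norm_sq_gaussSum {q : ℕ} [NeZero q] {p : ℤ} (hp : IsUnit (p : ZMod q)) (m : ℤ) :
    ((‖gaussSum q p m‖ ^ 2 : ℝ) : ℂ) =
      q * ∑ d : ZMod q with 2 * d = 0,
        ZMod.stdAddChar ((p : ZMod q) * d ^ 2 + (m : ZMod q) * d) := by
  rw [← gaussSum_mul_conj hp, Complex.mul_conj, Complex.normSq_eq_norm_sq]

lemma two_mul_eq_zero_odd {q : ℕ} [NeZero q] (hq : ¬ 2 ∣ q) :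
    (Finset.univ.filter fun d : ZMod q => 2 * d = 0) = {0} := by
  ext d
  simp only [Finset.mem_filter, Finset.mem_univ, true_and, Finset.mem_singleton]
  have : IsUnit ((2 : ℕ) : ZMod q) := by
    rw [ZMod.isUnit_iff_coprime, Nat.coprime_comm, Nat.coprime_two_right]
    exact Nat.not_even_iff_odd.mp (fun h => hq h.two_dvd)
  exact_mod_cast this.mul_right_eq_zero

lemma two_mul_eq_zero_even {k : ℕ} [NeZero (2 * k)] :
    (Finset.univ.filter fun d : ZMod (2 * k) => 2 * d = 0) = {0, (k : ZMod (2 * k))} := by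
  ext d
  simp only [Finset.mem_filter, Finset.mem_univ, true_and, Finset.mem_singleton, Finset.mem_insert]
  have hk : 0 < k := Nat.pos_of_ne_zero fun h => NeZero.ne (2 * k) (by simp [h])
  constructor
  · intro h
    have h2 : ((2 * d.val : ℕ) : ZMod (2 * k)) = 0 := by
      push_cast; rw [ZMod.natCast_zmod_val]; exact h
    rw [ZMod.natCast_eq_zero_iff] at h2
    have h3 : k ∣ d.val := Nat.dvd_of_mul_dvd_mul_left (by norm_num) h2
    obtain ⟨e, he⟩ := h3
    have h4 := ZMod.val_lt d
    have h5 : e < 2 := by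
      by_contra hcon
      push Not at hcon
      nlinarith
    have h6 : d = ((d.val : ℕ) : ZMod (2 * k)) := (ZMod.natCast_zmod_val d).symm
    interval_cases e
    · left; rw [h6, he]; simp
    · right; rw [h6, he]; simp
  · rintro (h | h)
    · simp [h]
    · rw [h]; exact_mod_cast ZMod.natCast_self (2 * k)

lemma norm_gaussSum_le {q : ℕ} [NeZero q] {p : ℤ} (hp : IsUnit (p : ZMod q)) (m : ℤ) :
    ‖gaussSum q p m‖ ≤ √(2 * q) := by
  apply Real.le_sqrt_of_sq_le
  have h := congrArg norm (norm_sq_gaussSum hp m)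
  rw [Complex.norm_real, Real.norm_of_nonneg (by positivity)] at h
  rw [h, norm_mul, Complex.norm_natCast, mul_comm]
  gcongr
  refine (norm_sum_le _ _).trans ?_
  simp only [norm_stdAddChar, Finset.sum_const, nsmul_eq_mul, mul_one]
  by_cases hq : 2 ∣ q
  · obtain ⟨k, rfl⟩ := hq
    rw [two_mul_eq_zero_even]
    exact_mod_cast Finset.card_le_two
  · rw [two_mul_eq_zero_odd hq]; simp

lemma norm_gaussSum_odd {q : ℕ} [NeZero q] {p : ℤ} (hp : IsUnit (p : ZMod q)) (hq : ¬ 2 ∣ q) :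
    ‖gaussSum q p 0‖ = √q := by
  symm
  rw [Real.sqrt_eq_iff_mul_self_eq (by positivity) (by positivity), ← sq]
  have h := norm_sq_gaussSum hp 0
  rw [two_mul_eq_zero_odd hq] at h
  simp only [Finset.sum_singleton, ne_eq, OfNat.ofNat_ne_zero, not_false_eq_true, zero_pow,
    mul_zero, add_zero, AddChar.map_zero_eq_one, mul_one] at h
  exact_mod_cast h.symm

/-- When 4 ∣ q the square of q/2 vanishes mod q, so the solutions d = 0 and d = q/2 contribute 1
each and do not cancel. -/
lemma norm_gaussSum_four_dvd {q : ℕ} [NeZero q] {p : ℤ} (hp : IsUnit (p : ZMod q)) (hq : 4 ∣ q) :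
    ‖gaussSum q p 0‖ = √(2 * q) := by
  symm
  rw [Real.sqrt_eq_iff_mul_self_eq (by positivity) (by positivity), ← sq]
  have h := norm_sq_gaussSum hp 0
  obtain ⟨l, rfl⟩ := hq
  obtain ⟨k, hk⟩ : ∃ k, k = 2 * l := ⟨_, rfl⟩
  have e : 4 * l = 2 * k := by omega
  have hl : l ≠ 0 := fun h0 => NeZero.ne (4 * l) (by simp [h0])
  -- Stated for a variable modulus, so that the equation 4l = 2k can be substituted inside the type
  -- `ZMod n`.
  have key : ∀ (n : ℕ) [NeZero n] (_ : n = 2 * k) (z : ZMod n → ℂ) (_ : z 0 = 1)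
      (_ : z (k : ZMod n) = 1), ∑ d : ZMod n with 2 * d = 0, z d = 2 := by
    intro n _ hn z h0 h1
    subst hn
    rw [two_mul_eq_zero_even, Finset.sum_pair, h0, h1]
    · norm_num
    · intro h2
      have := (ZMod.natCast_eq_zero_iff k (2 * k)).mp h2.symm
      have := Nat.le_of_dvd (by omega) this
      omega
  rw [key _ e] at h
  · have h' : (‖gaussSum (4 * l) p 0‖ ^ 2 : ℝ) = (4 * l : ℕ) * 2 := by exact_mod_cast h
    rw [h', mul_comm]
  · simp
  · have : (p : ZMod (4 * l)) * (k : ZMod (4 * l)) ^ 2 + ((0 : ℤ) : ZMod (4 * l)) * k = 0 := by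
      have h3 : (k : ZMod (4 * l)) ^ 2 = 0 := by
        rw [← Nat.cast_pow, ZMod.natCast_eq_zero_iff]
        exact ⟨l, by rw [hk]; ring⟩
      rw [h3]; simp
    rw [this]; simp

/-! ### The theta function near a rational point -/

/-- The theta function `∑_{n ∈ ℤ} e(n² z)`. -/
noncomputable def theta (z : ℂ) : ℂ := jacobiTheta (2 * z)

lemma summable_theta {z : ℂ} (hz : 0 < z.im) :
    Summable fun n : ℤ => Complex.exp (2 * Real.pi * Complex.I * (n : ℂ) ^ 2 * z) := by
  have h2 : 0 < (2 * z).im := by simpa using hz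
  have := (hasSum_jacobiTheta₂_term 0 h2).summable
  refine this.congr fun n => ?_
  rw [jacobiTheta₂_term]
  congr 1; ring

lemma theta_eq_tsum (z : ℂ) :
    theta z = ∑' n : ℤ, Complex.exp (2 * Real.pi * Complex.I * (n : ℂ) ^ 2 * z) := by
  rw [theta, jacobiTheta]
  refine tsum_congr fun n => ?_
  congr 1; ring

lemma exp_residue {q : ℕ} [NeZero q] (p m : ℤ) (r : ℕ) :
    (ZMod.stdAddChar ((p : ZMod q) * ((r : ℕ) : ZMod q) ^ 2 + (m : ZMod q) * ((r : ℕ) : ZMod q)) : ℂ)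
      = Complex.exp (2 * Real.pi * Complex.I * ((p * r ^ 2 + m * r) / q)) := by
  have := ZMod.stdAddChar_coe (N := q) (p * (r : ℤ) ^ 2 + m * (r : ℤ))
  push_cast at this
  rw [this]
  congr 1; ring

lemma sum_fin_zmod {q : ℕ} [NeZero q] (f : ZMod q → ℂ) :
    ∑ r : Fin q, f ((r : ℕ) : ZMod q) = ∑ r : ZMod q, f r := by
  refine Fintype.sum_bijective (fun r : Fin q => ((r : ℕ) : ZMod q)) ?_ _ _ fun _ => rfl
  rw [Fintype.bijective_iff_injective_and_card]
  refine ⟨fun a b h => ?_, by simp [ZMod.card]⟩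
  have h' : ((a : ℕ) : ZMod q) = ((b : ℕ) : ZMod q) := h
  rw [ZMod.natCast_eq_natCast_iff', Nat.mod_eq_of_lt a.2, Nat.mod_eq_of_lt b.2] at h'
  exact Fin.ext h'

/-- Poisson summation for the theta function at a rational point, with `a = -2 i q² w`. -/
lemma theta_rational_add {q : ℕ} [NeZero q] (p : ℤ) {w a : ℂ} (hw : 0 < w.im)
    (ha : a = -2 * Complex.I * q ^ 2 * w) :
    theta (p / q + w) =
      1 / a ^ (1 / 2 : ℂ) * ∑' n : ℤ, gaussSum q p n * Complex.exp (-Real.pi / a * (n : ℂ) ^ 2) := by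
  have hq : (q : ℂ) ≠ 0 := Nat.cast_ne_zero.mpr (NeZero.ne q)
  have hqr : (0 : ℝ) < q := Nat.cast_pos.mpr (NeZero.pos q)
  have hare : 0 < a.re := by
    have : a.re = 2 * (q : ℝ) ^ 2 * w.im := by
      rw [ha, show (-2 * Complex.I * q ^ 2 * w : ℂ) = ((-2 * (q : ℝ) ^ 2 : ℝ) : ℂ) * (w * Complex.I) by
        push_cast; ring, Complex.re_ofReal_mul, Complex.mul_I_re]
      ring
    rw [this]; positivity
  have ha0 : a ≠ 0 := fun h => by simp [h] at hare
  have hinv : 0 < (1 / a).re := by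
    rw [one_div, Complex.inv_re]
    exact div_pos hare (Complex.normSq_pos.mpr ha0)
  have hz : 0 < ((p : ℂ) / q + w).im := by
    have : ((p : ℂ) / q).im = 0 := by
      rw [show ((p : ℂ) / q) = (((p : ℝ) / q : ℝ) : ℂ) by push_cast; rfl, Complex.ofReal_im]
    rw [Complex.add_im, this, zero_add]; exact hw
  have hsum := summable_theta hz
  have hsq : ((1 / a) ^ (1 / 2 : ℂ)) = 1 / a ^ (1 / 2 : ℂ) := by
    rw [one_div a, Complex.inv_cpow, ← one_div (a ^ (1 / 2 : ℂ))]
    intro h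
    have := (Complex.arg_eq_pi_iff.mp h).1
    linarith
  have hsqne : a ^ (1 / 2 : ℂ) ≠ 0 := by simp [Complex.cpow_eq_zero_iff, ha0]
  have inner : ∀ r : Fin q, ∑' m : ℤ, Complex.exp (2 * Real.pi * Complex.I *
      (((m * q + (r : ℕ) : ℤ)) : ℂ) ^ 2 * (p / q + w)) =
      1 / a ^ (1 / 2 : ℂ) * ∑' n : ℤ,
        ZMod.stdAddChar ((p : ZMod q) * ((r : ℕ) : ZMod q) ^ 2 + (n : ZMod q) * ((r : ℕ) : ZMod q)) *
          Complex.exp (-Real.pi / a * (n : ℂ) ^ 2) := by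
    intro r
    have hP := Complex.tsum_exp_neg_quadratic hinv (Complex.I * ((r : ℕ) : ℂ) / q)
    have hP' := Complex.tsum_exp_neg_quadratic hinv (-(Complex.I * ((r : ℕ) : ℂ) / q))
    rw [hsq, one_div_one_div] at hP'
    have e1 : ∀ m : ℤ, Complex.exp (2 * Real.pi * Complex.I *
      (((m * q + (r : ℕ) : ℤ)) : ℂ) ^ 2 * (p / q + w)) =
        Complex.exp (2 * Real.pi * Complex.I * (p * ((r : ℕ) : ℂ) ^ 2 / q)) *
        Complex.exp (-Real.pi / (1 / a) * (m + Complex.I * (-(Complex.I * ((r : ℕ) : ℂ) / q))) ^ 2) := by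
      intro m
      rw [← Complex.exp_add]
      rw [Complex.exp_eq_exp_iff_exists_int]
      -- The integer p(mq + r)²/q - pr²/q: the phase at p/q depends only on the residue r.
      refine ⟨p * (m ^ 2 * q + 2 * m * (r : ℕ)), ?_⟩
      rw [ha]
      have hI : Complex.I * (-(Complex.I * ((r : ℕ) : ℂ) / q)) = ((r : ℕ) : ℂ) / q := by
        rw [mul_neg, ← mul_div_assoc, ← mul_assoc, Complex.I_mul_I]; ring
      rw [hI]
      push_cast
      field_simp
      ring
    rw [tsum_congr e1, tsum_mul_left]
    rw [show (∑' m : ℤ, Complex.exp (-Real.pi / (1 / a) *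
      (m + Complex.I * (-(Complex.I * ((r : ℕ) : ℂ) / q))) ^ 2)) =
      1 / a ^ (1 / 2 : ℂ) * ∑' (n : ℤ), Complex.exp (-Real.pi * (1 / a) * n ^ 2 +
        2 * Real.pi * -(Complex.I * ((r : ℕ) : ℂ) / q) * n) by
      rw [hP', ← mul_assoc, one_div_mul_cancel hsqne, one_mul]]
    rw [mul_left_comm, ← tsum_mul_left]
    congr 1
    -- The dual variable appears with the opposite sign to the one in the Gauss sum.
    rw [← (Equiv.neg ℤ).tsum_eq]
    refine tsum_congr fun n => ?_
    rw [exp_residue, ← Complex.exp_add, ← Complex.exp_add]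
    congr 1
    simp only [Equiv.neg_apply]
    push_cast
    ring
  have hsum' : Summable fun x : ℤ × Fin q => Complex.exp (2 * Real.pi * Complex.I *
      (((x.1 * q + (x.2 : ℕ) : ℤ)) : ℂ) ^ 2 * (p / q + w)) :=
    (Int.divModEquiv q).symm.summable_iff.mpr hsum
  -- Split the sum over n = mq + r into residue classes; each class is a shifted Gaussian sum.
  rw [theta_eq_tsum, ← (Int.divModEquiv q).symm.tsum_eq]
  have e2 : ∀ x : ℤ × Fin q, Complex.exp (2 * Real.pi * Complex.I *
      (((Int.divModEquiv q).symm x : ℤ) : ℂ) ^ 2 * (p / q + w)) =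
      Complex.exp (2 * Real.pi * Complex.I *
      (((x.1 * q + (x.2 : ℕ) : ℤ)) : ℂ) ^ 2 * (p / q + w)) := fun x => rfl
  rw [tsum_congr e2, ← (Equiv.prodComm (Fin q) ℤ).tsum_eq]
  have hsum'' := (Equiv.prodComm (Fin q) ℤ).summable_iff.mpr hsum'
  refine hsum''.tsum_prod.trans ?_
  rw [tsum_fintype]
  simp only [Function.comp_apply, Equiv.prodComm_apply, Prod.swap_prod_mk]
  rw [Finset.sum_congr rfl fun r _ => inner r, ← Finset.mul_sum]
  congr 1
  rw [← Summable.tsum_finsetSum]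
  · refine tsum_congr fun n => ?_
    rw [gaussSum, ← sum_fin_zmod, Finset.sum_mul]
  · intro r _
    refine Summable.of_norm ?_
    simp only [norm_mul, norm_stdAddChar, one_mul]
    have h0 : 0 < (Complex.I / a / 2).im := by
      rw [show Complex.I / a / 2 = ((1 / 2 : ℝ) : ℂ) * (Complex.I * (1 / a)) by push_cast; ring,
        Complex.im_ofReal_mul, Complex.I_mul_im]
      positivity
    refine (summable_theta h0).norm.congr fun n => ?_
    congr 2
    rw [show 2 * Real.pi * Complex.I * (n : ℂ) ^ 2 * (Complex.I / a / 2) =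
      (Complex.I * Complex.I) * (Real.pi / a * n ^ 2) by ring, Complex.I_mul_I]
    ring

/-- The exponent must exceed 1/2, so that x = vn² gives a summable series in n. With 3/4 the
resulting powers of y also integrate to O(q^{-1/2}) over each range of heights. -/
lemma exp_neg_le_rpow {x : ℝ} (hx : 0 < x) : Real.exp (-x) ≤ x ^ (-(3 / 4) : ℝ) := by
  rw [Real.rpow_def_of_pos hx]
  apply Real.exp_le_exp.mpr
  have := Real.log_le_sub_one_of_pos hx
  nlinarith [Real.log_le_sub_one_of_pos hx]

lemma csqrt_sq (b : ℂ) : (b ^ (1 / 2 : ℂ)) ^ 2 = b := by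
  rw [← Complex.cpow_nat_mul]; simp

lemma norm_csqrt (b : ℂ) : ‖b ^ (1 / 2 : ℂ)‖ = √‖b‖ := by
  rw [eq_comm, Real.sqrt_eq_iff_mul_self_eq (norm_nonneg _) (norm_nonneg _), ← sq, ← norm_pow,
    csqrt_sq]

lemma csqrt_pos_mul {r : ℝ} (hr : 0 < r) (b : ℂ) :
    ((r : ℂ) * b) ^ (1 / 2 : ℂ) = (√r : ℂ) * b ^ (1 / 2 : ℂ) := by
  rcases eq_or_ne b 0 with rfl | hb
  · simp
  rw [Complex.cpow_def_of_ne_zero (mul_ne_zero (by exact_mod_cast hr.ne') hb),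
    Complex.cpow_def_of_ne_zero hb, Complex.log_ofReal_mul hr hb, add_mul, Complex.exp_add]
  congr 1
  rw [show (Real.log r : ℂ) * (1 / 2) = ((Real.log r * (1 / 2) : ℝ) : ℂ) by push_cast; ring,
    ← Complex.ofReal_exp, Real.sqrt_eq_rpow, Real.rpow_def_of_pos hr]

/-- Away from the real line, `theta` near `p / q` is its leading term up to an explicit error. -/
lemma theta_near_rational : ∃ C : ℝ, 0 < C ∧ ∀ (q : ℕ) [NeZero q] (p : ℤ), IsUnit (p : ZMod q) →
    ∀ h y : ℝ, 0 < y →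
      ‖theta ((p : ℂ) / q + (h + y * Complex.I)) -
        gaussSum q p 0 / (√2 * q * ((y : ℂ) - h * Complex.I) ^ (1 / 2 : ℂ))‖
        ≤ C * (q * (|h| + y) * y ^ (-(3 / 4) : ℝ)) := by
  set D : ℝ := ∑' n : ℤ, |(n : ℝ)| ^ (-(3 / 2) : ℝ) with hD
  have hDs : Summable fun n : ℤ => |(n : ℝ)| ^ (-(3 / 2) : ℝ) :=
    Real.summable_abs_int_rpow (by norm_num)
  have hD0 : 0 ≤ D := tsum_nonneg fun n => by positivity
  refine ⟨D + 1, by positivity, fun q _ p hp h y hy => ?_⟩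
  have hqr : (0 : ℝ) < q := Nat.cast_pos.mpr (NeZero.pos q)
  set w : ℂ := h + y * Complex.I with hw
  have hwim : w.im = y := by simp [hw]
  set b : ℂ := (y : ℂ) - h * Complex.I with hb
  have hbre : b.re = y := by simp [hb]
  have hb0 : b ≠ 0 := fun h0 => by rw [h0] at hbre; simp at hbre; linarith
  have hbn : 0 < ‖b‖ := norm_pos_iff.mpr hb0
  set a : ℂ := -2 * Complex.I * q ^ 2 * w with ha
  have hab : a = ((2 * (q : ℝ) ^ 2 : ℝ) : ℂ) * b := by
    rw [ha, hw, hb]; push_cast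
    linear_combination (-2 * (q : ℂ) ^ 2 * y) * Complex.I_mul_I
  have hsq : a ^ (1 / 2 : ℂ) = √2 * q * b ^ (1 / 2 : ℂ) := by
    rw [hab, csqrt_pos_mul (by positivity), Real.sqrt_mul (by norm_num), Real.sqrt_sq hqr.le]
    push_cast; ring
  have hsqn : ‖a ^ (1 / 2 : ℂ)‖ = √2 * q * √‖b‖ := by
    rw [hsq, norm_mul, norm_mul, norm_csqrt, Complex.norm_real, Complex.norm_natCast,
      Real.norm_of_nonneg (by positivity)]
  -- Re(1/a) = v/2, so v is the rate of decay of the dual Gaussians.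
  set v : ℝ := y / (q ^ 2 * ‖b‖ ^ 2) with hv
  have hv0 : 0 < v := by positivity
  have hterm : ∀ n : ℤ, ‖Complex.exp (-Real.pi / a * (n : ℂ) ^ 2)‖ =
      Real.exp (-(Real.pi / 2 * v * n ^ 2)) := by
    intro n
    rw [Complex.norm_exp]
    congr 1
    have h1 : (b⁻¹).re = y / ‖b‖ ^ 2 := by
      rw [Complex.inv_re, hbre, Complex.normSq_eq_norm_sq]
    have : -Real.pi / a * (n : ℂ) ^ 2 =
        ((-Real.pi / (2 * (q : ℝ) ^ 2) * n ^ 2 : ℝ) : ℂ) * b⁻¹ := by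
      rw [hab]; push_cast; field_simp
    rw [this, Complex.re_ofReal_mul, h1, hv]
    field_simp
  set f : ℤ → ℂ := fun n => gaussSum q p n * Complex.exp (-Real.pi / a * (n : ℂ) ^ 2) with hf
  have hfb : ∀ n : ℤ, n ≠ 0 → ‖f n‖ ≤ √(2 * q) * v ^ (-(3 / 4) : ℝ) * |(n : ℝ)| ^ (-(3 / 2) : ℝ) := by
    intro n hn
    rw [hf]; simp only [norm_mul]
    rw [hterm, mul_assoc (√(2 * (q : ℝ)))]
    have hnr : (0 : ℝ) < |(n : ℝ)| := abs_pos.mpr (by exact_mod_cast hn)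
    have hn2 : (n : ℝ) ^ 2 = |(n : ℝ)| ^ (2 : ℝ) := by
      rw [Real.rpow_two, sq_abs]
    have hle : v * n ^ 2 ≤ Real.pi / 2 * v * n ^ 2 := by
      have : 1 ≤ Real.pi / 2 := by linarith [Real.pi_gt_three]
      have : 0 ≤ v * (n : ℝ) ^ 2 := by positivity
      nlinarith
    refine mul_le_mul (norm_gaussSum_le hp n) ?_ (by positivity) (by positivity)
    · calc Real.exp (-(Real.pi / 2 * v * n ^ 2)) ≤ Real.exp (-(v * n ^ 2)) := by gcongr
        _ ≤ (v * n ^ 2) ^ (-(3 / 4) : ℝ) := exp_neg_le_rpow (by rw [hn2]; positivity)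
        _ = v ^ (-(3 / 4) : ℝ) * |(n : ℝ)| ^ (-(3 / 2) : ℝ) := by
          rw [Real.mul_rpow hv0.le (by positivity), hn2, ← Real.rpow_mul (abs_nonneg _)]
          norm_num
  have hfs : Summable f := by
    have hup : Summable fun n : ℤ => (if n = 0 then ‖f 0‖ else 0) +
        √(2 * q) * v ^ (-(3 / 4) : ℝ) * |(n : ℝ)| ^ (-(3 / 2) : ℝ) := by
      refine Summable.add ?_ (hDs.mul_left _)
      exact (hasSum_ite_eq 0 _).summable
    refine Summable.of_norm_bounded hup fun n => ?_
    by_cases hn : n = 0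
    · subst hn; simp only [if_true]
      have : 0 ≤ √(2 * q) * v ^ (-(3 / 4) : ℝ) * |((0 : ℤ) : ℝ)| ^ (-(3 / 2) : ℝ) := by positivity
      linarith
    · simp only [hn, if_false, zero_add]; exact hfb n hn
  have hP := theta_rational_add p (w := w) (a := a) (by rw [hwim]; exact hy) ha
  rw [hP, hfs.tsum_eq_add_tsum_ite 0]
  have hf0 : f 0 = gaussSum q p 0 := by simp [hf]
  have htail : ‖∑' n : ℤ, (if n = 0 then 0 else f n)‖ ≤ √(2 * q) * v ^ (-(3 / 4) : ℝ) * D := by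
    refine tsum_of_norm_bounded (hDs.hasSum.mul_left _) fun n => ?_
    split_ifs with hn
    · rw [norm_zero]; positivity
    · exact hfb n hn
  rw [hf0, ← hsq, mul_add, one_div_mul_eq_div, add_sub_cancel_left, norm_mul, norm_div, norm_one, hsqn]
  have hbound : ‖b‖ ≤ |h| + y := by
    calc ‖b‖ ≤ ‖(y : ℂ)‖ + ‖(h : ℂ) * Complex.I‖ := norm_sub_le _ _
      _ = |h| + y := by
        rw [norm_mul, Complex.norm_I, Complex.norm_real, Complex.norm_real, Real.norm_eq_abs,
          Real.norm_eq_abs, abs_of_pos hy]; ring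
  have hvp : v ^ (-(3 / 4) : ℝ) = y ^ (-(3 / 4) : ℝ) * ((q * √q) * (‖b‖ * √‖b‖)) := by
    rw [hv, div_eq_mul_inv, Real.mul_rpow hy.le (by positivity), Real.inv_rpow (by positivity),
      Real.rpow_neg (by positivity : (0 : ℝ) ≤ q ^ 2 * ‖b‖ ^ 2), inv_inv,
      Real.mul_rpow (by positivity) (by positivity)]
    have aux : ∀ t : ℝ, 0 < t → (t ^ 2) ^ (3 / 4 : ℝ) = t * √t := by
      intro t ht
      rw [← Real.rpow_natCast, ← Real.rpow_mul ht.le, Real.sqrt_eq_rpow]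
      nth_rw 2 [← Real.rpow_one t]
      rw [← Real.rpow_add ht]; norm_num
    rw [aux _ hqr, aux _ hbn]
  calc 1 / (√2 * q * √‖b‖) * ‖∑' n : ℤ, (if n = 0 then 0 else f n)‖
      ≤ 1 / (√2 * q * √‖b‖) * (√(2 * q) * v ^ (-(3 / 4) : ℝ) * D) := by gcongr
    _ = D * (q * ‖b‖ * y ^ (-(3 / 4) : ℝ)) := by
      rw [hvp, Real.sqrt_mul (by norm_num)]
      have h1 : √(q : ℝ) * √q = q := Real.mul_self_sqrt hqr.le
      have h3 : 0 < √‖b‖ := Real.sqrt_pos.mpr hbn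
      field_simp
      rw [sq, h1]
    _ ≤ (D + 1) * (q * (|h| + y) * y ^ (-(3 / 4) : ℝ)) := by
      gcongr
      linarith

/-! ### Vertical integrals of the theta function -/

/-- The integral of `(θ(x + i y) - 1) / √(2 y)` over `y > y₀`. -/
noncomputable def thetaInt (y₀ x : ℝ) : ℂ :=
  1 / √2 * ∫ y in Set.Ioi y₀, (theta (x + y * Complex.I) - 1) / (√y : ℂ)

lemma differentiableAt_theta {z : ℂ} (hz : 0 < z.im) : DifferentiableAt ℂ theta z := by
  have h2 : 0 < (2 * z).im := by simpa using hz
  exact (differentiableAt_jacobiTheta h2).comp z (by fun_prop : DifferentiableAt ℂ (fun z => 2 * z) z)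

lemma continuousOn_theta_vertical (x : ℝ) :
    ContinuousOn (fun y : ℝ => theta (x + y * Complex.I)) (Set.Ioi 0) := by
  intro y hy
  have h : 0 < ((x : ℂ) + y * Complex.I).im := by simpa using hy
  have h1 : ContinuousAt (fun y : ℝ => (x : ℂ) + y * Complex.I) y := by fun_prop
  exact (ContinuousAt.comp (f := fun y : ℝ => (x : ℂ) + y * Complex.I) (g := theta)
    (differentiableAt_theta h).continuousAt h1).continuousWithinAt

lemma continuousOn_inv_sqrt : ContinuousOn (fun y : ℝ => ((√y : ℝ) : ℂ)⁻¹) (Set.Ioi 0) := by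
  refine ContinuousOn.inv₀ (by fun_prop) fun y hy => ?_
  exact_mod_cast (Real.sqrt_pos.mpr hy).ne'

lemma integrableOn_thetaInt {y₀ : ℝ} (hy₀ : 0 < y₀) (x : ℝ) :
    IntegrableOn (fun y : ℝ => (theta (x + y * Complex.I) - 1) / (√y : ℂ)) (Set.Ioi y₀) := by
  have hsub : Set.Ioi y₀ ⊆ Set.Ioi (0 : ℝ) := fun y hy => hy₀.trans hy
  have hc : ContinuousOn (fun y : ℝ => (theta (x + y * Complex.I) - 1) / (√y : ℂ)) (Set.Ioi y₀) := by
    simp only [div_eq_mul_inv]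
    exact (((continuousOn_theta_vertical x).sub continuousOn_const).mul continuousOn_inv_sqrt).mono hsub
  have hexp : IntegrableOn (fun y : ℝ => 2 / (1 - Real.exp (-(2 * Real.pi) * y₀)) *
      Real.exp (-(2 * Real.pi) * y) * (√y₀)⁻¹) (Set.Ioi y₀) :=
    ((exp_neg_integrableOn_Ioi y₀ (by positivity : 0 < 2 * Real.pi)).const_mul _).mul_const _
  refine Integrable.mono' hexp (hc.aestronglyMeasurable measurableSet_Ioi) ?_
  refine (ae_restrict_iff' measurableSet_Ioi).mpr (Eventually.of_forall fun y hy => ?_)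
  have hy' : y₀ < y := hy
  have him : 0 < (2 * ((x : ℂ) + y * Complex.I)).im := by simp; linarith
  have himv : (2 * ((x : ℂ) + y * Complex.I)).im = 2 * y := by simp
  have hb := norm_jacobiTheta_sub_one_le him
  rw [himv] at hb
  rw [norm_div, Complex.norm_real, Real.norm_of_nonneg (Real.sqrt_nonneg _), div_eq_mul_inv]
  have hs0 := Real.sqrt_pos.mpr hy₀
  have e1 : Real.exp (-(2 * Real.pi) * y₀) < 1 := by
    rw [Real.exp_lt_one_iff]; nlinarith [Real.pi_pos]
  have hmul : -Real.pi * (2 * y) = -(2 * Real.pi) * y := by ring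
  rw [hmul] at hb
  have e2 : Real.exp (-(2 * Real.pi) * y) ≤ Real.exp (-(2 * Real.pi) * y₀) := by
    apply Real.exp_le_exp.mpr; nlinarith [Real.pi_pos]
  refine mul_le_mul (hb.trans ?_) (by gcongr) (by positivity) ?_
  · gcongr
  · have : 0 < 1 - Real.exp (-(2 * Real.pi) * y₀) := by linarith
    positivity

lemma norm_theta_le : ∃ C : ℝ, 0 < C ∧ ∀ (q : ℕ) [NeZero q] (p : ℤ), IsUnit (p : ZMod q) →
    ∀ h y : ℝ, 0 < y →
      ‖theta ((p : ℂ) / q + (h + y * Complex.I))‖ ≤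
        (√q)⁻¹ * (√y)⁻¹ + C * (q * (|h| + y) * y ^ (-(3 / 4) : ℝ)) := by
  obtain ⟨C, hC, H⟩ := theta_near_rational
  refine ⟨C, hC, fun q _ p hp h y hy => ?_⟩
  have hqr : (0 : ℝ) < q := Nat.cast_pos.mpr (NeZero.pos q)
  have h1 := H q p hp h y hy
  have hbn : y ≤ ‖(y : ℂ) - h * Complex.I‖ := by
    calc y = ((y : ℂ) - h * Complex.I).re := by simp
      _ ≤ _ := Complex.re_le_norm _
  have h2 : ‖gaussSum q p 0 / (√2 * q * ((y : ℂ) - h * Complex.I) ^ (1 / 2 : ℂ))‖ ≤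
      (√q)⁻¹ * (√y)⁻¹ := by
    rw [norm_div, norm_mul, norm_mul, norm_csqrt, Complex.norm_real, Complex.norm_natCast,
      Real.norm_of_nonneg (by positivity)]
    have hs : 0 < √y := Real.sqrt_pos.mpr hy
    calc ‖gaussSum q p 0‖ / (√2 * q * √‖(y : ℂ) - h * Complex.I‖)
        ≤ √(2 * q) / (√2 * q * √y) := by
          gcongr
          exact norm_gaussSum_le hp 0
      _ = (√q)⁻¹ * (√y)⁻¹ := by
          rw [Real.sqrt_mul (by norm_num)]
          have : √(q : ℝ) * √q = q := Real.mul_self_sqrt hqr.le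
          have hq' : 0 < √(q : ℝ) := Real.sqrt_pos.mpr hqr
          field_simp
          rw [sq, this]
  calc _ ≤ _ := norm_le_norm_add_norm_sub' _ (gaussSum q p 0 / (√2 * q * ((y : ℂ) - h * Complex.I) ^ (1 / 2 : ℂ)))
    _ ≤ _ := add_le_add h2 h1

/-- Cauchy's estimate on discs of radius y/2 bounds θ' by a constant times (the size of θ)/y. A disc
centred above p/q + s with |s| ≤ 1/q² ≤ y stays within horizontal distance 3y/2 of p/q, so
`norm_theta_le` applies on it. -/
lemma norm_theta_sub_le : ∃ C : ℝ, 0 < C ∧ ∀ (q : ℕ) [NeZero q] (p : ℤ), IsUnit (p : ZMod q) →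
    ∀ h y : ℝ, 0 < y → |h| ≤ ((q : ℝ) ^ 2)⁻¹ → ((q : ℝ) ^ 2)⁻¹ ≤ y →
      ‖theta ((p : ℂ) / q + (h + y * Complex.I)) - theta ((p : ℂ) / q + y * Complex.I)‖ ≤
        C * ((q : ℝ) ^ 2)⁻¹ * (((√q)⁻¹ * (√y)⁻¹ + q * y ^ (1 / 4 : ℝ)) / y) := by
  obtain ⟨C, hC, H⟩ := norm_theta_le
  refine ⟨12 * C + 4, by positivity, fun q _ p hp h y hy hh hqy => ?_⟩
  have hqr : (0 : ℝ) < q := Nat.cast_pos.mpr (NeZero.pos q)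
  set M : ℝ := (√q)⁻¹ * (2 * (√y)⁻¹) + C * (q * (6 * y ^ (1 / 4 : ℝ))) with hM
  set S : Set ℂ := (fun s : ℝ => (p : ℂ) / q + (s + y * Complex.I)) '' Set.Icc (-((q : ℝ) ^ 2)⁻¹) (((q : ℝ) ^ 2)⁻¹) with hS
  have hpq : ((p : ℂ) / q).im = 0 := by
    rw [show ((p : ℂ) / q) = (((p : ℝ) / q : ℝ) : ℂ) by push_cast; rfl, Complex.ofReal_im]
  have hsphere : ∀ s : ℝ, |s| ≤ ((q : ℝ) ^ 2)⁻¹ →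
      ∀ z ∈ Metric.closedBall ((p : ℂ) / q + (s + y * Complex.I)) (y / 2),
        0 < z.im ∧ ‖theta z‖ ≤ M := by
    intro s hs z hz
    rw [Metric.mem_closedBall, dist_eq_norm] at hz
    set d := z - ((p : ℂ) / q + (s + y * Complex.I)) with hd
    have hre := (Complex.abs_re_le_norm d).trans hz
    have him := (Complex.abs_im_le_norm d).trans hz
    rw [abs_le] at him
    have hz' : z = (p : ℂ) / q + (((s + d.re : ℝ) : ℂ) + ((y + d.im : ℝ) : ℂ) * Complex.I) := by
      conv_lhs => rw [show z = (p : ℂ) / q + (s + y * Complex.I) + d by rw [hd]; ring, ← Complex.re_add_im d]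
      push_cast; ring
    have hypos : 0 < y + d.im := by linarith
    have hylow : y / 2 ≤ y + d.im := by linarith
    constructor
    · rw [hz', Complex.add_im, hpq]; simpa using hypos
    rw [hz']
    refine (H q p hp _ _ hypos).trans ?_
    have h4 : (y / 2) ^ (-(3 / 4) : ℝ) ≤ 2 * y ^ (-(3 / 4) : ℝ) := by
      rw [Real.div_rpow hy.le (by norm_num), div_eq_mul_inv, ← Real.rpow_neg (by norm_num), neg_neg,
        mul_comm]
      gcongr
      calc (2 : ℝ) ^ (3 / 4 : ℝ) ≤ 2 ^ (1 : ℝ) :=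
            Real.rpow_le_rpow_of_exponent_le (by norm_num) (by norm_num)
        _ = 2 := Real.rpow_one 2
    have h5 : y * y ^ (-(3 / 4) : ℝ) = y ^ (1 / 4 : ℝ) := by
      nth_rw 1 [← Real.rpow_one y]
      rw [← Real.rpow_add hy]; norm_num
    have hsy : 0 < √y := Real.sqrt_pos.mpr hy
    rw [hM]
    refine add_le_add ?_ ?_
    · gcongr
      rw [show 2 * (√y)⁻¹ = (√y / 2)⁻¹ by rw [inv_div]; ring]
      apply inv_anti₀ (by positivity)
      rw [show √y / 2 = √(y / 4) by
        rw [Real.sqrt_div hy.le, show (4 : ℝ) = 2 ^ 2 by norm_num, Real.sqrt_sq (by norm_num)]]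
      apply Real.sqrt_le_sqrt; linarith
    · rw [mul_assoc (q : ℝ)]
      refine mul_le_mul_of_nonneg_left (mul_le_mul_of_nonneg_left ?_ hqr.le) hC.le
      calc (|s + d.re| + (y + d.im)) * (y + d.im) ^ (-(3 / 4) : ℝ)
          ≤ (3 * y) * (y / 2) ^ (-(3 / 4) : ℝ) := by
            refine mul_le_mul ?_ ?_ (by positivity) (by positivity)
            · have := abs_add_le s d.re; linarith
            · exact Real.rpow_le_rpow_of_nonpos (by linarith) hylow (by norm_num)
        _ ≤ (3 * y) * (2 * y ^ (-(3 / 4) : ℝ)) := by gcongr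
        _ = 6 * y ^ (1 / 4 : ℝ) := by rw [← h5]; ring
  have hderiv : ∀ z ∈ S, ‖deriv theta z‖ ≤ M / (y / 2) := by
    rintro z ⟨s, hs, rfl⟩
    have hs' : |s| ≤ ((q : ℝ) ^ 2)⁻¹ := abs_le.mpr hs
    refine Complex.norm_deriv_le_of_forall_mem_sphere_norm_le (by positivity) ?_ ?_
    · refine DifferentiableOn.diffContOnCl fun z hz => ?_
      refine (differentiableAt_theta (hsphere s hs' z ?_).1).differentiableWithinAt
      rwa [closure_ball _ (by positivity)] at hz
    · exact fun z hz => (hsphere s hs' z (Metric.sphere_subset_closedBall hz)).2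
  have hdiff : ∀ z ∈ S, DifferentiableAt ℂ theta z := by
    rintro z ⟨s, hs, rfl⟩
    exact differentiableAt_theta (hsphere s (abs_le.mpr hs) _ (Metric.mem_closedBall_self (by positivity))).1
  have hconv : Convex ℝ S := by
    rw [hS, show (fun s : ℝ => (p : ℂ) / q + (s + y * Complex.I)) =
      (fun z : ℂ => ((p : ℂ) / q + y * Complex.I) + z) ∘ (Complex.ofRealLI.toLinearMap) by
        ext s; simp; ring, Set.image_comp]
    exact ((convex_Icc _ _).linear_image _).translate _
  have hmem0 : (p : ℂ) / q + y * Complex.I ∈ S := ⟨0, by constructor <;> simp, by simp⟩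
  have hmemh : (p : ℂ) / q + (h + y * Complex.I) ∈ S := ⟨h, abs_le.mp hh, rfl⟩
  have key := hconv.norm_image_sub_le_of_norm_deriv_le hdiff hderiv hmem0 hmemh
  refine key.trans ?_
  have : ‖(p : ℂ) / q + (h + y * Complex.I) - ((p : ℂ) / q + y * Complex.I)‖ = |h| := by
    rw [show (p : ℂ) / q + (h + y * Complex.I) - ((p : ℂ) / q + y * Complex.I) = (h : ℂ) by ring,
      Complex.norm_real, Real.norm_eq_abs]
  rw [this]
  have hM0 : 0 ≤ M := by positivity
  calc M / (y / 2) * |h| ≤ M / (y / 2) * ((q : ℝ) ^ 2)⁻¹ := by gcongr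
    _ = ((q : ℝ) ^ 2)⁻¹ * ((2 * M) / y) := by field_simp
    _ ≤ ((q : ℝ) ^ 2)⁻¹ * (((12 * C + 4) * ((√q)⁻¹ * (√y)⁻¹ + q * y ^ (1 / 4 : ℝ))) / y) := by
      have a1 : 0 ≤ (√q)⁻¹ * (√y)⁻¹ := by positivity
      have a2 : 0 ≤ q * y ^ (1 / 4 : ℝ) := by positivity
      have a3 : 2 * M ≤ (12 * C + 4) * ((√q)⁻¹ * (√y)⁻¹ + q * y ^ (1 / 4 : ℝ)) := by
        rw [hM]; nlinarith [mul_nonneg hC.le a1]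
      exact mul_le_mul_of_nonneg_left (div_le_div_of_nonneg_right a3 hy.le) (by positivity)
    _ = _ := by ring

lemma inv_sq_rpow {q : ℝ} (hq : 0 < q) (s : ℝ) : ((q ^ 2)⁻¹) ^ s = q ^ (-2 * s) := by
  rw [Real.inv_rpow (by positivity), ← Real.rpow_natCast, ← Real.rpow_mul hq.le,
    ← Real.rpow_neg hq.le]
  congr 1; push_cast; ring

/-- After division by √y the bound for the difference is q^{-2}(q^{-1/2} y^{-2} + q y^{-5/4}); from
1/q² on, both parts integrate to multiples of q^{-1/2}. -/
lemma thetaInt_sub_center : ∃ C : ℝ, 0 < C ∧ ∀ (q : ℕ) [NeZero q] (p : ℤ), IsUnit (p : ZMod q) →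
    ∀ h : ℝ, |h| ≤ ((q : ℝ) ^ 2)⁻¹ →
      ‖thetaInt ((q : ℝ) ^ 2)⁻¹ (p / q + h) - thetaInt ((q : ℝ) ^ 2)⁻¹ (p / q)‖ ≤ C / √q := by
  obtain ⟨C, hC, H⟩ := norm_theta_sub_le
  refine ⟨5 * C, by positivity, fun q _ p hp h hh => ?_⟩
  have hqr : (0 : ℝ) < q := Nat.cast_pos.mpr (NeZero.pos q)
  set y₀ : ℝ := ((q : ℝ) ^ 2)⁻¹ with hy₀
  have hy₀p : 0 < y₀ := by positivity
  rw [thetaInt, thetaInt, ← mul_sub, ← integral_sub (integrableOn_thetaInt hy₀p _)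
    (integrableOn_thetaInt hy₀p _), norm_mul]
  have i1 : IntegrableOn (fun y : ℝ => y ^ (-2 : ℝ)) (Set.Ioi y₀) :=
    integrableOn_Ioi_rpow_of_lt (by norm_num) hy₀p
  have i2 : IntegrableOn (fun y : ℝ => y ^ (-(5 / 4) : ℝ)) (Set.Ioi y₀) :=
    integrableOn_Ioi_rpow_of_lt (by norm_num) hy₀p
  have hint : Integrable (fun y : ℝ => C * y₀ * ((√q)⁻¹ * y ^ (-2 : ℝ) + q * y ^ (-(5 / 4) : ℝ)))
      (volume.restrict (Set.Ioi y₀)) := ((i1.const_mul _).add (i2.const_mul _)).const_mul _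
  have hle := norm_integral_le_of_norm_le (f := fun y : ℝ =>
    (theta (((p / q + h : ℝ) : ℂ) + y * Complex.I) - 1) / (√y : ℂ) -
      (theta (((p / q : ℝ) : ℂ) + y * Complex.I) - 1) / (√y : ℂ)) hint ?_
  · have hval : ∫ y in Set.Ioi y₀, C * y₀ * ((√q)⁻¹ * y ^ (-2 : ℝ) + q * y ^ (-(5 / 4) : ℝ)) =
        5 * C / √q := by
      rw [integral_const_mul, integral_add (i1.const_mul _) (i2.const_mul _), integral_const_mul,
        integral_const_mul, integral_Ioi_rpow_of_lt (by norm_num) hy₀p,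
        integral_Ioi_rpow_of_lt (by norm_num) hy₀p, hy₀, inv_sq_rpow hqr, inv_sq_rpow hqr]
      have e1 : (q : ℝ) ^ (-2 * (-2 + 1) : ℝ) = q ^ 2 := by
        rw [← Real.rpow_natCast]; norm_num
      have e2 : (q : ℝ) ^ (-2 * (-(5 / 4) + 1) : ℝ) = √q := by
        rw [Real.sqrt_eq_rpow]; norm_num
      rw [e1, e2]
      have hs : 0 < √(q : ℝ) := Real.sqrt_pos.mpr hqr
      have hs2 : √(q : ℝ) * √q = q := Real.mul_self_sqrt hqr.le
      norm_num
      field_simp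
      rw [sq, hs2]; ring
    rw [hval] at hle
    have : ‖(1 / √2 : ℂ)‖ ≤ 1 := by
      rw [norm_div, norm_one, Complex.norm_real, Real.norm_of_nonneg (by positivity)]
      rw [div_le_one (by positivity)]
      exact Real.one_le_sqrt.mpr (by norm_num)
    calc _ ≤ 1 * (5 * C / √q) := by gcongr
      _ = _ := one_mul _
  · refine (ae_restrict_iff' measurableSet_Ioi).mpr (Eventually.of_forall fun y hy => ?_)
    have hy' : y₀ < y := hy
    have hyp : 0 < y := hy₀p.trans hy'
    have hsy : 0 < √y := Real.sqrt_pos.mpr hyp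
    have h1 := H q p hp h y hyp hh hy'.le
    rw [← sub_div, sub_sub_sub_cancel_right, norm_div, Complex.norm_real, Real.norm_of_nonneg hsy.le]
    have e0 : theta (((p / q + h : ℝ) : ℂ) + y * Complex.I) - theta (((p / q : ℝ) : ℂ) + y * Complex.I) =
        theta ((p : ℂ) / q + (h + y * Complex.I)) - theta ((p : ℂ) / q + y * Complex.I) := by
      push_cast; ring_nf
    rw [e0]
    calc _ ≤ C * y₀ * (((√q)⁻¹ * (√y)⁻¹ + q * y ^ (1 / 4 : ℝ)) / y) / √y := by gcongr
      _ = _ := by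
        have e1 : y ^ (-2 : ℝ) = (√y)⁻¹ / y / √y := by
          rw [Real.rpow_neg hyp.le, Real.rpow_two, div_div, mul_comm y, ← div_div,
            div_eq_mul_inv _ (√y), ← mul_inv, Real.mul_self_sqrt hyp.le]
          field_simp
        have e2 : y ^ (-(5 / 4) : ℝ) = y ^ (1 / 4 : ℝ) / y / √y := by
          rw [div_div, eq_div_iff (by positivity), Real.sqrt_eq_rpow]
          nth_rw 2 [← Real.rpow_one y]
          rw [← Real.rpow_add hyp, ← Real.rpow_add hyp]; norm_num
        rw [e1, e2]; ring

/-- The kernel `1 / √(y (y - i h))` is `1 / (y + |h|)` up to an error of bounded integral. -/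
lemma norm_kernel_sub_le (h : ℝ) {y : ℝ} (hy : 0 < y) (hh : h ≠ 0) :
    ‖1 / ((√y : ℂ) * ((y : ℂ) - h * Complex.I) ^ (1 / 2 : ℂ)) - ((1 / (y + |h|) : ℝ) : ℂ)‖ ≤
      2 * (√|h| / (√y * (y + |h|))) := by
  have hh0 : 0 < |h| := abs_pos.mpr hh
  set b : ℂ := (y : ℂ) - h * Complex.I with hb
  have hbre : b.re = y := by simp [hb]
  have hbim : b.im = -h := by simp [hb]
  have hb0 : b ≠ 0 := fun h0 => by rw [h0] at hbre; simp at hbre; linarith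
  set β : ℂ := b ^ (1 / 2 : ℂ) with hβ
  have hβ2 : β ^ 2 = b := csqrt_sq b
  have hβ0 : β ≠ 0 := by rw [hβ]; simp [Complex.cpow_eq_zero_iff, hb0]
  have hβre : 0 ≤ β.re := by
    rw [hβ, Complex.cpow_def_of_ne_zero hb0, Complex.exp_re]
    refine mul_nonneg (Real.exp_pos _).le (Real.cos_nonneg_of_neg_pi_div_two_le_of_le ?_ ?_)
    all_goals
      rw [show Complex.log b * (1 / 2) = ((1 / 2 : ℝ) : ℂ) * Complex.log b by push_cast; ring,
        Complex.im_ofReal_mul, Complex.log_im]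
      have := Complex.neg_pi_lt_arg b
      have := Complex.arg_le_pi b
      linarith
  have hβn : √|h| ≤ ‖β‖ := by
    rw [hβ, norm_csqrt]
    apply Real.sqrt_le_sqrt
    have := Complex.abs_im_le_norm b
    rwa [hbim, abs_neg] at this
  have hs : 0 < √y := Real.sqrt_pos.mpr hy
  have hss : (√y : ℂ) * √y = y := by exact_mod_cast Real.mul_self_sqrt hy.le
  have hsum : √y ≤ ‖(√y : ℂ) + β‖ := by
    refine le_trans ?_ (Complex.re_le_norm _)
    simp only [Complex.add_re, Complex.ofReal_re]; linarith
  have hsum0 : (√y : ℂ) + β ≠ 0 := fun h0 => by rw [h0, norm_zero] at hsum; linarith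
  -- Rationalise: (√y - β)(√y + β) = ih, and Re β ≥ 0 keeps the second factor at least √y in norm.
  have hdiff : √y * ‖(√y : ℂ) - β‖ ≤ |h| := by
    have e : ((√y : ℂ) - β) * (√y + β) = h * Complex.I := by
      linear_combination hss - hβ2 - hb
    have e' : ‖(√y : ℂ) - β‖ * ‖(√y : ℂ) + β‖ = |h| := by
      rw [← norm_mul, e, norm_mul, Complex.norm_I, Complex.norm_real, Real.norm_eq_abs, mul_one]
    nlinarith [norm_nonneg ((√y : ℂ) - β)]
  have hnum : ‖(y : ℂ) + |h| - √y * β‖ ≤ 2 * |h| := by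
    calc ‖(y : ℂ) + |h| - √y * β‖ = ‖((|h| : ℝ) : ℂ) + √y * ((√y : ℂ) - β)‖ := by
          congr 1; rw [mul_sub, hss]; ring
      _ ≤ |h| + √y * ‖(√y : ℂ) - β‖ := by
          refine (norm_add_le _ _).trans ?_
          rw [norm_mul, Complex.norm_real, Complex.norm_real, Real.norm_of_nonneg hs.le,
            Real.norm_of_nonneg hh0.le]
      _ ≤ _ := by linarith
  have hyh : 0 < y + |h| := by positivity
  have hyc : ((y : ℂ) + |h|) ≠ 0 := by exact_mod_cast hyh.ne'
  have hsc : (√y : ℂ) ≠ 0 := by exact_mod_cast hs.ne'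
  have e3 : 1 / ((√y : ℂ) * β) - ((1 / (y + |h|) : ℝ) : ℂ) =
      ((y : ℂ) + |h| - √y * β) / (√y * β * ((y : ℂ) + |h|)) := by
    push_cast; field_simp
  have hn : ‖(y : ℂ) + |h|‖ = y + |h| := by
    rw [← Complex.ofReal_add, Complex.norm_real, Real.norm_of_nonneg hyh.le]
  rw [e3, norm_div, norm_mul, norm_mul, Complex.norm_real, Real.norm_of_nonneg hs.le, hn]
  have hsh : 0 < √|h| := Real.sqrt_pos.mpr hh0
  calc ‖(y : ℂ) + |h| - √y * β‖ / (√y * ‖β‖ * (y + |h|))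
      ≤ (2 * |h|) / (√y * √|h| * (y + |h|)) := by gcongr
    _ = 2 * (√|h| / (√y * (y + |h|))) := by
      have : √|h| * √|h| = |h| := Real.mul_self_sqrt hh0.le
      field_simp
      rw [sq, this]

/-- The integrand is scale invariant, with antiderivative 2 arctan √(y/h); hence a bound free of h
and of the endpoints. -/
lemma integral_kernel_error_le {h y₀ y₁ : ℝ} (hh : 0 < h) (h0 : 0 < y₀) (h1 : y₀ ≤ y₁) :
    IntervalIntegrable (fun y => √h / (√y * (y + h))) volume y₀ y₁ ∧
      ∫ y in y₀..y₁, √h / (√y * (y + h)) ≤ 2 * Real.pi := by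
  have hpos : ∀ y ∈ Set.uIcc y₀ y₁, 0 < y := fun y hy => by
    rw [Set.uIcc_of_le h1] at hy; exact h0.trans_le hy.1
  have hcont : ContinuousOn (fun y => √h / (√y * (y + h))) (Set.uIcc y₀ y₁) := by
    refine ContinuousOn.div (by fun_prop) (by fun_prop) fun y hy => ?_
    have := hpos y hy
    have := Real.sqrt_pos.mpr this
    positivity
  refine ⟨hcont.intervalIntegrable, ?_⟩
  have hd : ∀ y ∈ Set.uIcc y₀ y₁,
      HasDerivAt (fun y => 2 * Real.arctan (√(y / h))) (√h / (√y * (y + h))) y := by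
    intro y hy
    have hy0 := hpos y hy
    have hyh : 0 < y / h := div_pos hy0 hh
    have d1 : HasDerivAt (fun y : ℝ => y / h) (1 / h) y := (hasDerivAt_id y).div_const h
    have d2 := ((d1.sqrt hyh.ne').arctan).const_mul 2
    refine d2.congr_deriv ?_
    rw [Real.sq_sqrt hyh.le, Real.sqrt_div hy0.le]
    have s1 : 0 < √h := Real.sqrt_pos.mpr hh
    have s2 : 0 < √y := Real.sqrt_pos.mpr hy0
    have s3 : √h * √h = h := Real.mul_self_sqrt hh.le
    field_simp
    ring
  rw [intervalIntegral.integral_eq_sub_of_hasDerivAt hd hcont.intervalIntegrable]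
  have := Real.arctan_lt_pi_div_two (√(y₁ / h))
  have := Real.neg_pi_div_two_lt_arctan (√(y₀ / h))
  linarith

lemma abs_log_sub_log_le {r s : ℝ} (hs : 0 < s) (h1 : r ≤ 4 * s) (h2 : s ≤ 4 * r) :
    |Real.log r - Real.log s| ≤ 2 := by
  have hr : 0 < r := by linarith
  have h4 : Real.log 4 ≤ 2 := by
    rw [show (4 : ℝ) = 2 ^ 2 by norm_num, Real.log_pow]
    have := Real.log_two_lt_d9
    push_cast; linarith
  have a1 := Real.log_le_log hr h1
  have a2 := Real.log_le_log hs h2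
  rw [Real.log_mul (by norm_num) hs.ne'] at a1
  rw [Real.log_mul (by norm_num) hr.ne'] at a2
  rw [abs_le]; constructor <;> linarith

lemma thetaInt_sub {y₀ y₁ : ℝ} (h0 : 0 < y₀) (h1 : y₀ ≤ y₁) (x : ℝ) :
    IntervalIntegrable (fun y : ℝ => (theta (x + y * Complex.I) - 1) / (√y : ℂ)) volume y₀ y₁ ∧
    thetaInt y₀ x - thetaInt y₁ x =
      1 / √2 * ∫ y in y₀..y₁, (theta (x + y * Complex.I) - 1) / (√y : ℂ) := by
  have i0 := integrableOn_thetaInt h0 x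
  have i1 := integrableOn_thetaInt (h0.trans_le h1) x
  have i2 : IntegrableOn (fun y : ℝ => (theta (x + y * Complex.I) - 1) / (√y : ℂ)) (Set.Ioc y₀ y₁) :=
    i0.mono_set Set.Ioc_subset_Ioi_self
  refine ⟨(intervalIntegrable_iff_integrableOn_Ioc_of_le h1).mpr i2, ?_⟩
  rw [thetaInt, thetaInt, ← mul_sub, ← Set.Ioc_union_Ioi_eq_Ioi h1,
    setIntegral_union (Set.Ioc_disjoint_Ioi le_rfl) measurableSet_Ioi i2 i1,
    intervalIntegral.integral_of_le h1]
  ring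

lemma norm_gaussSum_div_le {q : ℕ} [NeZero q] {p : ℤ} (hp : IsUnit (p : ZMod q)) :
    ‖gaussSum q p 0 / (2 * q)‖ ≤ (√q)⁻¹ := by
  have hqr : (0 : ℝ) < q := Nat.cast_pos.mpr (NeZero.pos q)
  have hs : 0 < √(q : ℝ) := Real.sqrt_pos.mpr hqr
  have hss : √(q : ℝ) * √q = q := Real.mul_self_sqrt hqr.le
  rw [norm_div, norm_mul, Complex.norm_natCast, Complex.norm_ofNat]
  calc ‖gaussSum q p 0‖ / (2 * q) ≤ √(2 * q) / (2 * q) := by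
        gcongr; exact norm_gaussSum_le hp 0
    _ ≤ (2 * √q) / (2 * q) := by
        gcongr
        rw [Real.sqrt_mul (by norm_num)]
        gcongr
        rw [Real.sqrt_le_left (by norm_num)]; norm_num
    _ = (√q)⁻¹ := by
        rw [mul_div_mul_left _ _ two_ne_zero, inv_eq_one_div, div_eq_div_iff hqr.ne' hs.ne', hss,
          one_mul]

/-- Three errors are added: replacing θ by its leading term (the first two summands), dropping the
constant -1 (the third), and replacing the complex kernel by 1/(y + |h|) (the last). -/
lemma norm_thetaInt_integrand_sub_le {C : ℝ} {q : ℕ} [NeZero q] {p : ℤ} (hp : IsUnit (p : ZMod q))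
    {h y : ℝ} (hh0 : 0 < |h|) (hyp : 0 < y)
    (h1 : ‖theta ((p : ℂ) / q + (h + y * Complex.I)) -
        gaussSum q p 0 / (√2 * q * ((y : ℂ) - h * Complex.I) ^ (1 / 2 : ℂ))‖
        ≤ C * (q * (|h| + y) * y ^ (-(3 / 4) : ℝ))) :
    ‖1 / (√2 : ℂ) * ((theta (((p / q + h : ℝ) : ℂ) + y * Complex.I) - 1) / (√y : ℂ)) -
      gaussSum q p 0 / (2 * q) * ((1 / (y + |h|) : ℝ) : ℂ)‖ ≤
    C * q * y ^ (-(1 / 4) : ℝ) + C * q * |h| * y ^ (-(5 / 4) : ℝ) +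
    y ^ (-(1 / 2) : ℝ) + 2 * (√q)⁻¹ * (√|h| / (√y * (y + |h|))) := by
  have hgn := norm_gaussSum_div_le hp
  have hqr : (0 : ℝ) < q := Nat.cast_pos.mpr (NeZero.pos q)
  have hs : 0 < √(q : ℝ) := Real.sqrt_pos.mpr hqr
  have harg : ((p / q + h : ℝ) : ℂ) + y * Complex.I = (p : ℂ) / q + (h + y * Complex.I) := by
    push_cast; ring
  rw [harg]
  have hsy : 0 < √y := Real.sqrt_pos.mpr hyp
  set b : ℂ := (y : ℂ) - h * Complex.I with hb
  set θ := theta ((p : ℂ) / q + (h + y * Complex.I)) with hθ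
  have h2 := norm_kernel_sub_le h hyp (abs_pos.mp hh0)
  have e1 : 1 / (√2 : ℂ) * ((θ - 1) / (√y : ℂ)) -
      gaussSum q p 0 / (2 * q) * ((1 / (y + |h|) : ℝ) : ℂ) =
      (1 / (√2 : ℂ)) * ((θ - gaussSum q p 0 / (√2 * q * b ^ (1 / 2 : ℂ))) / (√y : ℂ)) -
      (1 / (√2 : ℂ)) * (1 / (√y : ℂ)) +
      gaussSum q p 0 / (2 * q) *
        (1 / ((√y : ℂ) * b ^ (1 / 2 : ℂ)) - ((1 / (y + |h|) : ℝ) : ℂ)) := by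
    have h22 : (√2 : ℂ) * √2 = 2 := by exact_mod_cast Real.mul_self_sqrt (by norm_num : (0:ℝ) ≤ 2)
    rw [← h22]
    simp only [div_eq_mul_inv, mul_inv]; ring
  have hn2 : ‖(1 / √2 : ℂ)‖ ≤ 1 := by
    rw [norm_div, norm_one, Complex.norm_real, Real.norm_of_nonneg (by positivity)]
    rw [div_le_one (by positivity)]
    exact Real.one_le_sqrt.mpr (by norm_num)
  have hinv : (√y)⁻¹ = y ^ (-(1 / 2) : ℝ) := by
    rw [Real.rpow_neg hyp.le, Real.sqrt_eq_rpow]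
  have t1 : ‖(1 / (√2 : ℂ)) * ((θ - gaussSum q p 0 / (√2 * q * b ^ (1 / 2 : ℂ))) / (√y : ℂ))‖ ≤
      C * q * y ^ (-(1 / 4) : ℝ) + C * q * |h| * y ^ (-(5 / 4) : ℝ) := by
    rw [norm_mul, norm_div _ (√y : ℂ), Complex.norm_real √y, Real.norm_of_nonneg hsy.le]
    calc _ ≤ 1 * (C * (q * (|h| + y) * y ^ (-(3 / 4) : ℝ)) / √y) := by gcongr
      _ = C * q * (y * (y ^ (-(3 / 4) : ℝ) * y ^ (-(1 / 2) : ℝ))) +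
          C * q * |h| * (y ^ (-(3 / 4) : ℝ) * y ^ (-(1 / 2) : ℝ)) := by
        rw [← hinv]; ring
      _ = _ := by
        rw [← Real.rpow_add hyp]
        nth_rw 1 [← Real.rpow_one y]
        rw [← Real.rpow_add hyp]; norm_num
  have t2 : ‖(1 / (√2 : ℂ)) * (1 / (√y : ℂ))‖ ≤ y ^ (-(1 / 2) : ℝ) := by
    rw [norm_mul, ← hinv, norm_div _ (√y : ℂ), norm_one, Complex.norm_real √y, Real.norm_of_nonneg hsy.le,
      one_div (√y)]
    exact mul_le_of_le_one_left (by positivity) hn2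
  have t3 : ‖gaussSum q p 0 / (2 * q) * (1 / ((√y : ℂ) * b ^ (1 / 2 : ℂ)) - ((1 / (y + |h|) : ℝ) : ℂ))‖ ≤
      2 * (√q)⁻¹ * (√|h| / (√y * (y + |h|))) := by
    rw [norm_mul]
    calc _ ≤ (√q)⁻¹ * (2 * (√|h| / (√y * (y + |h|)))) :=
          mul_le_mul hgn h2 (norm_nonneg _) (by positivity)
      _ = _ := by ring
  rw [e1]
  exact (norm_add_le _ _).trans (add_le_add ((norm_sub_le _ _).trans (add_le_add t1 t2)) t3)

/-- Only the power y^{-5/4} is large at the lower endpoint, where it integrates to about √q'; the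
factor q|h| ≤ 1/q' compensates for this. -/
lemma integral_error_le {C : ℝ} (hC : 0 < C) {q q' h : ℝ} (hq1 : 1 ≤ q) (hqq' : q ≤ q')
    (hh0 : 0 < |h|) (hh2 : |h| ≤ 1 / (q * q')) :
    IntervalIntegrable (fun y => C * q * y ^ (-(1 / 4) : ℝ) + C * q * |h| * y ^ (-(5 / 4) : ℝ) +
      y ^ (-(1 / 2) : ℝ) + 2 * (√q)⁻¹ * (√|h| / (√y * (y + |h|)))) volume (q' ^ 2)⁻¹ (q ^ 2)⁻¹ ∧
    ∫ y in (q' ^ 2)⁻¹..(q ^ 2)⁻¹, (C * q * y ^ (-(1 / 4) : ℝ) + C * q * |h| * y ^ (-(5 / 4) : ℝ) +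
      y ^ (-(1 / 2) : ℝ) + 2 * (√q)⁻¹ * (√|h| / (√y * (y + |h|)))) ≤
        (6 * C + 4 * Real.pi + 2) / √q := by
  have hqr : (0 : ℝ) < q := by linarith
  have hqr' : (0 : ℝ) < q' := hqr.trans_le hqq'
  have hs : 0 < √(q : ℝ) := Real.sqrt_pos.mpr hqr
  have hss : √(q : ℝ) * √q = q := Real.mul_self_sqrt hqr.le
  obtain ⟨y₀, hy₀⟩ : ∃ y₀, y₀ = (q' ^ 2)⁻¹ := ⟨_, rfl⟩
  obtain ⟨y₁, hy₁⟩ : ∃ y₁, y₁ = (q ^ 2)⁻¹ := ⟨_, rfl⟩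
  rw [← hy₀, ← hy₁]
  have hy₀p : 0 < y₀ := by rw [hy₀]; positivity
  have hy₁p : 0 < y₁ := by rw [hy₁]; positivity
  have hle : y₀ ≤ y₁ := by rw [hy₀, hy₁]; gcongr
  have hnot : (0 : ℝ) ∉ Set.uIcc y₀ y₁ := fun h0 => by
    rw [Set.uIcc_of_le hle] at h0; exact absurd h0.1 (not_le.mpr hy₀p)
  obtain ⟨hk1, hk2⟩ := integral_kernel_error_le hh0 hy₀p hle
  have j1 : IntervalIntegrable (fun y : ℝ => y ^ (-(1 / 4) : ℝ)) volume y₀ y₁ :=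
    intervalIntegral.intervalIntegrable_rpow (Or.inr hnot)
  have j2 : IntervalIntegrable (fun y : ℝ => y ^ (-(5 / 4) : ℝ)) volume y₀ y₁ :=
    intervalIntegral.intervalIntegrable_rpow (Or.inr hnot)
  have j3 : IntervalIntegrable (fun y : ℝ => y ^ (-(1 / 2) : ℝ)) volume y₀ y₁ :=
    intervalIntegral.intervalIntegrable_rpow (Or.inr hnot)
  refine ⟨(((j1.const_mul _).add (j2.const_mul _)).add j3).add (hk1.const_mul _), ?_⟩
  rw [intervalIntegral.integral_add (((j1.const_mul _).add (j2.const_mul _)).add j3) (hk1.const_mul _),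
    intervalIntegral.integral_add ((j1.const_mul _).add (j2.const_mul _)) j3,
    intervalIntegral.integral_add (j1.const_mul _) (j2.const_mul _),
    intervalIntegral.integral_const_mul, intervalIntegral.integral_const_mul,
    intervalIntegral.integral_const_mul, integral_rpow (Or.inr ⟨by norm_num, hnot⟩),
    integral_rpow (Or.inr ⟨by norm_num, hnot⟩), integral_rpow (Or.inr ⟨by norm_num, hnot⟩)]
  have q3 : (q : ℝ) * (√q)⁻¹ * (√q)⁻¹ = 1 := by
    rw [mul_assoc, ← mul_inv, hss, mul_inv_cancel₀ hqr.ne']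
  have a1 : C * q * ((y₁ ^ (-(1 / 4) + 1 : ℝ) - y₀ ^ (-(1 / 4) + 1 : ℝ)) / (-(1 / 4) + 1)) ≤
      2 * C / √q := by
    have : (y₁ ^ (-(1 / 4) + 1 : ℝ)) = (q : ℝ)⁻¹ * (√q)⁻¹ := by
      rw [hy₁, inv_sq_rpow hqr, Real.sqrt_eq_rpow, ← Real.rpow_neg_one, ← Real.rpow_neg hqr.le,
        ← Real.rpow_add hqr]; norm_num
    rw [this]
    have h0 : 0 ≤ y₀ ^ (-(1 / 4) + 1 : ℝ) := by positivity
    calc _ ≤ C * q * (((q : ℝ)⁻¹ * (√q)⁻¹) / (-(1 / 4) + 1)) := by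
          gcongr; linarith
      _ = (4 / 3) * C / √q := by norm_num; field_simp
      _ ≤ _ := by gcongr; norm_num
  have a2 : C * q * |h| * ((y₁ ^ (-(5 / 4) + 1 : ℝ) - y₀ ^ (-(5 / 4) + 1 : ℝ)) / (-(5 / 4) + 1)) ≤
      4 * C / √q := by
    have : (y₀ ^ (-(5 / 4) + 1 : ℝ)) = √q' := by
      rw [hy₀, inv_sq_rpow hqr', Real.sqrt_eq_rpow]; norm_num
    rw [this]
    have h0 : 0 ≤ y₁ ^ (-(5 / 4) + 1 : ℝ) := by positivity
    calc _ = C * q * |h| * (4 * (√q' - y₁ ^ (-(5 / 4) + 1 : ℝ))) := by ring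
      _ ≤ C * q * (1 / (q * q')) * (4 * √q') := by
          have : √(q' : ℝ) - y₁ ^ (-(5 / 4) + 1 : ℝ) ≤ √q' := by linarith
          have h3 : C * q * |h| ≤ C * q * (1 / (q * q')) := by gcongr
          have h4 : 0 ≤ C * q * |h| := by positivity
          have h5 : 0 ≤ √(q' : ℝ) := by positivity
          calc _ ≤ C * q * |h| * (4 * √q') := by gcongr
            _ ≤ _ := by gcongr
      _ = 4 * C / √q' := by
          have : √(q' : ℝ) * √q' = q' := Real.mul_self_sqrt hqr'.le
          have hs' : 0 < √(q' : ℝ) := Real.sqrt_pos.mpr hqr'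
          field_simp
          rw [sq, this]
      _ ≤ _ := by gcongr
  have a3 : ((y₁ ^ (-(1 / 2) + 1 : ℝ) - y₀ ^ (-(1 / 2) + 1 : ℝ)) / (-(1 / 2) + 1)) ≤ 2 / √q := by
    have : (y₁ ^ (-(1 / 2) + 1 : ℝ)) = (q : ℝ)⁻¹ := by
      rw [hy₁, inv_sq_rpow hqr, ← Real.rpow_neg_one]; norm_num
    rw [this]
    have h0 : 0 ≤ y₀ ^ (-(1 / 2) + 1 : ℝ) := by positivity
    have h1 : (q : ℝ)⁻¹ ≤ (√q)⁻¹ := by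
      gcongr
      rw [Real.sqrt_le_left (by positivity)]
      nlinarith
    calc _ ≤ (√q)⁻¹ / (-(1 / 2) + 1) := by gcongr; linarith
      _ = 2 / √q := by norm_num; field_simp
  have a4 : 2 * (√q)⁻¹ * ∫ y in y₀..y₁, √|h| / (√y * (y + |h|)) ≤ 4 * Real.pi / √q := by
    calc _ ≤ 2 * (√q)⁻¹ * (2 * Real.pi) := by gcongr
      _ = _ := by field_simp; ring
  calc _ ≤ 2 * C / √q + 4 * C / √q + 2 / √q + 4 * Real.pi / √q :=
        add_le_add (add_le_add (add_le_add a1 a2) a3) a4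
    _ = _ := by ring

/-- The part of the vertical integral that is governed by the rational point `p / q`. -/
lemma thetaInt_step : ∃ C : ℝ, 0 < C ∧ ∀ (q q' : ℕ) [NeZero q] (p : ℤ), IsUnit (p : ZMod q) →
    q ≤ q' → ∀ h : ℝ, 1 / (2 * (q * q')) ≤ |h| → |h| ≤ 1 / (q * q') →
      ‖thetaInt ((q' : ℝ) ^ 2)⁻¹ (p / q + h) - thetaInt ((q : ℝ) ^ 2)⁻¹ (p / q + h) -
        gaussSum q p 0 / (2 * q) * Real.log (q' / q)‖ ≤ C / √q := by
  obtain ⟨C, hC, H⟩ := theta_near_rational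
  refine ⟨6 * C + 4 * Real.pi + 4, by positivity, fun q q' _ p hp hqq h hh1 hh2 => ?_⟩
  have hqr : (0 : ℝ) < q := Nat.cast_pos.mpr (NeZero.pos q)
  have hqq' : (q : ℝ) ≤ q' := Nat.cast_le.mpr hqq
  have hqr' : (0 : ℝ) < q' := hqr.trans_le hqq'
  have hh0 : 0 < |h| := lt_of_lt_of_le (by positivity) hh1
  have hs : 0 < √(q : ℝ) := Real.sqrt_pos.mpr hqr
  have hss : √(q : ℝ) * √q = q := Real.mul_self_sqrt hqr.le
  set y₀ : ℝ := ((q' : ℝ) ^ 2)⁻¹ with hy₀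
  set y₁ : ℝ := ((q : ℝ) ^ 2)⁻¹ with hy₁
  have hy₀p : 0 < y₀ := by positivity
  have hy₁p : 0 < y₁ := by positivity
  have hle : y₀ ≤ y₁ := by rw [hy₀, hy₁]; gcongr
  set g : ℂ := gaussSum q p 0 / (2 * q) with hg
  have hgn : ‖g‖ ≤ (√q)⁻¹ := norm_gaussSum_div_le hp
  obtain ⟨hfi, hfe⟩ := thetaInt_sub hy₀p hle (p / q + h)
  rw [hfe]
  set f : ℝ → ℂ := fun y : ℝ => (theta (((p / q + h : ℝ) : ℂ) + y * Complex.I) - 1) / (√y : ℂ) with hf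
  have hmem : ∀ y ∈ Set.uIcc y₀ y₁, 0 < y := fun y hy => by
    rw [Set.uIcc_of_le hle] at hy; exact hy₀p.trans_le hy.1
  have hkc : ContinuousOn (fun y : ℝ => 1 / (y + |h|)) (Set.uIcc y₀ y₁) := by
    refine ContinuousOn.div (by fun_prop) (by fun_prop) fun y hy => ?_
    have := hmem y hy
    positivity
  have hki : IntervalIntegrable (fun y : ℝ => ((1 / (y + |h|) : ℝ) : ℂ)) volume y₀ y₁ :=
    (Complex.continuous_ofReal.comp_continuousOn hkc).intervalIntegrable
  have hkv : ∫ y in y₀..y₁, ((1 / (y + |h|) : ℝ) : ℂ) = Real.log ((y₁ + |h|) / (y₀ + |h|)) := by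
    rw [intervalIntegral.integral_ofReal]
    congr 1
    have := intervalIntegral.integral_comp_add_right (a := y₀) (b := y₁) (fun y : ℝ => 1 / y) |h|
    rw [this, integral_one_div_of_pos (by positivity) (by positivity)]
  obtain ⟨hBi, hBv⟩ := integral_error_le hC (by exact_mod_cast NeZero.pos q : (1 : ℝ) ≤ q) hqq' hh0 hh2
  have hpt : ∀ y ∈ Set.Ioc y₀ y₁, ‖1 / (√2 : ℂ) * f y - g * ((1 / (y + |h|) : ℝ) : ℂ)‖ ≤
      C * q * y ^ (-(1 / 4) : ℝ) + C * q * |h| * y ^ (-(5 / 4) : ℝ) +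
      y ^ (-(1 / 2) : ℝ) + 2 * (√q)⁻¹ * (√|h| / (√y * (y + |h|))) := fun y hy =>
    norm_thetaInt_integrand_sub_le hp hh0 (hy₀p.trans hy.1) (H q p hp h y (hy₀p.trans hy.1))
  have hmain := intervalIntegral.norm_integral_le_of_norm_le
    (f := fun y => 1 / (√2 : ℂ) * f y - g * ((1 / (y + |h|) : ℝ) : ℂ)) hle
    (Eventually.of_forall hpt) hBi
  rw [intervalIntegral.integral_sub (hfi.const_mul _) (hki.const_mul _),
    intervalIntegral.integral_const_mul, intervalIntegral.integral_const_mul, hkv] at hmain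
  -- Up to factors of 2, y₁ + |h| is 1/q² and y₀ + |h| is 1/(qq'), so their ratio is q'/q within a
  -- factor 4.
  have hlog : |Real.log ((y₁ + |h|) / (y₀ + |h|)) - Real.log (q' / q)| ≤ 2 := by
    have hy01 : y₀ ≤ 1 / (q * q') := by
      rw [hy₀, ← one_div]; gcongr; nlinarith
    have hh3 : |h| ≤ y₁ := by
      refine hh2.trans ?_
      rw [hy₁, ← one_div]; gcongr; nlinarith
    refine abs_log_sub_log_le (by positivity) ?_ ?_
    · calc (y₁ + |h|) / (y₀ + |h|) ≤ (2 * y₁) / (1 / (2 * (q * q'))) := by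
            gcongr <;> linarith
        _ = 4 * (q' / q) := by rw [hy₁]; field_simp; norm_num
    · calc (q' : ℝ) / q = 2 * (y₁ / (2 * (1 / (q * q')))) := by rw [hy₁]; field_simp
        _ ≤ 2 * ((y₁ + |h|) / (y₀ + |h|)) := by
            gcongr <;> linarith
        _ ≤ 4 * ((y₁ + |h|) / (y₀ + |h|)) := by gcongr; norm_num
  calc _ = ‖(1 / (√2 : ℂ) * (∫ y in y₀..y₁, f y) - g * Real.log ((y₁ + |h|) / (y₀ + |h|))) +
        g * ((Real.log ((y₁ + |h|) / (y₀ + |h|)) - Real.log (q' / q) : ℝ) : ℂ)‖ := by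
        congr 1; push_cast; ring
    _ ≤ (6 * C + 4 * Real.pi + 2) / √q + (√q)⁻¹ * 2 := by
        refine (norm_add_le _ _).trans (add_le_add (hmain.trans hBv) ?_)
        rw [norm_mul, Complex.norm_real, Real.norm_eq_abs]
        gcongr
    _ = _ := by field_simp; ring

/-! ### Summation of the series by the vertical integrals -/

/-- A regular summation method with monotone weights sums a convergent series to its limit. -/
lemma tendsto_tsum_of_antitone_weights {ι : Type*} {l : Filter ι} {a : ℕ → ℂ} {s : ℂ}
    (ha : Tendsto (fun N => ∑ n ∈ Finset.range N, a n) atTop (𝓝 s)) {c : ι → ℕ → ℝ}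
    (hanti : ∀ i, Antitone (c i)) (h0 : ∀ i n, 0 ≤ c i n) (h1 : ∀ i n, c i n ≤ 1)
    (hsum : ∀ i, Summable fun n => (c i n : ℂ) * a n)
    (hlim : ∀ n, Tendsto (fun i => c i n) l (𝓝 1)) :
    Tendsto (fun i => ∑' n, (c i n : ℂ) * a n) l (𝓝 s) := by
  rw [Metric.tendsto_nhds]
  intro ε hε
  set r : ℕ → ℂ := fun N => ∑ n ∈ Finset.range N, a n - s with hr
  have hr0 : Tendsto r atTop (𝓝 0) := by
    have := ha.sub_const s
    rwa [sub_self] at this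
  obtain ⟨M, hM⟩ : ∃ M, ∀ n ≥ M, ‖r n‖ ≤ ε / 5 := by
    have := (Metric.tendsto_atTop.mp hr0) (ε / 5) (by positivity)
    obtain ⟨M, hM⟩ := this
    exact ⟨M, fun n hn => by have := hM n hn; rw [dist_zero_right] at this; exact this.le⟩
  -- Abel summation as an induction: each step adds (c_N - c_{N+1}) r_{N+1}, and the monotone
  -- weights telescope in the bound.
  have tail : ∀ i, ∀ N ≥ M, ‖∑ n ∈ Finset.Ico M N, (c i n : ℂ) * a n - c i N * r N‖ ≤
      ε / 5 * (2 * c i M - c i N) := by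
    intro i N hN
    induction N, hN using Nat.le_induction with
    | base =>
      simp only [Finset.Ico_self, Finset.sum_empty, zero_sub, norm_neg, norm_mul, Complex.norm_real,
        Real.norm_of_nonneg (h0 i M)]
      have := hM M le_rfl
      nlinarith [h0 i M]
    | succ N hN ih =>
      have ha' : a N = r (N + 1) - r N := by
        simp only [hr, Finset.sum_range_succ]; ring
      rw [Finset.sum_Ico_succ_top hN]
      have e : ∑ n ∈ Finset.Ico M N, (c i n : ℂ) * a n + c i N * a N - c i (N + 1) * r (N + 1) =
          (∑ n ∈ Finset.Ico M N, (c i n : ℂ) * a n - c i N * r N) +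
            ((c i N - c i (N + 1) : ℝ) : ℂ) * r (N + 1) := by
        rw [ha']; push_cast; ring
      rw [e]
      have hd : 0 ≤ c i N - c i (N + 1) := sub_nonneg.mpr (hanti i (Nat.le_succ N))
      refine (norm_add_le _ _).trans ?_
      rw [norm_mul, Complex.norm_real, Real.norm_of_nonneg hd]
      have := hM (N + 1) (by omega)
      nlinarith
  have tail' : ∀ i, ∀ N ≥ M, ‖∑ n ∈ Finset.Ico M N, (c i n : ℂ) * a n‖ ≤ 2 * (ε / 5) := by
    intro i N hN
    have h2 := tail i N hN
    have h3 : ‖(c i N : ℂ) * r N‖ ≤ ε / 5 * c i N := by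
      rw [norm_mul, Complex.norm_real, Real.norm_of_nonneg (h0 i N), mul_comm]
      exact mul_le_mul_of_nonneg_right (hM N hN) (h0 i N)
    have h4 := norm_le_norm_add_norm_sub' (∑ n ∈ Finset.Ico M N, (c i n : ℂ) * a n) (c i N * r N)
    nlinarith [h1 i M]
  have tail'' : ∀ i, ‖∑' n, (c i n : ℂ) * a n - ∑ n ∈ Finset.range M, (c i n : ℂ) * a n‖ ≤
      2 * (ε / 5) := by
    intro i
    have ht := (hsum i).hasSum.tendsto_sum_nat.sub_const (∑ n ∈ Finset.range M, (c i n : ℂ) * a n)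
    refine le_of_tendsto ht.norm ?_
    filter_upwards [eventually_ge_atTop M] with N hN
    rw [← Finset.sum_Ico_eq_sub _ hN]
    exact tail' i N hN
  have head : Tendsto (fun i => ∑ n ∈ Finset.range M, (c i n : ℂ) * a n) l
      (𝓝 (∑ n ∈ Finset.range M, a n)) := by
    refine tendsto_finsetSum _ fun n _ => ?_
    have := ((Complex.continuous_ofReal.tendsto 1).comp (hlim n)).mul_const (a n)
    simpa using this
  have head' := (Metric.tendsto_nhds.mp head) (ε / 5) (by positivity)
  filter_upwards [head'] with i hi
  rw [dist_eq_norm] at hi ⊢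
  have h5 := hM M le_rfl
  have e : ∑' n, (c i n : ℂ) * a n - s = (∑' n, (c i n : ℂ) * a n -
      ∑ n ∈ Finset.range M, (c i n : ℂ) * a n) + (∑ n ∈ Finset.range M, (c i n : ℂ) * a n -
      ∑ n ∈ Finset.range M, a n) + r M := by simp only [hr]; ring
  rw [e]
  have := tail'' i
  calc _ ≤ _ := norm_add₃_le
    _ < ε := by linarith

/-- The incomplete Gamma weight `∫_s^∞ e^{-2πv} v^{-1/2} dv`. -/
noncomputable def gammaTail (s : ℝ) : ℝ :=
  ∫ v in Set.Ioi s, Real.exp (-(2 * Real.pi * v)) / √v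

lemma gammaTail_integrand (v : ℝ) : Real.exp (-(2 * Real.pi * v)) / √v =
    v ^ ((1 / 2 : ℝ) - 1) * Real.exp (-(2 * Real.pi * v)) ∨ v < 0 := by
  rcases lt_or_ge v 0 with hv | hv
  · exact Or.inr hv
  · left
    rw [div_eq_mul_inv, mul_comm, Real.sqrt_eq_rpow, ← Real.rpow_neg hv]
    norm_num

lemma integrableOn_gammaTail : IntegrableOn (fun v : ℝ => Real.exp (-(2 * Real.pi * v)) / √v)
    (Set.Ioi 0) := by
  have h := integrableOn_rpow_mul_exp_neg_mul_rpow (p := 1) (s := (1 / 2 : ℝ) - 1) (by norm_num)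
    zero_lt_one (by positivity : 0 < 2 * Real.pi)
  refine h.congr_fun (fun v hv => ?_) measurableSet_Ioi
  have hv' : (0 : ℝ) < v := hv
  rcases gammaTail_integrand v with h1 | h1
  · simp only [h1, Real.rpow_one, neg_mul]
  · linarith

/-- Γ(1/2) = √π. This is the normalisation behind the factor 1/√2 in `thetaInt`: the full weight of
each term is 1. -/
lemma gammaTail_zero : √2 * gammaTail 0 = 1 := by
  have h := Real.integral_rpow_mul_exp_neg_mul_Ioi (a := 1 / 2) (by norm_num)
    (by positivity : 0 < 2 * Real.pi)
  have h2 : gammaTail 0 = ∫ t in Set.Ioi (0 : ℝ),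
      t ^ ((1 / 2 : ℝ) - 1) * Real.exp (-(2 * Real.pi * t)) := by
    refine setIntegral_congr_fun measurableSet_Ioi fun v hv => ?_
    have hv' : (0 : ℝ) < v := hv
    rcases gammaTail_integrand v with h1 | h1
    · exact h1
    · linarith
  rw [h2, h, Real.Gamma_one_half_eq, ← Real.sqrt_eq_rpow, one_div, Real.sqrt_inv,
    Real.sqrt_mul (by norm_num)]
  have : 0 < √Real.pi := Real.sqrt_pos.mpr Real.pi_pos
  field_simp

lemma gammaTail_nonneg (s : ℝ) : 0 ≤ gammaTail s :=
  setIntegral_nonneg measurableSet_Ioi fun v _ => by positivity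

lemma gammaTail_anti {s t : ℝ} (hs : 0 ≤ s) (hst : s ≤ t) : gammaTail t ≤ gammaTail s := by
  refine setIntegral_mono_set (integrableOn_gammaTail.mono_set (Set.Ioi_subset_Ioi hs))
    (Eventually.of_forall fun v => by positivity) ?_
  exact (Set.Ioi_subset_Ioi hst).eventuallyLE

lemma tendsto_gammaTail {ι : Type*} {l : Filter ι} [l.IsCountablyGenerated] {a : ι → ℝ}
    (ha : Tendsto a l (𝓝 0)) (hpos : ∀ i, 0 ≤ a i) :
    Tendsto (fun i => √2 * gammaTail (a i)) l (𝓝 1) := by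
  rw [← gammaTail_zero]
  refine Tendsto.const_mul _ ?_
  have h := (aecover_Ioi_of_Ioi (μ := volume) ha).integral_tendsto_of_countably_generated
    integrableOn_gammaTail
  refine h.congr fun i => ?_
  rw [gammaTail, Measure.restrict_restrict measurableSet_Ioi,
    Set.inter_eq_left.mpr (Set.Ioi_subset_Ioi (hpos i))]

/-- From e^{-2πv} ≤ 1/v. At s = n²y₀ this supplies the extra factor 1/n that makes the weighted
series absolutely convergent. -/
lemma gammaTail_le {s : ℝ} (hs : 0 < s) : gammaTail s ≤ 2 / √s := by
  have h : ∫ v in Set.Ioi s, v ^ (-(3 / 2) : ℝ) = 2 / √s := by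
    rw [integral_Ioi_rpow_of_lt (by norm_num) hs, Real.sqrt_eq_rpow, ]
    norm_num
    rw [Real.rpow_neg hs.le]; ring
  rw [← h]
  refine setIntegral_mono_on (integrableOn_gammaTail.mono_set (Set.Ioi_subset_Ioi hs.le))
    (integrableOn_Ioi_rpow_of_lt (by norm_num) hs) measurableSet_Ioi fun v hv => ?_
  have hv' : 0 < v := hs.trans hv
  have hsv : 0 < √v := Real.sqrt_pos.mpr hv'
  rw [show (-(3 / 2) : ℝ) = -1 + -(1 / 2) by norm_num, Real.rpow_add hv', Real.rpow_neg_one,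
    Real.rpow_neg hv'.le, ← Real.sqrt_eq_rpow, div_eq_mul_inv]
  gcongr
  rw [Real.exp_neg]
  gcongr
  have := Real.add_one_le_exp (2 * Real.pi * v)
  nlinarith [Real.pi_gt_three]

lemma integral_exp_div_sqrt (n : ℕ) (y₀ : ℝ) :
    ∫ y in Set.Ioi y₀, Real.exp (-(2 * Real.pi * (n + 1) ^ 2 * y)) / √y =
      gammaTail ((n + 1) ^ 2 * y₀) / (n + 1) := by
  have hb : (0 : ℝ) < (n + 1) ^ 2 := by positivity
  have h := integral_comp_mul_left_Ioi (fun v : ℝ => Real.exp (-(2 * Real.pi * v)) / √v) y₀ hb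
  rw [gammaTail, div_eq_inv_mul]
  have e : ∀ y : ℝ, Real.exp (-(2 * Real.pi * (n + 1) ^ 2 * y)) / √y =
      (n + 1) * (Real.exp (-(2 * Real.pi * ((n + 1) ^ 2 * y))) / √((n + 1) ^ 2 * y)) := by
    intro y
    have : (0 : ℝ) < n + 1 := by positivity
    rw [Real.sqrt_mul hb.le, Real.sqrt_sq this.le]
    rw [show 2 * Real.pi * (n + 1) ^ 2 * y = 2 * Real.pi * ((n + 1) ^ 2 * y) by ring]
    field_simp
  simp_rw [e]
  rw [integral_const_mul, h, smul_eq_mul]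
  field_simp

/-- Termwise integration of the theta series, justified by absolute convergence; the scaling v = n²y
turns each integral into (1/n) times an incomplete Gamma weight. -/
lemma hasSum_thetaInt {y₀ : ℝ} (hy₀ : 0 < y₀) (x : ℝ) :
    HasSum (fun n : ℕ => ((√2 * gammaTail ((n + 1) ^ 2 * y₀) : ℝ) : ℂ) *
      (Complex.exp (2 * Real.pi * Complex.I * (((n + 1 : ℕ) : ℂ) ^ 2 * (x : ℂ))) / ((n + 1 : ℕ) : ℂ)))
      (thetaInt y₀ x) := by
  set E : ℕ → ℂ := fun n => Complex.exp (2 * Real.pi * Complex.I * (((n + 1 : ℕ) : ℂ) ^ 2 * (x : ℂ)))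
    with hE
  have hEn : ∀ n, ‖E n‖ = 1 := by
    intro n
    rw [hE]
    simp only
    rw [show 2 * Real.pi * Complex.I * (((n + 1 : ℕ) : ℂ) ^ 2 * (x : ℂ)) =
      ((2 * Real.pi * ((n + 1 : ℕ) : ℝ) ^ 2 * x : ℝ) : ℂ) * Complex.I by push_cast; ring]
    exact Complex.norm_exp_ofReal_mul_I _
  set f : ℕ → ℝ → ℂ := fun n y => 2 * E n *
    ((Real.exp (-(2 * Real.pi * (n + 1) ^ 2 * y)) / √y : ℝ) : ℂ) with hf
  have hint0 : ∀ n : ℕ, IntegrableOn (fun y : ℝ => Real.exp (-(2 * Real.pi * (n + 1) ^ 2 * y)) / √y)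
      (Set.Ioi y₀) := by
    intro n
    have hm : Continuous (fun y : ℝ => Real.exp (-(2 * Real.pi * (n + 1) ^ 2 * y))) := by fun_prop
    refine (integrableOn_gammaTail.mono_set (Set.Ioi_subset_Ioi hy₀.le)).mono' ?_ ?_
    · exact (hm.measurable.div Real.continuous_sqrt.measurable).aestronglyMeasurable
    · refine (ae_restrict_iff' measurableSet_Ioi).mpr (Eventually.of_forall fun y hy => ?_)
      have hy' : 0 < y := hy₀.trans hy
      rw [Real.norm_of_nonneg (by positivity)]
      refine div_le_div_of_nonneg_right (Real.exp_le_exp.mpr (neg_le_neg ?_)) (Real.sqrt_nonneg y)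
      have : (1 : ℝ) ≤ (n + 1) ^ 2 := one_le_pow₀ (by linarith [n.cast_nonneg (α := ℝ)])
      have := Real.pi_pos
      calc 2 * Real.pi * y = 2 * Real.pi * 1 * y := by ring
        _ ≤ _ := by gcongr
  have hfint : ∀ n, Integrable (f n) (volume.restrict (Set.Ioi y₀)) := fun n =>
    (hint0 n).ofReal.const_mul _
  have hfval : ∀ n, ∫ y in Set.Ioi y₀, f n y = 2 * E n * ((gammaTail ((n + 1) ^ 2 * y₀) / (n + 1) : ℝ) : ℂ) := by
    intro n
    simp only [hf]
    rw [integral_const_mul, integral_complex_ofReal, integral_exp_div_sqrt]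
  have hfnorm : ∀ n, ∫ y in Set.Ioi y₀, ‖f n y‖ = 2 * (gammaTail ((n + 1) ^ 2 * y₀) / (n + 1)) := by
    intro n
    have : ∀ y, ‖f n y‖ = 2 * (Real.exp (-(2 * Real.pi * (n + 1) ^ 2 * y)) / √y) := by
      intro y
      simp only [hf]
      rw [norm_mul, norm_mul, hEn, Complex.norm_real, Real.norm_of_nonneg (by positivity)]
      simp
    simp_rw [this]
    rw [integral_const_mul, integral_exp_div_sqrt]
  have hsumm : Summable fun n => ∫ y in Set.Ioi y₀, ‖f n y‖ := by
    simp_rw [hfnorm]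
    have h2 : Summable fun n : ℕ => 4 / √y₀ * (1 / ((n + 1 : ℕ) : ℝ) ^ 2) :=
      ((summable_nat_add_iff 1).mpr (Real.summable_one_div_nat_pow.mpr (by norm_num))).mul_left _
    refine Summable.of_nonneg_of_le (fun n => ?_) (fun n => ?_) h2
    · have := gammaTail_nonneg ((n + 1) ^ 2 * y₀)
      positivity
    · have hb : (0 : ℝ) < (n + 1) ^ 2 * y₀ := by positivity
      have := gammaTail_le hb
      rw [Real.sqrt_mul (by positivity), Real.sqrt_sq (by positivity)] at this
      calc _ ≤ 2 * (2 / ((n + 1) * √y₀) / (n + 1)) := by gcongr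
        _ = _ := by push_cast; field_simp; norm_num
  have key := hasSum_integral_of_summable_integral_norm hfint hsumm
  have hlim : ∫ y in Set.Ioi y₀, ∑' n, f n y =
      ∫ y in Set.Ioi y₀, (theta (x + y * Complex.I) - 1) / (√y : ℂ) := by
    refine setIntegral_congr_fun measurableSet_Ioi fun y hy => ?_
    have hy' : 0 < y := hy₀.trans hy
    have him : 0 < (2 * ((x : ℂ) + y * Complex.I)).im := by simpa using hy'
    have hj := hasSum_nat_jacobiTheta him
    have hj2 := (hj.mul_left 2).div_const (√y : ℂ)
    rw [mul_div_cancel₀ _ two_ne_zero] at hj2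
    rw [theta, ← hj2.tsum_eq]
    refine tsum_congr fun n => ?_
    simp only [hf, hE]
    push_cast
    rw [mul_div_assoc', mul_assoc 2, ← Complex.exp_add]
    congr 3
    linear_combination (2 * Real.pi * (n + 1 : ℂ) ^ 2 * y) * (-Complex.I_mul_I)
  rw [hlim] at key
  have key2 := key.mul_left (1 / (√2 : ℂ))
  rw [thetaInt]
  refine key2.congr_fun fun n => ?_
  rw [hfval]
  have h22 : (√2 : ℂ) * √2 = 2 := by exact_mod_cast Real.mul_self_sqrt (by norm_num : (0:ℝ) ≤ 2)
  have h20 : (√2 : ℂ) ≠ 0 := by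
    intro h0; rw [h0, zero_mul] at h22; norm_num at h22
  have hn : ((n : ℂ) + 1) ≠ 0 := by exact_mod_cast Nat.succ_ne_zero n
  change _ * (E n / _) = _
  generalize E n = e
  push_cast
  rw [← h22]
  field_simp

lemma partialSum_eq_range (N : ℕ) (x : ℝ) : partialSum N x = ∑ n ∈ Finset.range N,
    Complex.exp (2 * Real.pi * Complex.I * (((n + 1 : ℕ) : ℂ) ^ 2 * (x : ℂ))) / ((n + 1 : ℕ) : ℂ) := by
  rw [partialSum, Finset.range_eq_Ico, Finset.sum_Ico_add' (fun n : ℕ =>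
    Complex.exp (2 * Real.pi * Complex.I * ((n : ℂ) ^ 2 * (x : ℂ))) / (n : ℂ)) 0 N 1]
  rfl

/-- The weights √2 `gammaTail` (n²y) decrease in n, lie in [0,1] and tend to 1 as y → 0, so the
summation method is regular. -/
lemma tendsto_thetaInt {x : ℝ} {z : ℂ} (hx : Tendsto (fun N => partialSum N x) atTop (𝓝 z))
    {y : ℕ → ℝ} (hy0 : ∀ k, 0 < y k) (hy : Tendsto y atTop (𝓝 0)) :
    Tendsto (fun k => thetaInt (y k) x) atTop (𝓝 z) := by
  simp only [partialSum_eq_range] at hx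
  have h := tendsto_tsum_of_antitone_weights (l := atTop) hx
    (c := fun k n => √2 * gammaTail ((n + 1) ^ 2 * y k)) ?_ ?_ ?_ ?_ ?_
  · refine h.congr fun k => (hasSum_thetaInt (hy0 k) x).tsum_eq
  · intro k m n hmn
    have := hy0 k
    have : (m : ℝ) ≤ n := Nat.cast_le.mpr hmn
    refine mul_le_mul_of_nonneg_left (gammaTail_anti (by positivity) (by gcongr)) (by positivity)
  · exact fun k n => mul_nonneg (by positivity) (gammaTail_nonneg _)
  · intro k n
    have := hy0 k
    rw [← gammaTail_zero]
    exact mul_le_mul_of_nonneg_left (gammaTail_anti le_rfl (by positivity)) (by positivity)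
  · exact fun k => (hasSum_thetaInt (hy0 k) x).summable
  · intro n
    refine tendsto_gammaTail ?_ fun k => by have := hy0 k; positivity
    simpa using hy.const_mul (((n : ℝ) + 1) ^ 2)

/-! ### Almost everywhere convergence and integrability -/

/-- The `n`-th term of the series. -/
noncomputable def term (n : ℕ) (x : ℝ) : ℂ :=
  Complex.exp (2 * Real.pi * Complex.I * ((n : ℂ) ^ 2 * (x : ℂ))) / (n : ℂ)

lemma norm_term (n : ℕ) (x : ℝ) : ‖term n x‖ = 1 / n := by
  rw [term, norm_div, Complex.norm_natCast,
    show 2 * Real.pi * Complex.I * ((n : ℂ) ^ 2 * (x : ℂ)) =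
      ((2 * Real.pi * (n : ℝ) ^ 2 * x : ℝ) : ℂ) * Complex.I by push_cast; ring,
    Complex.norm_exp_ofReal_mul_I]

lemma continuous_term (n : ℕ) : Continuous (term n) := by
  unfold term; fun_prop

lemma integral_exp_int (c k : ℤ) :
    ∫ x in (c : ℝ)..(c + 1 : ℝ), Complex.exp (2 * Real.pi * Complex.I * k * x) =
      if k = 0 then 1 else 0 := by
  split_ifs with hk
  · subst hk; simp
  · have hc : (2 * Real.pi * Complex.I * k : ℂ) ≠ 0 := by
      simp [Real.pi_ne_zero, hk]
    rw [integral_exp_mul_complex hc, div_eq_zero_iff]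
    left
    rw [sub_eq_zero, Complex.exp_eq_exp_iff_exists_int]
    exact ⟨k, by push_cast; ring⟩

lemma integral_term_mul_conj (c : ℤ) (n m : ℕ) :
    ∫ x in (c : ℝ)..(c + 1 : ℝ), term n x * (starRingEnd ℂ) (term m x) =
      if n = m then (1 / (n : ℂ) ^ 2) else 0 := by
  have h : ∀ x : ℝ, term n x * (starRingEnd ℂ) (term m x) = 1 / ((n : ℂ) * m) *
      Complex.exp (2 * Real.pi * Complex.I * (((n : ℤ) ^ 2 - (m : ℤ) ^ 2 : ℤ) : ℂ) * x) := by
    intro x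
    rw [term, term, map_div₀, ← Complex.exp_conj, map_natCast]
    have : (starRingEnd ℂ) (2 * Real.pi * Complex.I * ((m : ℂ) ^ 2 * (x : ℂ))) =
        -(2 * Real.pi * Complex.I * ((m : ℂ) ^ 2 * (x : ℂ))) := by
      rw [show (2 : ℂ) = ((2 : ℝ) : ℂ) by norm_num]
      simp only [map_mul, map_pow, Complex.conj_ofReal, Complex.conj_I, map_natCast]; ring
    rw [this, div_mul_div_comm, ← Complex.exp_add, div_eq_mul_inv, mul_comm, one_div]
    congr 2
    push_cast; ring
  simp_rw [h]
  rw [intervalIntegral.integral_const_mul, integral_exp_int]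
  have : ((n : ℤ) ^ 2 - (m : ℤ) ^ 2 = 0) ↔ n = m := by
    rw [sub_eq_zero]
    constructor
    · intro h
      have h' : n ^ 2 = m ^ 2 := by exact_mod_cast h
      exact Nat.pow_left_injective two_ne_zero h'
    · rintro rfl; rfl
  simp only [this]
  split_ifs with hnm
  · subst hnm; rw [mul_one, sq]
  · simp

/-- Parseval: distinct natural numbers have distinct squares, so the terms are orthogonal on every
unit interval. -/
lemma integral_norm_sq_sum_term (c : ℤ) (s : Finset ℕ) :
    ∫ x in (c : ℝ)..(c + 1 : ℝ), ‖∑ n ∈ s, term n x‖ ^ 2 = ∑ n ∈ s, 1 / (n : ℝ) ^ 2 := by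
  have h : ((∫ x in (c : ℝ)..(c + 1 : ℝ), ‖∑ n ∈ s, term n x‖ ^ 2 : ℝ) : ℂ) =
      ((∑ n ∈ s, 1 / (n : ℝ) ^ 2 : ℝ) : ℂ) := by
    rw [← intervalIntegral.integral_ofReal]
    have e : ∀ x : ℝ, ((‖∑ n ∈ s, term n x‖ ^ 2 : ℝ) : ℂ) =
        ∑ n ∈ s, ∑ m ∈ s, term n x * (starRingEnd ℂ) (term m x) := by
      intro x
      rw [← Finset.sum_mul_sum, ← map_sum, Complex.mul_conj, Complex.normSq_eq_norm_sq]
    have hcont : ∀ n m : ℕ, Continuous fun x => term n x * (starRingEnd ℂ) (term m x) :=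
      fun n m => (continuous_term n).mul (Complex.continuous_conj.comp (continuous_term m))
    have hi : ∀ n m : ℕ, IntervalIntegrable (fun x => term n x * (starRingEnd ℂ) (term m x)) volume
        (c : ℝ) (c + 1 : ℝ) := fun n m =>
      (hcont n m).intervalIntegrable _ _
    simp_rw [e]
    rw [intervalIntegral.integral_finsetSum fun n _ =>
      (continuous_finsetSum _ fun m _ => hcont n m).intervalIntegrable _ _]
    push_cast
    refine Finset.sum_congr rfl fun n hn => ?_
    rw [intervalIntegral.integral_finsetSum fun m _ => hi n m]
    simp_rw [integral_term_mul_conj]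
    rw [Finset.sum_ite_eq, if_pos hn]
  exact_mod_cast h

/-- The block of terms between two consecutive squares. -/
noncomputable def block (k : ℕ) (x : ℝ) : ℂ :=
  ∑ n ∈ Finset.Ioc (k ^ 2) ((k + 1) ^ 2), term n x

lemma continuous_block (k : ℕ) : Continuous (block k) :=
  continuous_finsetSum _ fun n _ => continuous_term n

lemma sum_block (K : ℕ) (x : ℝ) : ∑ k ∈ Finset.range K, block k x = partialSum (K ^ 2) x := by
  induction K with
  | zero => simp [partialSum]
  | succ K ih =>
    rw [Finset.sum_range_succ, ih, partialSum, partialSum, block]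
    have h : ∀ N : ℕ, Finset.Icc 1 N = Finset.Ioc 0 N := fun N => by ext; simp; omega
    rw [h, h]
    exact Finset.sum_Ioc_consecutive (fun n => term n x) (Nat.zero_le _) (by gcongr; omega)

/-- With t = k + 1, the block has 2t + 1 orthogonal terms of norm at most t^{-2}. Its L² norm is
thus O(t^{-3/2}), and so is its L¹ norm, which makes the blocks summable in L¹. -/
lemma integral_norm_block_le (c : ℤ) (k : ℕ) :
    ∫ x in (c : ℝ)..(c + 1 : ℝ), ‖block (k + 1) x‖ ≤ 2 * ((k + 1 : ℕ) : ℝ) ^ (-(3 / 2) : ℝ) := by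
  set t : ℝ := ((k + 1 : ℕ) : ℝ) with ht
  have ht1 : 1 ≤ t := by rw [ht]; exact_mod_cast Nat.succ_le_succ (Nat.zero_le k)
  have ht0 : 0 < t := by linarith
  set ε : ℝ := t ^ (-(3 / 2) : ℝ) with hε
  have hε0 : 0 < ε := by positivity
  have hεε : t ^ (-3 : ℝ) = ε * ε := by
    rw [hε, ← Real.rpow_add ht0]; norm_num
  have hsq : ∫ x in (c : ℝ)..(c + 1 : ℝ), ‖block (k + 1) x‖ ^ 2 ≤ 3 * (ε * ε) := by
    simp only [block]
    rw [integral_norm_sq_sum_term]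
    calc _ ≤ ∑ n ∈ Finset.Ioc ((k + 1) ^ 2) ((k + 1 + 1) ^ 2), 1 / t ^ 4 := by
          refine Finset.sum_le_sum fun n hn => ?_
          have : (t : ℝ) ^ 2 ≤ n := by
            rw [ht]; exact_mod_cast (Finset.mem_Ioc.mp hn).1.le
          rw [show t ^ 4 = (t ^ 2) ^ 2 by ring]
          gcongr
      _ = (2 * t + 1) * (1 / t ^ 4) := by
          rw [Finset.sum_const, Nat.card_Ioc, nsmul_eq_mul]
          congr 1
          rw [show (k + 1 + 1) ^ 2 - (k + 1) ^ 2 = 2 * (k + 1) + 1 by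
            rw [Nat.sub_eq_iff_eq_add (by gcongr; omega)]; ring]
          rw [ht]; push_cast; ring
      _ ≤ (3 * t) * (1 / t ^ 4) := by gcongr; linarith
      _ = 3 * (ε * ε) := by
          rw [← hεε, Real.rpow_neg ht0.le, show (3 : ℝ) = ((3 : ℕ) : ℝ) by norm_num, Real.rpow_natCast]
          field_simp
  have hc1 : Continuous fun x => ‖block (k + 1) x‖ := (continuous_block _).norm
  -- Cauchy–Schwarz in the form b ≤ ε/2 + b²/(2ε), with ε of the size of the L² norm.
  calc _ ≤ ∫ x in (c : ℝ)..(c + 1 : ℝ), (1 / 2 * ε + 1 / (2 * ε) * ‖block (k + 1) x‖ ^ 2) := by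
        refine intervalIntegral.integral_mono_on (by linarith) (hc1.intervalIntegrable _ _)
          (Continuous.intervalIntegrable (by fun_prop) _ _) fun x _ => ?_
        have h := sq_nonneg (‖block (k + 1) x‖ - ε)
        rw [← sub_nonneg]
        have : 1 / 2 * ε + 1 / (2 * ε) * ‖block (k + 1) x‖ ^ 2 - ‖block (k + 1) x‖ =
          (‖block (k + 1) x‖ - ε) ^ 2 / (2 * ε) := by field_simp; ring
        rw [this]; positivity
    _ = 1 / 2 * ε + 1 / (2 * ε) * ∫ x in (c : ℝ)..(c + 1 : ℝ), ‖block (k + 1) x‖ ^ 2 := by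
        rw [intervalIntegral.integral_add (Continuous.intervalIntegrable (by fun_prop) _ _)
          (Continuous.intervalIntegrable (by fun_prop) _ _), intervalIntegral.integral_const_mul]
        simp
    _ ≤ 1 / 2 * ε + 1 / (2 * ε) * (3 * (ε * ε)) := by gcongr
    _ = _ := by field_simp; norm_num

lemma lintegral_tsum_block_lt_top (c : ℤ) :
    ∫⁻ x in Set.Ioc (c : ℝ) (c + 1 : ℝ), ∑' k, ‖block k x‖ₑ < ⊤ := by
  rw [lintegral_tsum fun k => (continuous_block k).enorm.measurable.aemeasurable]
  have h : ∀ k, ∫⁻ x in Set.Ioc (c : ℝ) (c + 1 : ℝ), ‖block k x‖ₑ =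
      ENNReal.ofReal (∫ x in (c : ℝ)..(c + 1 : ℝ), ‖block k x‖) := by
    intro k
    rw [intervalIntegral.integral_of_le (by linarith), ofReal_integral_norm_eq_lintegral_enorm]
    exact ((continuous_block k).integrableOn_Icc).mono_set Set.Ioc_subset_Icc_self
  simp_rw [h]
  rw [← ENNReal.ofReal_tsum_of_nonneg]
  · exact ENNReal.ofReal_lt_top
  · exact fun k => intervalIntegral.integral_nonneg (by linarith) fun _ _ => norm_nonneg _
  · rw [← summable_nat_add_iff 1]
    refine Summable.of_nonneg_of_le (fun k => intervalIntegral.integral_nonneg (by linarith)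
      fun _ _ => norm_nonneg _) (integral_norm_block_le c) ?_
    exact ((summable_nat_add_iff 1).mpr
      (Real.summable_nat_rpow.mpr (by norm_num : (-(3 / 2) : ℝ) < -1))).mul_left 2

lemma ae_tsum_block_lt_top : ∀ᵐ x : ℝ, ∑' k, ‖block k x‖ₑ < ⊤ := by
  have h : ∀ c : ℤ, ∀ᵐ x : ℝ, x ∈ Set.Ioc (c : ℝ) (c + 1 : ℝ) → ∑' k, ‖block k x‖ₑ < ⊤ := fun c =>
    (ae_restrict_iff' measurableSet_Ioc).mp (ae_lt_top
      (Measurable.tsum fun k => (continuous_block k).enorm.measurable)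
      (lintegral_tsum_block_lt_top c).ne)
  filter_upwards [ae_all_iff.mpr h] with x hx
  refine hx (⌈x⌉ - 1) ⟨?_, ?_⟩
  · push_cast; linarith [Int.ceil_lt_add_one x]
  · push_cast; linarith [Int.le_ceil x]

/-- Absolute summability of the blocks gives convergence along squares. Between k² and (k+1)² there
are at most 2k further terms, each at most 1/k², so no maximal inequality is needed. -/
lemma tendsto_partialSum_of_tsum_block {x : ℝ} (hx : ∑' k, ‖block k x‖ₑ < ⊤) :
    Tendsto (fun N => partialSum N x) atTop (𝓝 (∑' k, block k x)) := by
  have hs : Summable fun k => block k x := by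
    refine Summable.of_norm ?_
    have := ENNReal.summable_toReal hx.ne
    simpa using this
  have h1 : Tendsto (fun K => partialSum (K ^ 2) x) atTop (𝓝 (∑' k, block k x)) := by
    refine hs.hasSum.tendsto_sum_nat.congr fun K => sum_block K x
  have hsqrt : Tendsto Nat.sqrt atTop atTop := by
    refine tendsto_atTop.mpr fun b => ?_
    filter_upwards [eventually_ge_atTop (b * b)] with n hn
    exact Nat.le_sqrt.mpr hn
  have h2 : Tendsto (fun N => partialSum N x - partialSum (Nat.sqrt N ^ 2) x) atTop (𝓝 0) := by
    have h3 : Tendsto (fun N => 2 / (Nat.sqrt N : ℝ)) atTop (𝓝 0) :=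
      (tendsto_const_div_atTop_nhds_zero_nat 2).comp hsqrt
    refine squeeze_zero_norm' ?_ h3
    filter_upwards [eventually_ge_atTop 1] with N hN
    set k := Nat.sqrt N with hk
    have hk1 : 1 ≤ k := Nat.le_sqrt.mpr (by simpa using hN)
    have hkN : k ^ 2 ≤ N := by rw [sq]; exact Nat.sqrt_le N
    have hNk : N ≤ k ^ 2 + 2 * k := by
      have := Nat.sqrt_le_add N
      rw [sq, hk]; omega
    have e : partialSum N x - partialSum (k ^ 2) x = ∑ n ∈ Finset.Ioc (k ^ 2) N, term n x := by
      have h : ∀ N : ℕ, Finset.Icc 1 N = Finset.Ioc 0 N := fun N => by ext; simp; omega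
      rw [partialSum, partialSum, h, h, sub_eq_iff_eq_add, add_comm]
      exact (Finset.sum_Ioc_consecutive (fun n => term n x) (Nat.zero_le _) hkN).symm
    rw [e]
    have hk0 : (0 : ℝ) < k := by exact_mod_cast hk1
    calc _ ≤ ∑ n ∈ Finset.Ioc (k ^ 2) N, 1 / (k : ℝ) ^ 2 := by
          refine norm_sum_le_of_le _ fun n hn => ?_
          rw [norm_term]
          have : ((k : ℝ) ^ 2) ≤ n := by exact_mod_cast (Finset.mem_Ioc.mp hn).1.le
          gcongr
      _ = ((N - k ^ 2 : ℕ) : ℝ) * (1 / (k : ℝ) ^ 2) := by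
          rw [Finset.sum_const, Nat.card_Ioc, nsmul_eq_mul]
      _ ≤ (2 * k) * (1 / (k : ℝ) ^ 2) := by
          gcongr
          exact_mod_cast (by omega : N - k ^ 2 ≤ 2 * k)
      _ = 2 / k := by field_simp
  have h4 := h2.add (h1.comp hsqrt)
  simpa using h4

lemma F_eq_of_tendsto {x : ℝ} {z : ℂ} (h : Tendsto (fun N => partialSum N x) atTop (𝓝 z)) :
    F x = z := h.limUnder_eq

lemma ae_tendsto_F : ∀ᵐ x : ℝ, Tendsto (fun N => partialSum N x) atTop (𝓝 (F x)) := by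
  filter_upwards [ae_tsum_block_lt_top] with x hx
  have h := tendsto_partialSum_of_tsum_block hx
  rwa [F_eq_of_tendsto h]

lemma integrableOn_F : IntegrableOn F (Set.Ico (0 : ℝ) 1) := by
  have hae : ∀ᵐ x ∂(volume.restrict (Set.Ioc ((0 : ℤ) : ℝ) ((0 : ℤ) + 1 : ℝ))), ‖F x‖ₑ ≤ ∑' k, ‖block k x‖ₑ := by
    refine ae_restrict_of_ae ?_
    filter_upwards [ae_tsum_block_lt_top] with x hx
    rw [F_eq_of_tendsto (tendsto_partialSum_of_tsum_block hx)]
    exact enorm_tsum_le_tsum_enorm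
  have hm : AEStronglyMeasurable F volume := by
    refine aestronglyMeasurable_of_tendsto_ae atTop (f := fun N x => partialSum N x) (fun N => ?_)
      ae_tendsto_F
    exact (continuous_finsetSum _ fun n _ => continuous_term n).aestronglyMeasurable
  have h : IntegrableOn F (Set.Ioc ((0 : ℤ) : ℝ) ((0 : ℤ) + 1 : ℝ)) :=
    ⟨hm.restrict, (lintegral_mono_ae hae).trans_lt (lintegral_tsum_block_lt_top 0)⟩
  simp only [Int.cast_zero, zero_add] at h
  rw [integrableOn_Ico_iff_integrableOn_Ioo]
  exact h.mono_set Set.Ioo_subset_Ioc_self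

/-! ### The Gauss map -/

/-- The Gauss map `t ↦ {1 / t}`. -/
noncomputable def gaussMap (t : ℝ) : ℝ := Int.fract t⁻¹

/-- The inverse branch `u ↦ 1 / (a + 1 + u)` of the Gauss map. -/
noncomputable def gaussBranch (a : ℕ) (u : ℝ) : ℝ := (a + 1 + u)⁻¹

lemma measurable_gaussMap : Measurable gaussMap := measurable_fract.comp measurable_inv

lemma gaussMap_branch (a : ℕ) {u : ℝ} (hu : u ∈ Set.Ioo (0 : ℝ) 1) :
    gaussMap (gaussBranch a u) = u := by
  rw [gaussMap, gaussBranch, inv_inv, Int.fract_eq_iff]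
  exact ⟨hu.1.le, hu.2, a + 1, by push_cast; ring⟩

lemma gaussBranch_mem (a : ℕ) {u : ℝ} (hu : u ∈ Set.Ioo (0 : ℝ) 1) :
    gaussBranch a u ∈ Set.Ioo (0 : ℝ) 1 := by
  have h1 := hu.1
  have : (0 : ℝ) ≤ a := a.cast_nonneg
  refine ⟨by rw [gaussBranch]; positivity, ?_⟩
  rw [gaussBranch]
  exact inv_lt_one_of_one_lt₀ (by linarith)

lemma gaussBranch_injOn (a : ℕ) : Set.InjOn (gaussBranch a) (Set.Ioo (0 : ℝ) 1) := by
  intro u hu v hv h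
  rw [← gaussMap_branch a hu, h, gaussMap_branch a hv]

lemma hasDerivAt_gaussBranch (a : ℕ) {u : ℝ} (hu : u ∈ Set.Ioo (0 : ℝ) 1) :
    HasDerivAt (gaussBranch a) (-1 / (a + 1 + u) ^ 2) u := by
  have h1 := hu.1
  have : (0 : ℝ) < a + 1 + u := by positivity
  exact ((hasDerivAt_id u).const_add ((a : ℝ) + 1)).inv this.ne'

lemma gaussMap_mem_of_irrational {t : ℝ} (ht : Irrational t) :
    gaussMap t ∈ Set.Ioo (0 : ℝ) 1 ∧ Irrational (gaussMap t) := by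
  have h1 : Irrational (gaussMap t) := by
    rw [gaussMap, Int.fract]
    exact ht.inv.sub_intCast _
  refine ⟨⟨lt_of_le_of_ne (Int.fract_nonneg _) (fun h => ?_), Int.fract_lt_one _⟩, h1⟩
  exact h1.ne_zero h.symm

/-- The index of the branch of the Gauss map at `t`. -/
noncomputable def digit (t : ℝ) : ℕ := ⌊t⁻¹⌋₊ - 1

lemma gaussBranch_digit {t : ℝ} (h : t ∈ Set.Ioo (0 : ℝ) 1) :
    gaussBranch (digit t) (gaussMap t) = t := by
  have h1 : 1 < t⁻¹ := (one_lt_inv₀ h.1).mpr h.2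
  have h2 : 1 ≤ ⌊t⁻¹⌋₊ := Nat.le_floor (by exact_mod_cast h1.le)
  have h3 : ((digit t : ℝ) + 1) = ⌊t⁻¹⌋ := by
    rw [← natCast_floor_eq_intCast_floor (by linarith), digit, Nat.cast_sub h2]; simp
  rw [gaussBranch, h3, gaussMap, Int.floor_add_fract, inv_inv]

lemma ae_irrational : ∀ᵐ t : ℝ, Irrational t := by
  have : (Set.range ((↑) : ℚ → ℝ)).Countable := Set.countable_range _
  exact this.ae_notMem volume

/-- Change of variables along the branches of the Gauss map. -/
lemma lintegral_gauss (g : ℝ → ENNReal) :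
    ∫⁻ t in Set.Ioo (0 : ℝ) 1, g t =
      ∑' a : ℕ, ∫⁻ u in Set.Ioo (0 : ℝ) 1,
        ENNReal.ofReal (1 / (a + 1 + u) ^ 2) * g (gaussBranch a u) := by
  have himg : ∀ a : ℕ, MeasurableSet (gaussBranch a '' Set.Ioo (0 : ℝ) 1) := by
    intro a
    refine measurableSet_Ioo.image_of_continuousOn_injOn (fun u hu => ?_) (gaussBranch_injOn a)
    exact (hasDerivAt_gaussBranch a hu).continuousAt.continuousWithinAt
  have hdisj : Pairwise (Function.onFun Disjoint fun a : ℕ => gaussBranch a '' Set.Ioo (0 : ℝ) 1) := by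
    intro a b hab
    refine Set.disjoint_left.mpr ?_
    rintro _ ⟨u, hu, rfl⟩ ⟨v, hv, hv'⟩
    have h1 : u = v := by rw [← gaussMap_branch a hu, ← hv', gaussMap_branch b hv]
    subst h1
    rw [gaussBranch, gaussBranch, inv_inj] at hv'
    apply hab
    have : (b : ℝ) = a := by linarith
    exact_mod_cast this.symm
  have hunion : Set.Ioo (0 : ℝ) 1 =ᵐ[volume] ⋃ a : ℕ, gaussBranch a '' Set.Ioo (0 : ℝ) 1 := by
    filter_upwards [ae_irrational] with t ht
    refine propext ⟨fun h => ?_, fun h => ?_⟩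
    · obtain ⟨a, ha⟩ : ∃ a, _ = gaussBranch a _ := ⟨_, (gaussBranch_digit h).symm⟩
      exact Set.mem_iUnion.mpr ⟨a, _, (gaussMap_mem_of_irrational ht).1, ha.symm⟩
    · obtain ⟨a, u, hu, rfl⟩ := Set.mem_iUnion.mp h
      exact gaussBranch_mem a hu
  rw [setLIntegral_congr hunion, lintegral_iUnion himg hdisj]
  refine tsum_congr fun a => ?_
  rw [lintegral_image_eq_lintegral_abs_deriv_mul measurableSet_Ioo
    (fun u hu => (hasDerivAt_gaussBranch a hu).hasDerivWithinAt) (gaussBranch_injOn a)]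
  refine setLIntegral_congr_fun measurableSet_Ioo fun u hu => ?_
  simp only [neg_div, abs_neg]
  rw [abs_of_nonneg (by positivity)]

/-! ### Exponential moments and tails of weighted Birkhoff sums. -/

/-- Weighted Birkhoff sums of `-log` along the Gauss map. -/
noncomputable def logSum (n : ℕ) (ω : ℕ → ℝ) (t : ℝ) : ℝ :=
  ∑ k ∈ Finset.range n, ω k * -Real.log (gaussMap^[k] t)

lemma logSum_succ (n : ℕ) (ω : ℕ → ℝ) (t : ℝ) :
    logSum (n + 1) ω t = ω 0 * -Real.log t + logSum n (fun k => ω (k + 1)) (gaussMap t) := by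
  rw [logSum, Finset.sum_range_succ', add_comm]
  rfl

lemma measurable_logSum (n : ℕ) (ω : ℕ → ℝ) : Measurable (logSum n ω) := by
  refine Finset.measurable_sum _ fun k _ => ?_
  exact (Real.measurable_log.comp (measurable_gaussMap.iterate k)).neg.const_mul _

lemma gaussMap_iterate_mem {t : ℝ} (ht : t ∈ Set.Ico (0 : ℝ) 1) (k : ℕ) :
    gaussMap^[k] t ∈ Set.Ico (0 : ℝ) 1 := by
  induction k with
  | zero => exact ht
  | succ k ih =>
    rw [Function.iterate_succ_apply']
    exact ⟨Int.fract_nonneg _, Int.fract_lt_one _⟩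

lemma neg_log_iterate_nonneg {t : ℝ} (ht : t ∈ Set.Ico (0 : ℝ) 1) (k : ℕ) :
    0 ≤ -Real.log (gaussMap^[k] t) := by
  have := gaussMap_iterate_mem ht k
  exact neg_nonneg.mpr (Real.log_nonpos this.1 this.2.le)

lemma logSum_nonneg {ω : ℕ → ℝ} (hω : ∀ k, 0 ≤ ω k) (n : ℕ) {t : ℝ} (ht : t ∈ Set.Ico (0 : ℝ) 1) :
    0 ≤ logSum n ω t :=
  Finset.sum_nonneg fun k _ => mul_nonneg (hω k) (neg_log_iterate_nonneg ht k)

lemma logSum_mono {ω : ℕ → ℝ} (hω : ∀ k, 0 ≤ ω k) {t : ℝ} (ht : t ∈ Set.Ico (0 : ℝ) 1) :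
    Monotone fun n => logSum n ω t := by
  refine monotone_nat_of_le_succ fun n => ?_
  rw [logSum, logSum, Finset.sum_range_succ]
  have := mul_nonneg (hω n) (neg_log_iterate_nonneg ht n)
  linarith

/-- Bernoulli's inequality for the power κ/(9/10) ≤ 1 of s^{9/10}. The excess over 1 must be linear
in κ, so that small weights cost little in the product of moments. -/
lemma rpow_le_one_add {s κ : ℝ} (hs : 1 ≤ s) (h0 : 0 ≤ κ) (h1 : κ ≤ 9 / 10) :
    s ^ κ ≤ 1 + 2 * κ * s ^ (9 / 10 : ℝ) := by
  have hs0 : 0 ≤ s := by linarith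
  have hS : 0 ≤ s ^ (9 / 10 : ℝ) := by positivity
  have h := rpow_one_add_le_one_add_mul_self (s := s ^ (9 / 10 : ℝ) - 1) (p := κ / (9 / 10))
    (by linarith) (by positivity) (by rw [div_le_one (by norm_num)]; exact h1)
  rw [add_sub_cancel, ← Real.rpow_mul hs0, mul_div_cancel₀ _ (by norm_num)] at h
  refine h.trans ?_
  have : κ / (9 / 10) * (s ^ (9 / 10 : ℝ) - 1) ≤ κ / (9 / 10) * s ^ (9 / 10 : ℝ) := by
    gcongr; linarith
  have h2 : κ / (9 / 10) * s ^ (9 / 10 : ℝ) ≤ 2 * κ * s ^ (9 / 10 : ℝ) := by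
    gcongr; linarith
  linarith

lemma hasSum_telescope (u : ℝ) (hu : 0 ≤ u) :
    HasSum (fun a : ℕ => 1 / ((a + 1 + u) * (a + 1 + u + 1))) (1 / (1 + u)) := by
  have hpos : ∀ a : ℕ, (0 : ℝ) < a + 1 + u := fun a => by positivity
  rw [hasSum_iff_tendsto_nat_of_nonneg (fun a => by have := hpos a; positivity)]
  have h : ∀ n : ℕ, ∑ a ∈ Finset.range n, 1 / (((a : ℝ) + 1 + u) * (a + 1 + u + 1)) =
      1 / (1 + u) - 1 / (n + (1 + u)) := by
    intro n
    induction n with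
    | zero => simp
    | succ n ih =>
      rw [Finset.sum_range_succ, ih]
      have := hpos n
      have h3 : (0 : ℝ) < 1 + u := by positivity
      have h4 : (0 : ℝ) < n + (1 + u) := by linarith
      push_cast
      field_simp
      ring
  simp_rw [h]
  have h2 : Tendsto (fun n : ℕ => 1 / ((n : ℝ) + (1 + u))) atTop (𝓝 0) := by
    have := tendsto_natCast_atTop_atTop (R := ℝ)
    exact tendsto_const_nhds.div_atTop (tendsto_atTop_add_const_right _ _ this)
  simpa using h2.const_sub (1 / (1 + u))

/-- The transfer operator applied to the Gauss density times t^{-κ}. At κ = 0 the sum telescopes to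
1/(1+u), the invariance of the density; for κ ≤ 9/10 the excess is at most κ times the convergent
series of 2(a+1)^{-11/10}. -/
lemma tsum_branch_weight_le : ∃ c : ℝ, 0 < c ∧ ∀ κ : ℝ, 0 ≤ κ → κ ≤ 9 / 10 →
    ∀ u ∈ Set.Ioo (0 : ℝ) 1,
      ∑' a : ℕ, ENNReal.ofReal ((a + 1 + u) ^ κ / ((a + 1 + u) * (a + 1 + u + 1))) ≤
        ENNReal.ofReal ((1 + c * κ) * (1 / (1 + u))) := by
  have hZs : Summable fun a : ℕ => ((a + 1 : ℕ) : ℝ) ^ (-(11 / 10) : ℝ) :=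
    (summable_nat_add_iff 1).mpr (Real.summable_nat_rpow.mpr (by norm_num))
  set Z : ℝ := ∑' a : ℕ, ((a + 1 : ℕ) : ℝ) ^ (-(11 / 10) : ℝ) with hZ
  have hZ0 : 0 ≤ Z := tsum_nonneg fun a => by positivity
  refine ⟨4 * Z + 1, by positivity, fun κ h0 h1 u hu => ?_⟩
  have hu0 : 0 < u := hu.1
  have hu1 : u < 1 := hu.2
  have hT := hasSum_telescope u hu0.le
  have hterm : ∀ a : ℕ, ((a : ℝ) + 1 + u) ^ κ / ((a + 1 + u) * (a + 1 + u + 1)) ≤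
      1 / ((a + 1 + u) * (a + 1 + u + 1)) + 2 * κ * ((a + 1 : ℕ) : ℝ) ^ (-(11 / 10) : ℝ) := by
    intro a
    set s : ℝ := a + 1 + u with hs
    have ha : (0 : ℝ) ≤ a := a.cast_nonneg
    have hs1 : 1 ≤ s := by rw [hs]; linarith
    have hs0 : 0 < s := by linarith
    calc s ^ κ / (s * (s + 1)) ≤ (1 + 2 * κ * s ^ (9 / 10 : ℝ)) / (s * (s + 1)) := by
          gcongr; exact rpow_le_one_add hs1 h0 h1
      _ = 1 / (s * (s + 1)) + 2 * κ * (s ^ (9 / 10 : ℝ) / (s * (s + 1))) := by ring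
      _ ≤ 1 / (s * (s + 1)) + 2 * κ * (s ^ (9 / 10 : ℝ) / (s * s)) := by gcongr; linarith
      _ = 1 / (s * (s + 1)) + 2 * κ * s ^ (-(11 / 10) : ℝ) := by
          rw [← sq, ← Real.rpow_two, ← Real.rpow_sub hs0]; norm_num
      _ ≤ _ := by
          gcongr 1 / (s * (s + 1)) + 2 * κ * ?_
          refine Real.rpow_le_rpow_of_nonpos (by positivity) ?_ (by norm_num)
          rw [hs]; push_cast; linarith
  have hsum := hT.summable.add (hZs.mul_left (2 * κ))
  have hnn : ∀ a : ℕ, 0 ≤ ((a : ℝ) + 1 + u) ^ κ / ((a + 1 + u) * (a + 1 + u + 1)) := fun a => by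
    positivity
  have hS : Summable fun a : ℕ => ((a : ℝ) + 1 + u) ^ κ / ((a + 1 + u) * (a + 1 + u + 1)) :=
    Summable.of_nonneg_of_le hnn hterm hsum
  rw [← ENNReal.ofReal_tsum_of_nonneg hnn hS]
  refine ENNReal.ofReal_le_ofReal ((hS.tsum_le_tsum hterm hsum).trans ?_)
  rw [hT.summable.tsum_add (hZs.mul_left (2 * κ)), hT.tsum_eq, tsum_mul_left, ← hZ, add_mul, one_mul]
  refine add_le_add le_rfl ?_
  rw [mul_one_div, le_div_iff₀ (by linarith)]
  have : 0 ≤ κ * Z := by positivity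
  nlinarith

/-- Induction on the length: a change of variables along the branches peels off the first factor,
and the transfer operator reproduces the density 1/(1+u) at the cost of a factor 1 + cω₀. -/
lemma lintegral_exp_logSum_le_prod : ∃ c : ℝ, 0 < c ∧ ∀ (n : ℕ) (ω : ℕ → ℝ),
    (∀ k, 0 ≤ ω k) → (∀ k, ω k ≤ 9 / 10) →
      ∫⁻ t in Set.Ioo (0 : ℝ) 1, ENNReal.ofReal (1 / (1 + t)) * ENNReal.ofReal (Real.exp (logSum n ω t)) ≤
        ENNReal.ofReal (∏ k ∈ Finset.range n, (1 + c * ω k)) := by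
  obtain ⟨c, hc, H⟩ := tsum_branch_weight_le
  refine ⟨c, hc, fun n => ?_⟩
  induction n with
  | zero =>
    intro ω _ _
    have : ∀ t ∈ Set.Ioo (0 : ℝ) 1, ENNReal.ofReal (1 / (1 + t)) * ENNReal.ofReal (Real.exp (logSum 0 ω t)) ≤ 1 := by
      intro t ht
      have h1 : 1 / (1 + t) ≤ 1 := by
        rw [div_le_one (by linarith [ht.1])]; linarith [ht.1]
      simpa [logSum] using h1
    calc _ ≤ ∫⁻ t in Set.Ioo (0 : ℝ) 1, 1 := setLIntegral_mono' measurableSet_Ioo this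
      _ = _ := by simp
  | succ n ih =>
    intro ω h0 h1
    set ω' : ℕ → ℝ := fun k => ω (k + 1) with hω'
    rw [lintegral_gauss]
    have hm : ∀ a : ℕ, Measurable fun u : ℝ =>
        ENNReal.ofReal ((a + 1 + u) ^ ω 0 / ((a + 1 + u) * (a + 1 + u + 1))) *
          ENNReal.ofReal (Real.exp (logSum n ω' u)) := by
      intro a
      have := measurable_logSum n ω'
      fun_prop
    have hstep : ∀ a : ℕ, ∫⁻ u in Set.Ioo (0 : ℝ) 1, ENNReal.ofReal (1 / (a + 1 + u) ^ 2) *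
        (ENNReal.ofReal (1 / (1 + gaussBranch a u)) *
          ENNReal.ofReal (Real.exp (logSum (n + 1) ω (gaussBranch a u)))) =
        ∫⁻ u in Set.Ioo (0 : ℝ) 1,
          ENNReal.ofReal ((a + 1 + u) ^ ω 0 / ((a + 1 + u) * (a + 1 + u + 1))) *
          ENNReal.ofReal (Real.exp (logSum n ω' u)) := by
      intro a
      refine setLIntegral_congr_fun measurableSet_Ioo fun u hu => ?_
      have hu0 : 0 < u := hu.1
      have hs : (0 : ℝ) < a + 1 + u := by positivity
      rw [logSum_succ, gaussMap_branch a hu, Real.exp_add, ENNReal.ofReal_mul (Real.exp_pos _).le,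
        ← mul_assoc, ← mul_assoc, ← ENNReal.ofReal_mul (by positivity), ← ENNReal.ofReal_mul]
      · congr 2
        rw [gaussBranch, Real.log_inv, neg_neg, mul_comm (ω 0), ← Real.rpow_def_of_pos hs]
        field_simp
      · have := (gaussBranch_mem a hu).1
        positivity
    simp_rw [hstep]
    rw [← lintegral_tsum fun a => (hm a).aemeasurable]
    simp_rw [ENNReal.tsum_mul_right]
    calc _ ≤ ∫⁻ u in Set.Ioo (0 : ℝ) 1, ENNReal.ofReal ((1 + c * ω 0) * (1 / (1 + u))) *
          ENNReal.ofReal (Real.exp (logSum n ω' u)) := by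
          refine setLIntegral_mono' measurableSet_Ioo fun u hu => ?_
          gcongr
          exact H (ω 0) (h0 0) (h1 0) u hu
      _ = ENNReal.ofReal (1 + c * ω 0) * ∫⁻ u in Set.Ioo (0 : ℝ) 1, ENNReal.ofReal (1 / (1 + u)) *
          ENNReal.ofReal (Real.exp (logSum n ω' u)) := by
          have hω0 := h0 0
          rw [← lintegral_const_mul' _ _ ENNReal.ofReal_ne_top]
          refine lintegral_congr fun u => ?_
          rw [ENNReal.ofReal_mul (by positivity), mul_assoc]
      _ ≤ ENNReal.ofReal (1 + c * ω 0) * ENNReal.ofReal (∏ k ∈ Finset.range n, (1 + c * ω' k)) := by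
          gcongr
          exact ih ω' (fun k => h0 _) (fun k => h1 _)
      _ = _ := by
          have hω0 := h0 0
          rw [← ENNReal.ofReal_mul (by positivity), Finset.prod_range_succ', mul_comm]

/-- Exponential moments of weighted Birkhoff sums are bounded in terms of the sum of the weights. -/
lemma lintegral_exp_logSum_le : ∃ c : ℝ, 0 < c ∧ ∀ (n : ℕ) (ω : ℕ → ℝ) (W : ℝ),
    (∀ k, 0 ≤ ω k) → (∀ k, ω k ≤ 9 / 10) → (∀ n, ∑ k ∈ Finset.range n, ω k ≤ W) →
      ∫⁻ t in Set.Ioo (0 : ℝ) 1, ENNReal.ofReal (Real.exp (logSum n ω t)) ≤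
        ENNReal.ofReal (2 * Real.exp (c * W)) := by
  obtain ⟨c, hc, H⟩ := lintegral_exp_logSum_le_prod
  refine ⟨c, hc, fun n ω W h0 h1 hW => ?_⟩
  have hprod : ∏ k ∈ Finset.range n, (1 + c * ω k) ≤ Real.exp (c * W) := by
    calc _ ≤ ∏ k ∈ Finset.range n, Real.exp (c * ω k) := by
          refine Finset.prod_le_prod (fun k _ => ?_) fun k _ => ?_
          · have := h0 k; positivity
          · rw [add_comm]; exact Real.add_one_le_exp _
      _ = Real.exp (c * ∑ k ∈ Finset.range n, ω k) := by
          rw [← Real.exp_sum, Finset.mul_sum]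
      _ ≤ _ := by gcongr; exact hW n
  calc _ ≤ ∫⁻ t in Set.Ioo (0 : ℝ) 1, ENNReal.ofReal 2 * (ENNReal.ofReal (1 / (1 + t)) *
        ENNReal.ofReal (Real.exp (logSum n ω t))) := by
        refine setLIntegral_mono' measurableSet_Ioo fun t ht => ?_
        have h0 := ht.1
        have h1 := ht.2
        rw [← mul_assoc, ← ENNReal.ofReal_mul (by norm_num)]
        refine le_mul_of_one_le_left (by positivity) ?_
        rw [ENNReal.one_le_ofReal, mul_one_div, le_div_iff₀ (by linarith)]
        linarith
    _ = ENNReal.ofReal 2 * _ := lintegral_const_mul' _ _ ENNReal.ofReal_ne_top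
    _ ≤ ENNReal.ofReal 2 * ENNReal.ofReal (Real.exp (c * W)) := by
        gcongr
        exact (H n ω h0 h1).trans (ENNReal.ofReal_le_ofReal hprod)
    _ = _ := by rw [ENNReal.ofReal_mul (by norm_num)]

lemma logSum_const_mul (r : ℝ) (n : ℕ) (ω : ℕ → ℝ) (t : ℝ) :
    logSum n (fun k => r * ω k) t = r * logSum n ω t := by
  simp only [logSum, Finset.mul_sum, mul_assoc]

lemma lintegral_min_rpow_le {B : ℝ} (hB : 0 < B) :
    ∫⁻ t in Set.Ioo (0 : ℝ) 1, ENNReal.ofReal (min 1 ((B * t⁻¹) ^ (5 / 4 : ℝ))) ≤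
      ENNReal.ofReal (5 * B) := by
  have hsub : Set.Ioo (0 : ℝ) 1 ⊆ Set.Ioc 0 B ∪ Set.Ioi B := by
    rw [Set.Ioc_union_Ioi_eq_Ioi hB.le]; exact fun t ht => ht.1
  have hint : IntegrableOn (fun t : ℝ => B ^ (5 / 4 : ℝ) * t ^ (-(5 / 4) : ℝ)) (Set.Ioi B) :=
    (integrableOn_Ioi_rpow_of_lt (by norm_num) hB).const_mul _
  calc _ ≤ ∫⁻ t in Set.Ioc 0 B ∪ Set.Ioi B, ENNReal.ofReal (min 1 ((B * t⁻¹) ^ (5 / 4 : ℝ))) :=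
        lintegral_mono_set hsub
    _ ≤ (∫⁻ t in Set.Ioc 0 B, ENNReal.ofReal (min 1 ((B * t⁻¹) ^ (5 / 4 : ℝ)))) +
        ∫⁻ t in Set.Ioi B, ENNReal.ofReal (min 1 ((B * t⁻¹) ^ (5 / 4 : ℝ))) :=
        lintegral_union_le _ _ _
    _ ≤ ENNReal.ofReal B + ENNReal.ofReal (4 * B) := by
        refine add_le_add ?_ ?_
        · calc _ ≤ ∫⁻ t in Set.Ioc 0 B, 1 := by
                refine lintegral_mono fun t => ?_
                rw [← ENNReal.ofReal_one]
                exact ENNReal.ofReal_le_ofReal (min_le_left _ _)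
            _ = _ := by simp
        · calc _ ≤ ∫⁻ t in Set.Ioi B, ENNReal.ofReal (B ^ (5 / 4 : ℝ) * t ^ (-(5 / 4) : ℝ)) := by
                refine setLIntegral_mono' measurableSet_Ioi fun t ht => ?_
                have ht' : 0 < t := hB.trans ht
                refine ENNReal.ofReal_le_ofReal ((min_le_right _ _).trans_eq ?_)
                rw [Real.mul_rpow hB.le (by positivity), Real.inv_rpow ht'.le, Real.rpow_neg ht'.le]
            _ = ENNReal.ofReal (∫ t in Set.Ioi B, B ^ (5 / 4 : ℝ) * t ^ (-(5 / 4) : ℝ)) := by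
                rw [ofReal_integral_eq_lintegral_ofReal hint]
                refine (ae_restrict_iff' measurableSet_Ioi).mpr (Eventually.of_forall fun t ht => ?_)
                have ht' : 0 < t := hB.trans ht
                positivity
            _ = _ := by
                congr 1
                rw [integral_const_mul, integral_Ioi_rpow_of_lt (by norm_num) hB]
                have : B ^ (5 / 4 : ℝ) * B ^ (-(5 / 4) + 1 : ℝ) = B := by
                  rw [← Real.rpow_add hB]; norm_num
                rw [mul_div_assoc', mul_neg, this]; norm_num; ring
    _ = _ := by rw [← ENNReal.ofReal_add hB.le (by positivity)]; congr 1; ring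

/-- Comparison with ∫ min(1, (B/t)^{5/4}) dt, B = 2/A, cut along the branches. The exponent 5/4 > 1
makes the part t > B of order B; the factor 4 comes from a + 1 + u ≤ 2(a + 1). -/
lemma tsum_min_rpow_le {A : ℝ} (hA : 0 < A) :
    ∑' a : ℕ, ENNReal.ofReal (1 / ((a : ℝ) + 1) ^ 2 * min 1 ((2 * (a + 1) / A) ^ (5 / 4 : ℝ))) ≤
      ENNReal.ofReal (40 / A) := by
  have h := lintegral_gauss fun t => ENNReal.ofReal (min 1 ((2 / A * t⁻¹) ^ (5 / 4 : ℝ)))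
  have h2 := lintegral_min_rpow_le (B := 2 / A) (by positivity)
  rw [h] at h2
  have hterm : ∀ a : ℕ, ENNReal.ofReal (1 / ((a : ℝ) + 1) ^ 2 * min 1 ((2 * (a + 1) / A) ^ (5 / 4 : ℝ))) ≤
      4 * ∫⁻ u in Set.Ioo (0 : ℝ) 1, ENNReal.ofReal (1 / (a + 1 + u) ^ 2) *
        ENNReal.ofReal (min 1 ((2 / A * (gaussBranch a u)⁻¹) ^ (5 / 4 : ℝ))) := by
    intro a
    have h4 : (4 : ENNReal) = ENNReal.ofReal 4 := by norm_num
    rw [h4, ← lintegral_const_mul' _ _ ENNReal.ofReal_ne_top]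
    calc _ = ∫⁻ u in Set.Ioo (0 : ℝ) 1, ENNReal.ofReal (1 / ((a : ℝ) + 1) ^ 2 *
          min 1 ((2 * (a + 1) / A) ^ (5 / 4 : ℝ))) := by simp
      _ ≤ _ := by
          refine setLIntegral_mono' measurableSet_Ioo fun u hu => ?_
          have hu0 := hu.1
          have hu1 := hu.2
          have ha : (0 : ℝ) ≤ a := a.cast_nonneg
          rw [← ENNReal.ofReal_mul (by positivity), ← ENNReal.ofReal_mul (by norm_num)]
          refine ENNReal.ofReal_le_ofReal ?_
          rw [gaussBranch, inv_inv, ← mul_assoc]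
          refine mul_le_mul ?_ ?_ (by positivity) (by positivity)
          · rw [mul_one_div, div_le_div_iff₀ (by positivity) (by positivity)]
            nlinarith
          · refine min_le_min_left _ (Real.rpow_le_rpow (by positivity) ?_ (by norm_num))
            rw [mul_div_right_comm]
            exact mul_le_mul_of_nonneg_left (by linarith) (by positivity)
  calc _ ≤ ∑' a : ℕ, _ := ENNReal.tsum_le_tsum hterm
    _ = 4 * _ := ENNReal.tsum_mul_left
    _ ≤ 4 * ENNReal.ofReal (5 * (2 / A)) := by gcongr
    _ = _ := by
        rw [show (4 : ENNReal) = ENNReal.ofReal 4 by norm_num, ← ENNReal.ofReal_mul (by norm_num)]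
        congr 1; ring

lemma volume_inter_eq_lintegral {S : Set ℝ} (hS : MeasurableSet S) :
    volume (S ∩ Set.Ioo (0 : ℝ) 1) = ∫⁻ t in Set.Ioo (0 : ℝ) 1, S.indicator 1 t := by
  rw [lintegral_indicator_one hS, Measure.restrict_apply hS]

/-- Sharp exponential tail for `-log t` plus a lighter Birkhoff sum. -/
lemma volume_log_add_logSum_gt_le (W : ℝ) : ∃ C : ℝ, 0 < C ∧ ∀ ω : ℕ → ℝ, (∀ k, 0 ≤ ω k) →
    (∀ k, ω k ≤ 18 / 25) → (∀ n, ∑ k ∈ Finset.range n, ω k ≤ W) → ∀ (n : ℕ) (D : ℝ),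
      volume ({t | D < -Real.log t + logSum n ω (gaussMap t)} ∩ Set.Ioo (0 : ℝ) 1) ≤
        ENNReal.ofReal (C * Real.exp (-D)) := by
  obtain ⟨c, hc, H⟩ := lintegral_exp_logSum_le
  refine ⟨40 * (2 * Real.exp (c * (5 / 4 * W))), by positivity, fun ω h0 h1 hW n D => ?_⟩
  have hmeas : MeasurableSet {t | D < -Real.log t + logSum n ω (gaussMap t)} :=
    measurableSet_lt measurable_const (Real.measurable_log.neg.add
      ((measurable_logSum n ω).comp measurable_gaussMap))
  rw [volume_inter_eq_lintegral hmeas, lintegral_gauss]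
  set A : ℝ := Real.exp D with hA
  have hA0 : 0 < A := Real.exp_pos _
  -- Markov's inequality at order 5/4 on each branch; 5/4 · 18/25 = 9/10 is exactly the admissible
  -- limit for the weights.
  set ω' : ℕ → ℝ := fun k => 5 / 4 * ω k with hω'
  have hE := H n ω' (5 / 4 * W) (fun k => by have := h0 k; simp only [hω']; positivity)
    (fun k => by have := h1 k; simp only [hω']; linarith)
    (fun n => by simp only [hω']; rw [← Finset.mul_sum]; have := hW n; linarith)
  have hterm : ∀ a : ℕ, ∫⁻ u in Set.Ioo (0 : ℝ) 1, ENNReal.ofReal (1 / (a + 1 + u) ^ 2) *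
      Set.indicator {t | D < -Real.log t + logSum n ω (gaussMap t)} 1 (gaussBranch a u) ≤
      ENNReal.ofReal (1 / ((a : ℝ) + 1) ^ 2 * min 1 ((2 * (a + 1) / A) ^ (5 / 4 : ℝ))) *
        ∫⁻ u in Set.Ioo (0 : ℝ) 1, ENNReal.ofReal (Real.exp (logSum n ω' u)) := by
    intro a
    rw [← lintegral_const_mul' _ _ ENNReal.ofReal_ne_top]
    refine setLIntegral_mono' measurableSet_Ioo fun u hu => ?_
    have hu0 := hu.1
    have hu1 := hu.2
    have ha : (0 : ℝ) ≤ a := a.cast_nonneg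
    rw [ENNReal.ofReal_mul (by positivity), mul_assoc]
    refine mul_le_mul' (ENNReal.ofReal_le_ofReal (one_div_le_one_div_of_le (by positivity)
      (pow_le_pow_left₀ (by positivity) (by linarith) 2))) ?_
    by_cases hmem : gaussBranch a u ∈ {t | D < -Real.log t + logSum n ω (gaussMap t)}
    · rw [Set.indicator_of_mem hmem, Pi.one_apply, ← ENNReal.ofReal_mul (by positivity),
        ENNReal.one_le_ofReal]
      have hs : (0 : ℝ) < a + 1 + u := by positivity
      rw [Set.mem_ofPred_eq, gaussMap_branch a hu, gaussBranch, Real.log_inv, neg_neg] at hmem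
      have hY := logSum_nonneg h0 n ⟨hu.1.le, hu.2⟩
      have hY' : logSum n ω' u = 5 / 4 * logSum n ω u := logSum_const_mul _ _ _ _
      rw [hY']
      set Y := logSum n ω u with hYdef
      have e1 : 1 ≤ Real.exp (5 / 4 * Y) := Real.one_le_exp (by positivity)
      rcases min_choice (1 : ℝ) ((2 * (a + 1) / A) ^ (5 / 4 : ℝ)) with hm | hm
      · rw [hm, one_mul]; exact e1
      · rw [hm, show 5 / 4 * Y = Y * (5 / 4) by ring, Real.exp_mul,
          ← Real.mul_rpow (by positivity) (Real.exp_pos _).le]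
        refine Real.one_le_rpow ?_ (by norm_num)
        rw [div_mul_eq_mul_div, le_div_iff₀ hA0, one_mul, hA]
        calc Real.exp D ≤ Real.exp (Real.log (a + 1 + u) + Y) := Real.exp_le_exp.mpr hmem.le
          _ = (a + 1 + u) * Real.exp Y := by rw [Real.exp_add, Real.exp_log hs]
          _ ≤ _ := by gcongr; linarith
    · rw [Set.indicator_of_notMem hmem]; exact zero_le
  calc _ ≤ ∑' a : ℕ, _ := ENNReal.tsum_le_tsum hterm
    _ = _ := ENNReal.tsum_mul_right
    _ ≤ ENNReal.ofReal (40 / A) * ENNReal.ofReal (2 * Real.exp (c * (5 / 4 * W))) :=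
        mul_le_mul' (tsum_min_rpow_le hA0) hE
    _ = _ := by
        rw [← ENNReal.ofReal_mul (by positivity), hA, Real.exp_neg]
        congr 1; ring

/-- Near `0`, the Birkhoff sums along the further orbit are bounded on a positive proportion. -/
lemma le_volume_logSum_le (W : ℝ) : ∃ M : ℝ, 0 < M ∧ ∀ ω : ℕ → ℝ, (∀ k, 0 ≤ ω k) →
    (∀ k, ω k ≤ 1) → (∀ n, ∑ k ∈ Finset.range n, ω k ≤ W) → ∀ A : ℕ, 1 ≤ A →
      ENNReal.ofReal (1 / (6 * A)) ≤
        volume ({t | t < 1 / (A : ℝ) ∧ ∀ n, logSum n ω (gaussMap t) ≤ M} ∩ Set.Ioo (0 : ℝ) 1) := by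
  obtain ⟨c, hc, H⟩ := lintegral_exp_logSum_le
  -- Chosen so that Markov's inequality for the halved weights gives probability at most 2e^{cW/2}/R
  -- ≤ 1/2. Halving brings weights up to 1 below 9/10 and explains the 2 in M = 2 log R.
  set R : ℝ := 4 * Real.exp (|c * (1 / 2 * W)|) with hR
  have hRp : 1 < R := by
    have : 1 ≤ Real.exp (|c * (1 / 2 * W)|) := Real.one_le_exp (abs_nonneg _)
    linarith
  refine ⟨2 * Real.log R, by have := Real.log_pos hRp; positivity, fun ω h0 h1 hW A hA => ?_⟩
  set M := 2 * Real.log R with hM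
  have hmeasV : MeasurableSet {u : ℝ | ∀ n, logSum n ω u ≤ M} := by
    rw [Set.ofPred_forall]
    exact MeasurableSet.iInter fun n => measurableSet_le (measurable_logSum n ω) measurable_const
  have hmeas : MeasurableSet {t | t < 1 / (A : ℝ) ∧ ∀ n, logSum n ω (gaussMap t) ≤ M} :=
    (measurableSet_lt measurable_id measurable_const).inter (measurable_gaussMap hmeasV)
  set V : Set ℝ := {u : ℝ | ∀ n, logSum n ω u ≤ M} with hV
  have hbad : ∀ n, volume ({u | M < logSum n ω u} ∩ Set.Ioo (0 : ℝ) 1) ≤ ENNReal.ofReal (1 / 2) := by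
    intro n
    have hE := H n (fun k => 1 / 2 * ω k) (1 / 2 * W) (fun k => by have := h0 k; positivity)
      (fun k => by have := h1 k; linarith)
      (fun n => by rw [← Finset.mul_sum]; have := hW n; linarith)
    have hms : MeasurableSet {u | M < logSum n ω u} :=
      measurableSet_lt measurable_const (measurable_logSum n ω)
    rw [volume_inter_eq_lintegral hms]
    calc _ ≤ ∫⁻ t in Set.Ioo (0 : ℝ) 1, ENNReal.ofReal (1 / R) *
          ENNReal.ofReal (Real.exp (logSum n (fun k => 1 / 2 * ω k) t)) := by
          refine lintegral_mono fun t => ?_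
          by_cases hmem : t ∈ {u | M < logSum n ω u}
          · rw [Set.indicator_of_mem hmem, Pi.one_apply, ← ENNReal.ofReal_mul (by positivity),
              ENNReal.one_le_ofReal, logSum_const_mul, one_div_mul_eq_div, le_div_iff₀ (by positivity),
              one_mul]
            have hmem' : M < logSum n ω t := hmem
            calc R = Real.exp (Real.log R) := (Real.exp_log (by positivity)).symm
              _ ≤ _ := Real.exp_le_exp.mpr (by linarith)
          · rw [Set.indicator_of_notMem hmem]; exact zero_le
      _ = ENNReal.ofReal (1 / R) * _ := lintegral_const_mul' _ _ ENNReal.ofReal_ne_top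
      _ ≤ ENNReal.ofReal (1 / R) * ENNReal.ofReal (2 * Real.exp (c * (1 / 2 * W))) := by gcongr
      _ ≤ _ := by
          rw [← ENNReal.ofReal_mul (by positivity)]
          refine ENNReal.ofReal_le_ofReal ?_
          rw [one_div_mul_eq_div, div_le_iff₀ (by positivity), hR]
          have := Real.exp_le_exp.mpr (le_abs_self (c * (1 / 2 * W)))
          linarith
  have hVc : volume (Vᶜ ∩ Set.Ioo (0 : ℝ) 1) ≤ ENNReal.ofReal (1 / 2) := by
    have hsub : Vᶜ ∩ Set.Ioo (0 : ℝ) 1 ⊆ ⋃ n, ({u | M < logSum n ω u} ∩ Set.Ioo (0 : ℝ) 1) := by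
      rintro u ⟨hu, hu'⟩
      simp only [hV, Set.mem_compl_iff, Set.mem_ofPred_eq, not_forall, not_le] at hu
      obtain ⟨n, hn⟩ := hu
      exact Set.mem_iUnion.mpr ⟨n, hn, hu'⟩
    have hmono : Monotone fun n => {u | M < logSum n ω u} ∩ Set.Ioo (0 : ℝ) 1 := by
      intro m n hmn u hu
      exact ⟨lt_of_lt_of_le hu.1 (logSum_mono h0 ⟨hu.2.1.le, hu.2.2⟩ hmn), hu.2⟩
    refine (measure_mono hsub).trans ?_
    rw [hmono.measure_iUnion]
    exact iSup_le hbad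
  have hVv : ENNReal.ofReal (1 / 2) ≤ volume (V ∩ Set.Ioo (0 : ℝ) 1) := by
    have htot : volume (V ∩ Set.Ioo (0 : ℝ) 1) + volume (Vᶜ ∩ Set.Ioo (0 : ℝ) 1) = ENNReal.ofReal 1 := by
      have := measure_inter_add_sdiff (μ := volume) (Set.Ioo (0 : ℝ) 1) hmeasV
      rw [Set.inter_comm V, Set.inter_comm Vᶜ, ← Set.sdiff_eq, this]; simp
    by_contra hcon
    rw [not_le] at hcon
    have h2 : volume (V ∩ Set.Ioo (0 : ℝ) 1) + volume (Vᶜ ∩ Set.Ioo (0 : ℝ) 1) <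
        ENNReal.ofReal (1 / 2) + ENNReal.ofReal (1 / 2) :=
      ENNReal.add_lt_add_of_lt_of_le (ne_top_of_le_ne_top ENNReal.ofReal_ne_top hVc) hcon hVc
    rw [htot, ← ENNReal.ofReal_add (by norm_num) (by norm_num)] at h2
    norm_num at h2
  rw [volume_inter_eq_lintegral hmeas, lintegral_gauss]
  have hinj : Function.Injective fun b : ℕ => A + b := fun b b' h => by simpa using h
  have hA1 : (1 : ℝ) ≤ A := by exact_mod_cast hA
  -- Only the branches of index A + b are kept: they lie below 1/A. Their Jacobians are bounded
  -- below by the terms of a telescoping series with sum 1/(A + 2) ≥ 1/(3A).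
  have hterm : ∀ b : ℕ, ENNReal.ofReal (1 / (((b : ℝ) + 1 + (A + 1)) * (b + 1 + (A + 1) + 1))) *
      ENNReal.ofReal (1 / 2) ≤
      ∫⁻ u in Set.Ioo (0 : ℝ) 1, ENNReal.ofReal (1 / (((A + b : ℕ) : ℝ) + 1 + u) ^ 2) *
        Set.indicator {t | t < 1 / (A : ℝ) ∧ ∀ n, logSum n ω (gaussMap t) ≤ M} 1
          (gaussBranch (A + b) u) := by
    intro b
    have hb : (0 : ℝ) ≤ b := b.cast_nonneg
    calc _ ≤ ENNReal.ofReal (1 / (((b : ℝ) + 1 + (A + 1)) * (b + 1 + (A + 1) + 1))) *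
          ∫⁻ u in Set.Ioo (0 : ℝ) 1, V.indicator 1 u := by
          rw [← volume_inter_eq_lintegral hmeasV]; gcongr
      _ = ∫⁻ u in Set.Ioo (0 : ℝ) 1,
          ENNReal.ofReal (1 / (((b : ℝ) + 1 + (A + 1)) * (b + 1 + (A + 1) + 1))) * V.indicator 1 u :=
          (lintegral_const_mul' _ _ ENNReal.ofReal_ne_top).symm
      _ ≤ _ := by
          refine setLIntegral_mono' measurableSet_Ioo fun u hu => ?_
          have hu0 := hu.1
          have hu1 := hu.2
          by_cases hmem : u ∈ V
          · have hmem' : gaussBranch (A + b) u ∈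
                {t | t < 1 / (A : ℝ) ∧ ∀ n, logSum n ω (gaussMap t) ≤ M} := by
              refine ⟨?_, by rw [gaussMap_branch _ hu]; exact hmem⟩
              rw [gaussBranch, ← one_div]
              push_cast
              gcongr; linarith
            rw [Set.indicator_of_mem hmem, Set.indicator_of_mem hmem', Pi.one_apply, Pi.one_apply]
            gcongr
            push_cast
            nlinarith
          · rw [Set.indicator_of_notMem hmem, mul_zero]; exact zero_le
  calc ENNReal.ofReal (1 / (6 * A)) ≤ ENNReal.ofReal (1 / (1 + ((A : ℝ) + 1))) * ENNReal.ofReal (1 / 2) := by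
        rw [← ENNReal.ofReal_mul (by positivity)]
        refine ENNReal.ofReal_le_ofReal ?_
        rw [div_mul_div_comm, one_mul]
        exact one_div_le_one_div_of_le (by positivity) (by linarith)
    _ = (∑' b : ℕ, ENNReal.ofReal (1 / (((b : ℝ) + 1 + (A + 1)) * (b + 1 + (A + 1) + 1)))) *
        ENNReal.ofReal (1 / 2) := by
        have hT := hasSum_telescope ((A : ℝ) + 1) (by positivity)
        rw [← hT.tsum_eq, ENNReal.ofReal_tsum_of_nonneg (fun b => by positivity) hT.summable]
    _ = _ := ENNReal.tsum_mul_right.symm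
    _ ≤ _ := ENNReal.tsum_le_tsum hterm
    _ ≤ _ := ENNReal.tsum_comp_le_tsum_of_injective hinj _

/-- Monotone convergence and 1 + Y ≤ 2e^{Y/2}. This dominates F minus its center and so controls the
average on a cylinder. -/
lemma lintegral_iSup_one_add_logSum_le (W : ℝ) : ∃ C : ℝ, 0 < C ∧ ∀ ω : ℕ → ℝ, (∀ k, 0 ≤ ω k) →
    (∀ k, ω k ≤ 1) → (∀ n, ∑ k ∈ Finset.range n, ω k ≤ W) →
      ∫⁻ t in Set.Ioo (0 : ℝ) 1, ⨆ n, ENNReal.ofReal (1 + logSum n ω t) ≤ ENNReal.ofReal C := by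
  obtain ⟨c, hc, H⟩ := lintegral_exp_logSum_le
  refine ⟨2 * (2 * Real.exp (c * (1 / 2 * W))), by positivity, fun ω h0 h1 hW => ?_⟩
  rw [lintegral_iSup']
  · refine iSup_le fun n => ?_
    have hE := H n (fun k => 1 / 2 * ω k) (1 / 2 * W) (fun k => by have := h0 k; positivity)
      (fun k => by have := h1 k; linarith)
      (fun n => by rw [← Finset.mul_sum]; have := hW n; linarith)
    calc _ ≤ ∫⁻ t in Set.Ioo (0 : ℝ) 1, ENNReal.ofReal 2 *
          ENNReal.ofReal (Real.exp (logSum n (fun k => 1 / 2 * ω k) t)) := by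
          refine lintegral_mono fun t => ?_
          simp only
          rw [← ENNReal.ofReal_mul (by norm_num)]
          refine ENNReal.ofReal_le_ofReal ?_
          rw [logSum_const_mul]
          have := Real.add_one_le_exp (1 / 2 * logSum n ω t)
          linarith
      _ = ENNReal.ofReal 2 * _ := lintegral_const_mul' _ _ ENNReal.ofReal_ne_top
      _ ≤ _ := by
          rw [ENNReal.ofReal_mul (p := 2) (by norm_num)]
          gcongr
  · exact fun n => ((measurable_logSum n ω).const_add 1).ennreal_ofReal.aemeasurable
  · refine (ae_restrict_iff' measurableSet_Ioo).mpr (Eventually.of_forall fun t ht m n hmn => ?_)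
    have := logSum_mono h0 ⟨ht.1.le, ht.2⟩ hmn
    exact ENNReal.ofReal_le_ofReal (by simp only at this; linarith)

/-! ### Cylinders of the continued fraction expansion -/

/-- A continued fraction cylinder, given by its last two convergents `p / q` and `r / s`. -/
structure Cylinder where
  p : ℕ
  q : ℕ
  r : ℕ
  s : ℕ
  q_pos : 0 < q
  s_le : s ≤ q
  det : (r * q : ℤ) - p * s = 1 ∨ (r * q : ℤ) - p * s = -1

namespace Cylinder

instance (c : Cylinder) : NeZero c.q := ⟨c.q_pos.ne'⟩

lemma q_pos_real (c : Cylinder) : (0 : ℝ) < c.q := Nat.cast_pos.mpr c.q_pos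

/-- The determinant relation modulo q reads ps = ±1. -/
lemma isUnit_p (c : Cylinder) : IsUnit ((c.p : ℤ) : ZMod c.q) := by
  have h : ∀ e : ℤ, (c.r * c.q : ℤ) - c.p * c.s = e →
      ((c.p : ℤ) : ZMod c.q) * (c.s : ZMod c.q) = -(e : ZMod c.q) := by
    intro e he
    have := congrArg (fun z : ℤ => (z : ZMod c.q)) he
    push_cast at this
    rw [ZMod.natCast_self, mul_zero, zero_sub] at this
    rw [← this]; push_cast; ring
  rcases c.det with h1 | h1
  · exact IsUnit.of_mul_eq_one (-(c.s : ZMod c.q)) (by rw [mul_neg, h _ h1]; simp)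
  · exact IsUnit.of_mul_eq_one (c.s : ZMod c.q) (by rw [h _ h1]; simp)

/-- The point of the cylinder with the given image under the iterated Gauss map. -/
noncomputable def point (c : Cylinder) (t : ℝ) : ℝ := (c.p + c.r * t) / (c.q + c.s * t)

/-- The subcylinder obtained by prescribing the next partial quotient to be `a + 1`. -/
def child (c : Cylinder) (a : ℕ) : Cylinder where
  p := (a + 1) * c.p + c.r
  q := (a + 1) * c.q + c.s
  r := c.p
  s := c.q
  q_pos := by have := c.q_pos; positivity
  s_le := by nlinarith [c.q_pos]
  det := by
    rcases c.det with h | h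
    · right; push_cast; linarith
    · left; push_cast; linarith

/-- The Gauss sum of the last convergent. -/
noncomputable def gauss (c : Cylinder) : ℂ := gaussSum c.q c.p 0

/-- The vertical integral over the last convergent, from the height `1 / q²` on. -/
noncomputable def center (c : Cylinder) : ℂ := thetaInt ((c.q : ℝ) ^ 2)⁻¹ ((c.p : ℝ) / c.q)

lemma point_branch (c : Cylinder) (a : ℕ) {u : ℝ} (hu : 0 < u) :
    c.point (gaussBranch a u) = (c.child a).point u := by
  have hs : (0 : ℝ) < a + 1 + u := by positivity
  have hq := c.q_pos_real
  have h1 : (0 : ℝ) < c.q * (a + 1 + u) + c.s := by positivity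
  rw [point, point, gaussBranch, child]
  push_cast
  rw [div_eq_div_iff (by positivity) (by positivity)]
  field_simp
  ring

lemma abs_det (c : Cylinder) : |(c.r * c.q : ℝ) - c.p * c.s| = 1 := by
  rcases c.det with h | h
  · have : (c.r * c.q : ℝ) - c.p * c.s = 1 := by exact_mod_cast h
    rw [this, abs_one]
  · have : (c.r * c.q : ℝ) - c.p * c.s = -1 := by exact_mod_cast h
    rw [this, abs_neg, abs_one]

lemma abs_point_sub (c : Cylinder) {t : ℝ} (ht : 0 < t) :
    |c.point t - c.p / c.q| = t / (c.q * (c.q + c.s * t)) := by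
  have hq := c.q_pos_real
  have hd : (0 : ℝ) < c.q + c.s * t := by positivity
  have e : c.point t - c.p / c.q = ((c.r * c.q : ℝ) - c.p * c.s) * (t / (c.q * (c.q + c.s * t))) := by
    rw [point]; field_simp; ring
  rw [e, abs_mul, c.abs_det, one_mul, abs_of_pos (by positivity)]

lemma abs_point_sub_le (c : Cylinder) {t : ℝ} (ht : t ∈ Set.Ioo (0 : ℝ) 1) :
    |c.point t - c.p / c.q| ≤ ((c.q : ℝ) ^ 2)⁻¹ := by
  have hq := c.q_pos_real
  rw [c.abs_point_sub ht.1, ← one_div]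
  have := ht.1
  refine div_le_div₀ zero_le_one ht.2.le (by positivity) ?_
  rw [sq]
  gcongr
  have : 0 ≤ (c.s : ℝ) * t := by positivity
  linarith

lemma norm_gauss_le (c : Cylinder) : √(2 * c.q) * (‖c.gauss‖ / (2 * c.q)) ≤ 1 := by
  have hq := c.q_pos_real
  rw [mul_div_assoc', div_le_one (by positivity)]
  calc _ ≤ √(2 * c.q) * √(2 * c.q) := by
        gcongr; exact norm_gaussSum_le c.isUnit_p 0
    _ = _ := Real.mul_self_sqrt (by positivity)

/-- For t = 1/(a + 1 + u) the distance to p/q is exactly 1/(q(q' + qu)), which lies in the range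
required by `thetaInt_step` as qu ≤ q'. Moreover q'/q = a + 1 + s/q agrees with 1/t within a factor
4, so log(q'/q) may be replaced by -log t. -/
lemma exists_thetaInt_step : ∃ C : ℝ, 0 < C ∧ ∀ (c : Cylinder) (a : ℕ), ∀ u ∈ Set.Ioo (0 : ℝ) 1,
    ‖thetaInt (((c.child a).q : ℝ) ^ 2)⁻¹ (c.point (gaussBranch a u)) -
      thetaInt ((c.q : ℝ) ^ 2)⁻¹ (c.point (gaussBranch a u)) -
      c.gauss / (2 * c.q) * ((-Real.log (gaussBranch a u) : ℝ) : ℂ)‖ ≤ C / √c.q := by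
  obtain ⟨C, hC, H⟩ := thetaInt_step
  refine ⟨C + 2, by positivity, fun c a u hu => ?_⟩
  have hq := c.q_pos_real
  have hu0 := hu.1
  have hu1 := hu.2
  have ha : (0 : ℝ) ≤ a := a.cast_nonneg
  set t := gaussBranch a u with ht
  have htm := gaussBranch_mem a hu
  set h : ℝ := c.point t - c.p / c.q with hh
  have hs : (c.s : ℝ) ≤ c.q := by exact_mod_cast c.s_le
  have hs0 : (0 : ℝ) ≤ c.s := Nat.cast_nonneg _
  have hq' : ((c.child a).q : ℝ) = (a + 1) * c.q + c.s := by rw [child]; push_cast; ring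
  have hqq : c.q ≤ (c.child a).q := (c.child a).s_le
  have hqq' : (c.q : ℝ) ≤ (c.child a).q := by exact_mod_cast hqq
  have hq'p : (0 : ℝ) < (c.child a).q := (c.child a).q_pos_real
  have hqu : (c.q : ℝ) * u ≤ (c.child a).q := by nlinarith
  have habs : |h| = 1 / (c.q * ((c.child a).q + c.q * u)) := by
    rw [hh, c.abs_point_sub htm.1, gaussBranch, hq']
    have : (0 : ℝ) < a + 1 + u := by positivity
    field_simp
    ring
  have h1 := H c.q (c.child a).q c.p c.isUnit_p hqq h
    (by rw [habs]
        refine one_div_le_one_div_of_le (by positivity) ?_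
        nlinarith [mul_le_mul_of_nonneg_left hqu hq.le])
    (by rw [habs]
        refine one_div_le_one_div_of_le (by positivity) ?_
        gcongr
        have : 0 ≤ (c.q : ℝ) * u := by positivity
        linarith)
  have hx : ((c.p : ℤ) : ℝ) / c.q + h = c.point t := by rw [hh]; push_cast; ring
  rw [hx] at h1
  have hlog : |Real.log ((c.child a).q / c.q) - Real.log t⁻¹| ≤ 2 := by
    have htinv : t⁻¹ = a + 1 + u := by rw [ht, gaussBranch, inv_inv]
    rw [htinv, hq']
    refine abs_log_sub_log_le (by positivity) ?_ ?_
    · rw [div_le_iff₀ hq]; nlinarith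
    · rw [mul_div_assoc', le_div_iff₀ hq]; nlinarith
  rw [Real.log_inv] at hlog
  have hg : ‖c.gauss / (2 * c.q)‖ ≤ (√c.q)⁻¹ := norm_gaussSum_div_le c.isUnit_p
  calc _ = ‖(thetaInt (((c.child a).q : ℝ) ^ 2)⁻¹ (c.point t) -
      thetaInt ((c.q : ℝ) ^ 2)⁻¹ (c.point t) -
      c.gauss / (2 * c.q) * Real.log ((c.child a).q / c.q)) +
      c.gauss / (2 * c.q) * ((Real.log ((c.child a).q / c.q) - -Real.log t : ℝ) : ℂ)‖ := by
        congr 1; push_cast; ring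
    _ ≤ C / √c.q + (√c.q)⁻¹ * 2 := by
        refine (norm_add_le _ _).trans (add_le_add h1 ?_)
        rw [norm_mul, Complex.norm_real, Real.norm_eq_abs]
        gcongr
    _ = _ := by field_simp

lemma exists_center_bound : ∃ C : ℝ, 0 < C ∧ ∀ (c : Cylinder), ∀ t ∈ Set.Ioo (0 : ℝ) 1,
    ‖thetaInt ((c.q : ℝ) ^ 2)⁻¹ (c.point t) - c.center‖ ≤ C / √c.q := by
  obtain ⟨C, hC, H⟩ := thetaInt_sub_center
  refine ⟨C, hC, fun c t ht => ?_⟩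
  have h := H c.q c.p c.isUnit_p (c.point t - c.p / c.q) (c.abs_point_sub_le ht)
  rwa [show ((c.p : ℤ) : ℝ) / c.q + (c.point t - c.p / c.q) = c.point t by push_cast; ring] at h

end Cylinder

/-! ### Nested cylinders along an orbit of the Gauss map. -/

lemma gaussMap_iterate_of_irrational {t : ℝ} (h : t ∈ Set.Ioo (0 : ℝ) 1) (ht : Irrational t) (k : ℕ) :
    gaussMap^[k] t ∈ Set.Ioo (0 : ℝ) 1 ∧ Irrational (gaussMap^[k] t) := by
  induction k with
  | zero => exact ⟨h, ht⟩
  | succ k ih =>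
    rw [Function.iterate_succ_apply']
    exact gaussMap_mem_of_irrational ih.2

namespace Cylinder

/-- The nested cylinders around the point with parameter `t`. -/
noncomputable def orbit (c : Cylinder) (t : ℝ) : ℕ → Cylinder
  | 0 => c
  | k + 1 => (orbit c t k).child (digit (gaussMap^[k] t))

lemma point_orbit (c : Cylinder) {t : ℝ} (h : t ∈ Set.Ioo (0 : ℝ) 1) (ht : Irrational t) (k : ℕ) :
    (c.orbit t k).point (gaussMap^[k] t) = c.point t := by
  induction k with
  | zero => rfl
  | succ k ih =>
    have hk := (gaussMap_iterate_of_irrational h ht k).1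
    have hk' := (gaussMap_iterate_of_irrational h ht (k + 1)).1
    rw [orbit, ← point_branch _ _ hk'.1, Function.iterate_succ_apply', gaussBranch_digit hk, ih]

lemma q_le_orbit_succ (c : Cylinder) (t : ℝ) (k : ℕ) : (c.orbit t k).q ≤ (c.orbit t (k + 1)).q :=
  (c.orbit t (k + 1)).s_le

lemma two_mul_q_le_orbit (c : Cylinder) (t : ℝ) (k : ℕ) :
    2 * (c.orbit t k).q ≤ (c.orbit t (k + 2)).q := by
  have h1 := c.q_le_orbit_succ t k
  have h2 : (c.orbit t (k + 2)).q = (digit (gaussMap^[k + 1] t) + 1) * (c.orbit t (k + 1)).q +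
    (c.orbit t k).q := rfl
  rw [h2]
  nlinarith [Nat.zero_le (digit (gaussMap^[k + 1] t) * (c.orbit t (k + 1)).q)]

lemma two_pow_mul_q_le (c : Cylinder) (t : ℝ) (k : ℕ) : 2 ^ (k / 2) * c.q ≤ (c.orbit t k).q := by
  induction k using Nat.twoStepInduction with
  | zero => simp [orbit]
  | one =>
    have h : c.q ≤ (c.orbit t 1).q := c.q_le_orbit_succ t 0
    simpa using h
  | more k ih _ =>
    have := c.two_mul_q_le_orbit t k
    rw [show (k + 2) / 2 = k / 2 + 1 by omega, pow_succ]
    linarith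

end Cylinder

/-- The geometric weights that bound the decay of `√(q / q_k)` along nested cylinders. -/
noncomputable def decay (k : ℕ) : ℝ := (√2)⁻¹ ^ (k / 2)

lemma inv_sqrt_two_le : (√2)⁻¹ ≤ (18 / 25 : ℝ) := by
  rw [inv_le_comm₀ (by positivity) (by norm_num)]
  exact Real.le_sqrt_of_sq_le (by norm_num)

lemma decay_nonneg (k : ℕ) : 0 ≤ decay k := by unfold decay; positivity

lemma decay_le_one (k : ℕ) : decay k ≤ 1 :=
  pow_le_one₀ (by positivity) (inv_sqrt_two_le.trans (by norm_num))

/-- The shift by 2 matters, since the weights of index 0 and 1 both equal 1. The number 18/25 is a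
rational bound for 1/√2 that stays within 9/10 after multiplication by 5/4. -/
lemma decay_le (k : ℕ) : decay (k + 2) ≤ 18 / 25 := by
  have h := decay_le_one k
  have h0 := decay_nonneg k
  have e : decay (k + 2) = decay k * (√2)⁻¹ := by
    rw [decay, decay, show (k + 2) / 2 = k / 2 + 1 by omega, pow_succ]
  rw [e]
  nlinarith [inv_sqrt_two_le]

lemma sum_decay_le (n : ℕ) : ∑ k ∈ Finset.range n, decay k ≤ 8 := by
  -- The added term majorises the remaining tail; the induction works because 4 · 18/25 ≤ 3.
  have h : ∑ k ∈ Finset.range n, decay k + 4 * (decay n + decay (n + 1)) ≤ 8 := by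
    induction n with
    | zero => simp [decay]; norm_num
    | succ n ih =>
      have e : decay (n + 2) = decay n * (√2)⁻¹ := by
        rw [decay, decay, show (n + 2) / 2 = n / 2 + 1 by omega, pow_succ]
      rw [Finset.sum_range_succ, show n + 1 + 1 = n + 2 by ring, e]
      have := decay_nonneg n
      nlinarith [inv_sqrt_two_le]
  have := decay_nonneg n
  have := decay_nonneg (n + 1)
  linarith

namespace Cylinder

lemma sqrt_div_sqrt_le_decay (c : Cylinder) (t : ℝ) (k : ℕ) :
    √c.q / √(c.orbit t k).q ≤ decay k := by
  have hq := c.q_pos_real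
  have hq' := (c.orbit t k).q_pos_real
  have h : (2 : ℝ) ^ (k / 2) * c.q ≤ (c.orbit t k).q := by exact_mod_cast c.two_pow_mul_q_le t k
  rw [div_le_iff₀ (Real.sqrt_pos.mpr hq'), decay, inv_pow, inv_mul_eq_div, le_div_iff₀ (by positivity)]
  have e : (√2) ^ (k / 2) = √(2 ^ (k / 2)) := by
    rw [eq_comm, Real.sqrt_eq_iff_mul_self_eq (by positivity) (by positivity), ← mul_pow,
      Real.mul_self_sqrt (by norm_num)]
  rw [e, mul_comm, ← Real.sqrt_mul (by positivity)]
  exact Real.sqrt_le_sqrt h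

lemma weight_le_decay (c : Cylinder) (t : ℝ) (k : ℕ) :
    √(2 * c.q) * (‖(c.orbit t k).gauss‖ / (2 * (c.orbit t k).q)) ≤ decay k := by
  have hq := c.q_pos_real
  have hq' := (c.orbit t k).q_pos_real
  have h1 := (c.orbit t k).norm_gauss_le
  have h2 := c.sqrt_div_sqrt_le_decay t k
  have hs : 0 < √((c.orbit t k).q : ℝ) := Real.sqrt_pos.mpr hq'
  calc _ = (√c.q / √(c.orbit t k).q) * (√(2 * (c.orbit t k).q) *
        (‖(c.orbit t k).gauss‖ / (2 * (c.orbit t k).q))) := by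
        rw [Real.sqrt_mul (by norm_num), Real.sqrt_mul (by norm_num)]
        field_simp
    _ ≤ decay k * 1 := by gcongr; exact decay_nonneg k
    _ = _ := mul_one _

/-- The expansion of the vertical integrals along the nested cylinders around a point. -/
lemma exists_expansion : ∃ C : ℝ, 0 < C ∧ ∀ (c : Cylinder), ∀ t ∈ Set.Ioo (0 : ℝ) 1, Irrational t →
    ∀ ω : ℕ → ℝ, (∀ k, √(2 * c.q) *
      (‖(c.orbit t (k + 1)).gauss‖ / (2 * (c.orbit t (k + 1)).q)) ≤ ω k) → ∀ n : ℕ,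
      √(2 * c.q) * ‖thetaInt (((c.orbit t (n + 1)).q : ℝ) ^ 2)⁻¹ (c.point t) - c.center -
        c.gauss / (2 * c.q) * ((-Real.log t : ℝ) : ℂ)‖ ≤ C + logSum n ω (gaussMap t) := by
  obtain ⟨C₁, hC₁, H₁⟩ := exists_thetaInt_step
  obtain ⟨C₂, hC₂, H₂⟩ := exists_center_bound
  refine ⟨√2 * (9 * C₁ + C₂), by positivity, fun c t h ht ω hω n => ?_⟩
  have hstep : ∀ k, √(2 * c.q) * ‖thetaInt (((c.orbit t (k + 1)).q : ℝ) ^ 2)⁻¹ (c.point t) -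
      thetaInt (((c.orbit t k).q : ℝ) ^ 2)⁻¹ (c.point t) - (c.orbit t k).gauss /
        (2 * (c.orbit t k).q) * ((-Real.log (gaussMap^[k] t) : ℝ) : ℂ)‖ ≤ √2 * C₁ * decay k := by
    intro k
    have hk := (gaussMap_iterate_of_irrational h ht k).1
    have hk' := (gaussMap_iterate_of_irrational h ht (k + 1)).1
    have h1 := H₁ (c.orbit t k) (digit (gaussMap^[k] t)) (gaussMap^[k + 1] t) hk'
    rw [Function.iterate_succ_apply', gaussBranch_digit hk, c.point_orbit h ht] at h1
    have hq := c.q_pos_real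
    calc _ ≤ √(2 * c.q) * (C₁ / √(c.orbit t k).q) := by gcongr; exact h1
      _ = √2 * C₁ * (√c.q / √(c.orbit t k).q) := by
          rw [Real.sqrt_mul (by norm_num)]; ring
      _ ≤ _ := by gcongr; exact c.sqrt_div_sqrt_le_decay t k
  have hmain : √(2 * c.q) * ‖thetaInt (((c.orbit t (n + 1)).q : ℝ) ^ 2)⁻¹ (c.point t) - c.center -
        c.gauss / (2 * c.q) * ((-Real.log t : ℝ) : ℂ)‖ ≤
      √2 * C₂ + √2 * C₁ * ∑ k ∈ Finset.range (n + 1), decay k + logSum n ω (gaussMap t) := by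
    have hs0 : 0 ≤ √(2 * (c.q : ℝ)) := Real.sqrt_nonneg _
    induction n with
    | zero =>
      have h1 := hstep 0
      have h2 := H₂ c t h
      have hs : 0 < √(c.q : ℝ) := Real.sqrt_pos.mpr c.q_pos_real
      have h2' : √(2 * c.q) * ‖thetaInt ((c.q : ℝ) ^ 2)⁻¹ (c.point t) - c.center‖ ≤ √2 * C₂ := by
        calc _ ≤ √(2 * c.q) * (C₂ / √c.q) := by gcongr
          _ = _ := by rw [Real.sqrt_mul (by norm_num)]; field_simp
      have hsplit := norm_add_le (thetaInt (((c.orbit t 1).q : ℝ) ^ 2)⁻¹ (c.point t) -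
        thetaInt ((c.q : ℝ) ^ 2)⁻¹ (c.point t) - c.gauss / (2 * c.q) * ((-Real.log t : ℝ) : ℂ))
        (thetaInt ((c.q : ℝ) ^ 2)⁻¹ (c.point t) - c.center)
      rw [show (thetaInt (((c.orbit t 1).q : ℝ) ^ 2)⁻¹ (c.point t) -
        thetaInt ((c.q : ℝ) ^ 2)⁻¹ (c.point t) - c.gauss / (2 * c.q) * ((-Real.log t : ℝ) : ℂ)) +
        (thetaInt ((c.q : ℝ) ^ 2)⁻¹ (c.point t) - c.center) =
        thetaInt (((c.orbit t 1).q : ℝ) ^ 2)⁻¹ (c.point t) - c.center -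
        c.gauss / (2 * c.q) * ((-Real.log t : ℝ) : ℂ) by ring] at hsplit
      have h1' : √(2 * c.q) * ‖thetaInt (((c.orbit t 1).q : ℝ) ^ 2)⁻¹ (c.point t) -
        thetaInt ((c.q : ℝ) ^ 2)⁻¹ (c.point t) - c.gauss / (2 * c.q) * ((-Real.log t : ℝ) : ℂ)‖ ≤
          √2 * C₁ * decay 0 := h1
      have := mul_le_mul_of_nonneg_left hsplit hs0
      simp only [logSum, Finset.range_zero, Finset.sum_empty, zero_add, Finset.sum_range_one]
      linarith
    | succ n ih =>
      have h1 := hstep (n + 1)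
      set z : ℂ := (c.orbit t (n + 1)).gauss / (2 * (c.orbit t (n + 1)).q) *
        ((-Real.log (gaussMap^[n + 1] t) : ℝ) : ℂ) with hz
      have hl := neg_log_iterate_nonneg ⟨h.1.le, h.2⟩ (n + 1)
      have hzn : √(2 * c.q) * ‖z‖ ≤ ω n * -Real.log (gaussMap^[n + 1] t) := by
        rw [hz, norm_mul, norm_div, norm_mul, Complex.norm_ofNat, Complex.norm_natCast,
          Complex.norm_real, Real.norm_of_nonneg hl, ← mul_assoc]
        exact mul_le_mul_of_nonneg_right (hω n) hl
      have hL : logSum (n + 1) ω (gaussMap t) = logSum n ω (gaussMap t) +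
          ω n * -Real.log (gaussMap^[n + 1] t) := by
        rw [logSum, Finset.sum_range_succ, ← Function.iterate_succ_apply]; rfl
      rw [hL, Finset.sum_range_succ]
      generalize thetaInt (((c.orbit t (n + 1 + 1)).q : ℝ) ^ 2)⁻¹ (c.point t) = A₂ at *
      generalize thetaInt (((c.orbit t (n + 1)).q : ℝ) ^ 2)⁻¹ (c.point t) = A₁ at *
      have hsplit := norm_add₃_le (a := A₁ - c.center - c.gauss / (2 * c.q) * ((-Real.log t : ℝ) : ℂ))
        (b := A₂ - A₁ - z) (c := z)
      rw [show A₁ - c.center - c.gauss / (2 * c.q) * ((-Real.log t : ℝ) : ℂ) + (A₂ - A₁ - z) + z =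
        A₂ - c.center - c.gauss / (2 * c.q) * ((-Real.log t : ℝ) : ℂ) by ring] at hsplit
      have := mul_le_mul_of_nonneg_left hsplit hs0
      linarith
  refine hmain.trans ?_
  have h8 := sum_decay_le n
  have h9 := decay_le_one n
  have : √2 * C₁ * ∑ k ∈ Finset.range (n + 1), decay k ≤ √2 * C₁ * 9 := by
    rw [Finset.sum_range_succ]; gcongr; linarith
  linarith

lemma tendsto_orbit_height (c : Cylinder) (t : ℝ) :
    Tendsto (fun n => (((c.orbit t (n + 1)).q : ℝ) ^ 2)⁻¹) atTop (𝓝 0) := by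
  have h1 : Tendsto (fun k => (c.orbit t k).q) atTop atTop := by
    refine tendsto_atTop_mono (fun k => ?_)
      ((tendsto_pow_atTop_atTop_of_one_lt (r := 2) (by norm_num)).comp
        (Nat.tendsto_div_const_atTop (n := 2) (by norm_num)))
    exact (Nat.le_mul_of_pos_right _ c.q_pos).trans (c.two_pow_mul_q_le t k)
  have h2 : Tendsto (fun k => ((c.orbit t k).q : ℝ) ^ 2) atTop atTop :=
    (tendsto_pow_atTop two_ne_zero).comp (tendsto_natCast_atTop_atTop.comp h1)
  exact (tendsto_inv_atTop_zero.comp h2).comp (tendsto_add_atTop_nat 1)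

lemma tendsto_thetaInt_orbit (c : Cylinder) {t : ℝ}
    (hF : Tendsto (fun N => partialSum N (c.point t)) atTop (𝓝 (F (c.point t)))) :
    Tendsto (fun n => thetaInt (((c.orbit t (n + 1)).q : ℝ) ^ 2)⁻¹ (c.point t)) atTop
      (𝓝 (F (c.point t))) :=
  tendsto_thetaInt hF (fun n => by have := (c.orbit t (n + 1)).q_pos_real; positivity)
    (c.tendsto_orbit_height t)

end Cylinder

/-! ### The intervals `I` are cylinders -/

lemma irrational_gaussBranch (a : ℕ) {u : ℝ} (hu : Irrational u) : Irrational (gaussBranch a u) := by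
  have h := (hu.natCast_add (a + 1)).inv
  rw [gaussBranch]
  push_cast at h
  exact h

lemma convs_zero_of_mem {x : ℝ} (hx : x ∈ Set.Ioo (0 : ℝ) 1) : (GenContFract.of x).convs 0 = 0 := by
  rw [GenContFract.zeroth_conv_eq_h, GenContFract.of_h_eq_floor,
    Int.floor_eq_zero_iff.mpr ⟨hx.1.le, hx.2⟩, Int.cast_zero]

lemma convs_add_natCast (j a : ℕ) {u : ℝ} (hu : u ∈ Set.Ioo (0 : ℝ) 1) :
    (GenContFract.of (a + u)).convs j = a + (GenContFract.of u).convs j := by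
  have hfl : ⌊(a : ℝ) + u⌋ = a := by
    rw [Int.floor_natCast_add, Int.floor_eq_zero_iff.mpr ⟨hu.1.le, hu.2⟩, add_zero]
  cases j with
  | zero =>
    rw [convs_zero_of_mem hu, GenContFract.zeroth_conv_eq_h, GenContFract.of_h_eq_floor, hfl]; simp
  | succ j =>
    rw [GenContFract.convs_succ, GenContFract.convs_succ, hfl, Int.fract_natCast_add,
      Int.floor_eq_zero_iff.mpr ⟨hu.1.le, hu.2⟩]
    simp

lemma convs_gaussBranch (j a : ℕ) {u : ℝ} (hu : u ∈ Set.Ioo (0 : ℝ) 1) :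
    (GenContFract.of (gaussBranch a u)).convs (j + 1) =
      1 / ((a : ℝ) + 1 + (GenContFract.of u).convs j) := by
  have hx := gaussBranch_mem a hu
  rw [GenContFract.convs_succ, Int.floor_eq_zero_iff.mpr ⟨hx.1.le, hx.2⟩,
    Int.fract_eq_self.mpr ⟨hx.1.le, hx.2⟩, gaussBranch, inv_inv, Int.cast_zero, zero_add]
  have := convs_add_natCast j (a + 1) hu
  push_cast at this
  rw [this]

lemma convs_mem (j : ℕ) {x : ℝ} (hx : x ∈ Set.Ioo (0 : ℝ) 1) (hirr : Irrational x) :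
    (GenContFract.of x).convs j ∈ Set.Icc (0 : ℝ) 1 ∧ (j ≠ 0 → 0 < (GenContFract.of x).convs j) := by
  induction j generalizing x with
  | zero => rw [convs_zero_of_mem hx]; simp
  | succ j ih =>
    obtain ⟨hm, hi⟩ := gaussMap_mem_of_irrational hirr
    obtain ⟨⟨h0, _⟩, _⟩ := ih hm hi
    rw [← gaussBranch_digit hx, convs_gaussBranch _ _ hm]
    have ha : (0 : ℝ) ≤ digit x := Nat.cast_nonneg _
    refine ⟨⟨by positivity, ?_⟩, fun _ => by positivity⟩
    rw [div_le_one (by positivity)]; linarith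

/-- A j-th convergent lies in (0,1] for j ≥ 1 and is 0 for j = 0. Fixing j thus excludes having both
values 0 and 1, which is the ambiguity between the two expansions of a rational. -/
lemma abs_convs_sub_lt (j : ℕ) {x y : ℝ} (hx : x ∈ Set.Ioo (0 : ℝ) 1) (hxi : Irrational x)
    (hy : y ∈ Set.Ioo (0 : ℝ) 1) (hyi : Irrational y) :
    |(GenContFract.of x).convs j - (GenContFract.of y).convs j| < 1 := by
  obtain ⟨⟨_, h1⟩, h2⟩ := convs_mem j hx hxi
  obtain ⟨⟨_, h3⟩, h4⟩ := convs_mem j hy hyi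
  rcases eq_or_ne j 0 with rfl | hj
  · rw [convs_zero_of_mem hx, convs_zero_of_mem hy]; simp
  · have := h2 hj
    have := h4 hj
    rw [abs_lt]; constructor <;> linarith

/-- The irrational points whose `j`-th convergent is a given fraction form a cylinder. -/
lemma exists_cylinder (j : ℕ) : ∀ (p q : ℕ), 0 < q → Nat.Coprime p q →
    ∀ x₀ ∈ Set.Ioo (0 : ℝ) 1, Irrational x₀ → (GenContFract.of x₀).convs j = (p : ℝ) / q →
    ∃ c : Cylinder, c.p = p ∧ c.q = q ∧ c.s + c.r ≤ c.q + c.p ∧ ∀ x : ℝ,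
      ((x ∈ Set.Ioo (0 : ℝ) 1 ∧ Irrational x) ∧ (GenContFract.of x).convs j = (p : ℝ) / q) ↔
        ∃ t, (t ∈ Set.Ioo (0 : ℝ) 1 ∧ Irrational t) ∧ x = c.point t := by
  induction j with
  | zero =>
    intro p q hq hpq x₀ hx₀ _ h
    rw [convs_zero_of_mem hx₀, eq_comm, div_eq_zero_iff] at h
    have hp : p = 0 := by
      rcases h with h | h
      · exact_mod_cast h
      · exact absurd h (by exact_mod_cast hq.ne')
    subst hp
    have hq1 : q = 1 := by simpa using hpq
    subst hq1
    -- The whole unit interval: convergent 0/1, preceded by the formal convergent 1/0.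
    refine ⟨⟨0, 1, 1, 0, one_pos, zero_le_one, by simp⟩, rfl, rfl, by simp, fun x => ?_⟩
    have hpt : ∀ t, Cylinder.point ⟨0, 1, 1, 0, one_pos, zero_le_one, by simp⟩ t = t := by
      intro t; simp [Cylinder.point]
    constructor
    · rintro ⟨hx, -⟩
      exact ⟨x, hx, (hpt x).symm⟩
    · rintro ⟨t, ht, rfl⟩
      rw [hpt]
      exact ⟨ht, by rw [convs_zero_of_mem ht.1]; simp⟩
  | succ j ih =>
    intro p q hq hpq x₀ hx₀ hirr₀ h
    obtain ⟨hm₀, hi₀⟩ := gaussMap_mem_of_irrational hirr₀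
    set a := digit x₀ with ha
    set u₀ := gaussMap x₀ with hu₀
    have hqr : (0 : ℝ) < q := Nat.cast_pos.mpr hq
    have har : (0 : ℝ) ≤ a := Nat.cast_nonneg _
    have hc := convs_gaussBranch j a hm₀
    rw [gaussBranch_digit hx₀] at hc
    obtain ⟨⟨hv0, hv1⟩, _⟩ := convs_mem j hm₀ hi₀
    set v := (GenContFract.of u₀).convs j with hv
    have hp : 0 < p := by
      rcases Nat.eq_zero_or_pos p with h0 | h0
      · rw [h0, hc] at h
        have : (0 : ℝ) < 1 / (a + 1 + v) := by positivity
        rw [h] at this; simp at this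
      · exact h0
    have hpr : (0 : ℝ) < p := Nat.cast_pos.mpr hp
    have hsum : (a : ℝ) + 1 + v = q / p := by
      rw [hc] at h
      have := congrArg (·⁻¹) h
      simpa using this
    have hle : (a + 1) * p ≤ q := by
      have : ((a : ℝ) + 1) * p ≤ q := by
        rw [← le_div_iff₀ hpr, ← hsum]; linarith
      exact_mod_cast this
    obtain ⟨p', hp'⟩ := Nat.exists_eq_add_of_le hle
    have hcop : Nat.Coprime p' p := by
      rw [hp'] at hpq
      have := (Nat.coprime_mul_right_add_right p p' (a + 1)).mp hpq
      exact this.symm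
    have hvp : v = (p' : ℝ) / p := by
      rw [eq_div_iff hpr.ne']
      have : (a + 1 + v) * p = q := by rw [hsum, div_mul_cancel₀ _ hpr.ne']
      have hq' : (q : ℝ) = (a + 1) * p + p' := by rw [hp']; push_cast; ring
      linarith
    obtain ⟨c, hcp, hcq, hcs, hciff⟩ := ih p' p hp hcop u₀ hm₀ hi₀ hvp
    have hdet := c.det
    have hsle := c.s_le
    -- The new digit is prepended, by composing the cylinder map with 1/(a + 1 + ·) on the outside.
    -- The inequality s + r ≤ q + p is carried along because s ≤ q alone is not preserved by this
    -- operation.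
    refine ⟨⟨c.q, (a + 1) * c.q + c.p, c.s, (a + 1) * c.s + c.r, ?_, ?_, ?_⟩, hcq, ?_, ?_, fun x => ?_⟩
    · have := c.q_pos; positivity
    · have := Nat.mul_le_mul_left a hsle
      rw [add_mul, add_mul, one_mul, one_mul]; omega
    · rcases hdet with h1 | h1
      · right; push_cast; linarith
      · left; push_cast; linarith
    · change (a + 1) * c.q + c.p = q
      rw [hcq, hcp, hp']
    · change (a + 1) * c.s + c.r + c.s ≤ (a + 1) * c.q + c.p + c.q
      have := Nat.mul_le_mul_left a hsle
      rw [add_mul, add_mul, one_mul, one_mul]; omega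
    · have hpt : ∀ t ∈ Set.Ioo (0 : ℝ) 1, Cylinder.point ⟨c.q, (a + 1) * c.q + c.p, c.s,
          (a + 1) * c.s + c.r, by have := c.q_pos; positivity,
          by have := Nat.mul_le_mul_left a hsle
             rw [add_mul, add_mul, one_mul, one_mul]; omega,
          by rcases hdet with h1 | h1
             · right; push_cast; linarith
             · left; push_cast; linarith⟩ t = gaussBranch a (c.point t) := by
        intro t ht
        have ht0 := ht.1
        have h1 : (0 : ℝ) < c.q + c.s * t := by have := c.q_pos_real; positivity
        rw [gaussBranch, Cylinder.point, Cylinder.point]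
        push_cast
        rw [eq_comm, inv_eq_iff_eq_inv, inv_div, eq_div_iff (by positivity), add_mul, add_mul]
        have h2 : (c.p + c.r * t) / (c.q + c.s * t) * (c.q + c.s * t) = c.p + c.r * t :=
          div_mul_cancel₀ _ h1.ne'
        linarith
      constructor
      · rintro ⟨⟨hx, hxi⟩, hxc⟩
        obtain ⟨hm, hi⟩ := gaussMap_mem_of_irrational hxi
        have hcx := convs_gaussBranch j (digit x) hm
        rw [gaussBranch_digit hx, hxc] at hcx
        have hsx : (digit x : ℝ) + 1 + (GenContFract.of (gaussMap x)).convs j = q / p := by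
          have := congrArg (·⁻¹) hcx
          simpa using this.symm
        have hlt := abs_convs_sub_lt j hm hi hm₀ hi₀
        -- Both digit-plus-convergent sums equal q/p, and the convergents differ by less than 1, so
        -- the integer parts agree.
        have hda : digit x = a := by
          rw [← hv] at hlt
          have : (GenContFract.of (gaussMap x)).convs j - v = (a : ℝ) - digit x := by linarith
          rw [this] at hlt
          have h3 : |(a : ℤ) - digit x| < 1 := by exact_mod_cast hlt
          rw [Int.abs_lt_one_iff] at h3
          omega
        have hcu : (GenContFract.of (gaussMap x)).convs j = (p' : ℝ) / p := by
          rw [hda] at hsx; rw [← hvp]; linarith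
        obtain ⟨t, ht, hut⟩ := (hciff (gaussMap x)).mp ⟨⟨hm, hi⟩, hcu⟩
        refine ⟨t, ht, ?_⟩
        rw [hpt t ht.1, ← hut, ← hda, gaussBranch_digit hx]
      · rintro ⟨t, ht, rfl⟩
        rw [hpt t ht.1]
        obtain ⟨⟨hm, hi⟩, hcu⟩ := (hciff (c.point t)).mpr ⟨t, ht, rfl⟩
        refine ⟨⟨gaussBranch_mem a hm, irrational_gaussBranch a hi⟩, ?_⟩
        rw [convs_gaussBranch j a hm, hcu, ← hvp, hsum, one_div_div]

/-! ### Measure distortion on cylinders. -/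

namespace Cylinder

/-- The open interval underlying a cylinder. -/
noncomputable def interval (c : Cylinder) : Set ℝ := c.point '' Set.Ioo (0 : ℝ) 1

lemma hasDerivAt_point (c : Cylinder) {t : ℝ} (ht : 0 < t) :
    HasDerivAt c.point (((c.r * c.q : ℝ) - c.p * c.s) / (c.q + c.s * t) ^ 2) t := by
  have hd : (0 : ℝ) < c.q + c.s * t := by have := c.q_pos_real; positivity
  have h1 : HasDerivAt (fun t : ℝ => (c.p : ℝ) + c.r * t) (c.r : ℝ) t := by
    simpa using ((hasDerivAt_id t).const_mul (c.r : ℝ)).const_add (c.p : ℝ)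
  have h2 : HasDerivAt (fun t : ℝ => (c.q : ℝ) + c.s * t) (c.s : ℝ) t := by
    simpa using ((hasDerivAt_id t).const_mul (c.s : ℝ)).const_add (c.q : ℝ)
  refine (h1.div h2 hd.ne').congr_deriv ?_
  congr 1; ring

lemma injOn_point (c : Cylinder) : Set.InjOn c.point (Set.Ioo (0 : ℝ) 1) := by
  intro t ht u hu h
  have hq := c.q_pos_real
  have h1 : (0 : ℝ) < c.q + c.s * t := by have := ht.1; positivity
  have h2 : (0 : ℝ) < c.q + c.s * u := by have := hu.1; positivity
  rw [point, point, div_eq_div_iff h1.ne' h2.ne'] at h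
  have h3 : ((c.r * c.q : ℝ) - c.p * c.s) * (t - u) = 0 := by linarith
  have h4 : (c.r * c.q : ℝ) - c.p * c.s ≠ 0 := by
    rw [← abs_pos, c.abs_det]; exact one_pos
  linarith [(mul_eq_zero.mp h3).resolve_left h4]

lemma lintegral_image_point (c : Cylinder) {E : Set ℝ} (hE : MeasurableSet E)
    (hsub : E ⊆ Set.Ioo (0 : ℝ) 1) (g : ℝ → ENNReal) :
    ∫⁻ x in c.point '' E, g x =
      ∫⁻ t in E, ENNReal.ofReal (1 / (c.q + c.s * t) ^ 2) * g (c.point t) := by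
  rw [lintegral_image_eq_lintegral_abs_deriv_mul hE
    (fun t ht => (c.hasDerivAt_point (hsub ht).1).hasDerivWithinAt) (c.injOn_point.mono hsub)]
  simp_rw [abs_div, c.abs_det, abs_sq]

lemma measurable_point (c : Cylinder) : Measurable c.point := by
  unfold point; fun_prop

lemma volume_image_le (c : Cylinder) {E : Set ℝ} (hE : MeasurableSet E)
    (hsub : E ⊆ Set.Ioo (0 : ℝ) 1) :
    volume (c.point '' E) ≤ ENNReal.ofReal (1 / (c.q : ℝ) ^ 2) * volume E := by
  have h := c.lintegral_image_point hE hsub 1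
  simp only [Pi.one_apply, lintegral_one, Measure.restrict_apply MeasurableSet.univ, Set.univ_inter,
    mul_one] at h
  rw [h, ← setLIntegral_const]
  refine setLIntegral_mono' hE fun t ht => ENNReal.ofReal_le_ofReal ?_
  have hq := c.q_pos_real
  have := (hsub ht).1
  gcongr
  have : 0 ≤ (c.s : ℝ) * t := by positivity
  linarith

lemma le_volume_image (c : Cylinder) {E : Set ℝ} (hE : MeasurableSet E)
    (hsub : E ⊆ Set.Ioo (0 : ℝ) 1) :
    ENNReal.ofReal (1 / (4 * (c.q : ℝ) ^ 2)) * volume E ≤ volume (c.point '' E) := by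
  have h := c.lintegral_image_point hE hsub 1
  simp only [Pi.one_apply, lintegral_one, Measure.restrict_apply MeasurableSet.univ, Set.univ_inter,
    mul_one] at h
  rw [h, ← setLIntegral_const]
  refine setLIntegral_mono' hE fun t ht => ENNReal.ofReal_le_ofReal ?_
  have hq := c.q_pos_real
  have ht0 := (hsub ht).1
  have ht1 := (hsub ht).2
  have hs : (c.s : ℝ) ≤ c.q := by exact_mod_cast c.s_le
  have hs0 : (0 : ℝ) ≤ c.s := Nat.cast_nonneg _
  refine one_div_le_one_div_of_le (by positivity) ?_
  rw [show 4 * (c.q : ℝ) ^ 2 = (2 * c.q) ^ 2 by ring]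
  gcongr
  nlinarith

/-- The Jacobian is at least 1/(4q²), so preimages of null sets are null. The exceptional set is
first enlarged to a measurable one, as the image bounds require. -/
lemma ae_point (c : Cylinder) {P : ℝ → Prop} (hP : ∀ᵐ x : ℝ, P x) :
    ∀ᵐ t : ℝ, t ∈ Set.Ioo (0 : ℝ) 1 → P (c.point t) := by
  set N : Set ℝ := toMeasurable volume {x | ¬ P x} with hN
  have hN0 : volume N = 0 := by rw [hN, measure_toMeasurable]; exact hP
  set E : Set ℝ := c.point ⁻¹' N ∩ Set.Ioo (0 : ℝ) 1 with hE
  have hEm : MeasurableSet E :=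
    (c.measurable_point (measurableSet_toMeasurable _ _)).inter measurableSet_Ioo
  have hE0 : volume E = 0 := by
    have h1 := c.le_volume_image hEm Set.inter_subset_right
    have h2 : volume (c.point '' E) = 0 :=
      measure_mono_null (by rintro _ ⟨t, ht, rfl⟩; exact ht.1) hN0
    rw [h2, nonpos_iff_eq_zero, mul_eq_zero] at h1
    refine h1.resolve_left ?_
    have hq := c.q_pos_real
    rw [ENNReal.ofReal_eq_zero, not_le]; positivity
  filter_upwards [measure_eq_zero_iff_ae_notMem.mp hE0] with t ht htm
  by_contra hcon
  exact ht ⟨subset_toMeasurable volume {x | ¬ P x} hcon, htm⟩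

lemma irrational_of_irrational_point (c : Cylinder) {t : ℝ} (ht : t ∈ Set.Ioo (0 : ℝ) 1)
    (h : Irrational (c.point t)) : Irrational t := by
  intro hr
  obtain ⟨r, rfl⟩ := hr
  apply h
  refine ⟨(c.p + c.r * r) / (c.q + c.s * r), ?_⟩
  rw [point]; push_cast; rfl

end Cylinder

/-- Up to null sets, `I p q j` is a cylinder unless it is negligible. -/
lemma exists_cylinder_I {p q : ℕ} (hq : 0 < q) (hpq : Nat.Coprime p q) (j : ℕ)
    (hI : volume (I p q j) ≠ 0) :
    ∃ c : Cylinder, c.p = p ∧ c.q = q ∧ I p q j =ᵐ[volume] c.interval := by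
  have hmem : ∀ x : ℝ, Irrational x → (x ∈ I p q j ↔
      ((x ∈ Set.Ioo (0 : ℝ) 1 ∧ Irrational x) ∧ (GenContFract.of x).convs j = (p : ℝ) / q)) := by
    intro x hx
    refine ⟨fun h => ⟨⟨⟨lt_of_le_of_ne h.1.1 (Ne.symm hx.ne_zero), h.1.2⟩, hx⟩, h.2⟩,
      fun h => ⟨⟨h.1.1.1.le, h.1.1.2⟩, h.2⟩⟩
  obtain ⟨x₀, hx₀, hirr⟩ : ∃ x ∈ I p q j, Irrational x := by
    by_contra hcon
    push Not at hcon
    apply hI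
    refine measure_mono_null (fun x hx => ?_) ae_irrational
    exact hcon x hx
  obtain ⟨⟨hx₁, _⟩, hx₂⟩ := (hmem x₀ hirr).mp hx₀
  obtain ⟨c, hcp, hcq, _, hiff⟩ := exists_cylinder j p q hq hpq x₀ hx₁ hirr hx₂
  refine ⟨c, hcp, hcq, ?_⟩
  filter_upwards [ae_irrational] with x hx
  refine propext ?_
  change x ∈ I p q j ↔ x ∈ c.interval
  rw [hmem x hx, hiff x]
  constructor
  · rintro ⟨t, ht, rfl⟩
    exact ⟨t, ht.1, rfl⟩
  · rintro ⟨t, ht, rfl⟩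
    exact ⟨t, ⟨ht, c.irrational_of_irrational_point ht hx⟩, rfl⟩

lemma sum_decay_succ_le (n : ℕ) : ∑ k ∈ Finset.range n, decay (k + 1) ≤ 8 := by
  have h := sum_decay_le (n + 1)
  rw [Finset.sum_range_succ'] at h
  linarith [decay_nonneg 0]

namespace Cylinder

/-! ### Pointwise estimates of `F` on a cylinder -/

/-- The limit of `exists_expansion` as the height tends to 0. The null set does not depend on the
weights ω, which may therefore be chosen later and depend on t. -/
lemma exists_ae_expansion : ∃ C : ℝ, 0 < C ∧ ∀ c : Cylinder, ∀ᵐ t : ℝ, t ∈ Set.Ioo (0 : ℝ) 1 →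
    ∀ ω : ℕ → ℝ, (∀ k, √(2 * c.q) *
      (‖(c.orbit t (k + 1)).gauss‖ / (2 * (c.orbit t (k + 1)).q)) ≤ ω k) →
    ∀ M : ℝ, (∀ n, logSum n ω (gaussMap t) ≤ M) →
      √(2 * c.q) * ‖F (c.point t) - c.center - c.gauss / (2 * c.q) * ((-Real.log t : ℝ) : ℂ)‖ ≤
        C + M := by
  obtain ⟨C, hC, H⟩ := exists_expansion
  refine ⟨C, hC, fun c => ?_⟩
  filter_upwards [ae_irrational, c.ae_point ae_tendsto_F] with t hirr hF ht ω hω M hM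
  have hlim := ((((c.tendsto_thetaInt_orbit (hF ht)).sub_const c.center).sub_const
    (c.gauss / (2 * c.q) * ((-Real.log t : ℝ) : ℂ))).norm).const_mul √(2 * (c.q : ℝ))
  refine le_of_tendsto hlim (Eventually.of_forall fun n => ?_)
  exact (H c t ht hirr ω hω n).trans (by linarith [hM n])

lemma norm_gauss_mul_log_le (c : Cylinder) {t : ℝ} (ht : t ∈ Set.Ioo (0 : ℝ) 1) :
    √(2 * c.q) * ‖c.gauss / (2 * c.q) * ((-Real.log t : ℝ) : ℂ)‖ ≤ -Real.log t := by
  have hl : 0 ≤ -Real.log t := neg_nonneg.mpr (Real.log_nonpos ht.1.le ht.2.le)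
  rw [norm_mul, norm_div, norm_mul, Complex.norm_ofNat, Complex.norm_natCast, Complex.norm_real,
    Real.norm_of_nonneg hl, ← mul_assoc]
  exact mul_le_of_le_one_left hl c.norm_gauss_le

lemma exists_ae_lt_logSum : ∃ C : ℝ, 0 < C ∧ ∀ c : Cylinder, ∀ᵐ t : ℝ, t ∈ Set.Ioo (0 : ℝ) 1 →
    ∀ ω : ℕ → ℝ, (∀ k, √(2 * c.q) *
      (‖(c.orbit t (k + 1)).gauss‖ / (2 * (c.orbit t (k + 1)).q)) ≤ ω k) →
    ∀ D : ℝ, D < √(2 * c.q) * ‖F (c.point t) - c.center‖ →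
      ∃ n, D < C + (-Real.log t + logSum n ω (gaussMap t)) := by
  obtain ⟨C, hC, H⟩ := exists_ae_expansion
  refine ⟨C, hC, fun c => ?_⟩
  filter_upwards [H c] with t h ht ω hω D hD
  by_contra! hcon
  have h1 := h ht ω hω (D - C - -Real.log t) (fun n => by linarith [hcon n])
  have h2 := c.norm_gauss_mul_log_le ht
  have h3 := norm_le_norm_sub_add (F (c.point t) - c.center)
    (c.gauss / (2 * c.q) * ((-Real.log t : ℝ) : ℂ))
  have h4 := mul_le_mul_of_nonneg_left h3 (Real.sqrt_nonneg (2 * (c.q : ℝ)))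
  linarith

/-! ### The average over a cylinder -/

/-- In the parameter t the integrand is at most q^{-2}(2q)^{-1/2} times a fixed integrable supremum
of Birkhoff sums. -/
lemma exists_lintegral_sub_center_le : ∃ C : ℝ, 0 < C ∧ ∀ c : Cylinder,
    ∫⁻ x in c.interval, ‖F x - c.center‖ₑ ≤ ENNReal.ofReal (C / (c.q ^ 2 * √(2 * c.q))) := by
  obtain ⟨C, hC, H⟩ := exists_ae_lt_logSum
  obtain ⟨C', hC', H'⟩ := lintegral_iSup_one_add_logSum_le 8
  have H₂ := H' decay decay_nonneg decay_le_one sum_decay_le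
  refine ⟨(C + 1) * C', by positivity, fun c => ?_⟩
  have hq := c.q_pos_real
  have hs : 0 < √(2 * (c.q : ℝ)) := Real.sqrt_pos.mpr (by positivity)
  rw [interval, c.lintegral_image_point measurableSet_Ioo subset_rfl]
  have hpt : ∀ᵐ t : ℝ, t ∈ Set.Ioo (0 : ℝ) 1 →
      ENNReal.ofReal (1 / (c.q + c.s * t) ^ 2) * ‖F (c.point t) - c.center‖ₑ ≤
        ENNReal.ofReal ((C + 1) / (c.q ^ 2 * √(2 * c.q))) *
          ⨆ n, ENNReal.ofReal (1 + logSum n decay t) := by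
    filter_upwards [H c] with t h ht
    have ht0 := ht.1
    have hsup : ENNReal.ofReal (√(2 * c.q) * ‖F (c.point t) - c.center‖) ≤
        ENNReal.ofReal (C + 1) * ⨆ n, ENNReal.ofReal (1 + logSum n decay t) := by
      refine le_of_forall_lt_imp_le_of_dense fun b hb => ?_
      have hbt : b ≠ ⊤ := (hb.trans ENNReal.ofReal_lt_top).ne
      obtain ⟨n, hn⟩ := h ht (fun k => decay (k + 1)) (fun k => c.weight_le_decay t (k + 1)) b.toReal
        ((ENNReal.lt_ofReal_iff_toReal_lt hbt).mp hb)
      -- As `decay 0` = 1, the leading -log t is the first term of the Birkhoff sum.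
      have e : logSum (n + 1) decay t =
          -Real.log t + logSum n (fun k => decay (k + 1)) (gaussMap t) := by
        rw [logSum_succ]; simp [decay]
      rw [← e] at hn
      have h0 := logSum_nonneg decay_nonneg (n + 1) (t := t) ⟨ht.1.le, ht.2⟩
      calc b = ENNReal.ofReal b.toReal := (ENNReal.ofReal_toReal hbt).symm
        _ ≤ ENNReal.ofReal ((C + 1) * (1 + logSum (n + 1) decay t)) :=
          ENNReal.ofReal_le_ofReal (by nlinarith)
        _ = ENNReal.ofReal (C + 1) * ENNReal.ofReal (1 + logSum (n + 1) decay t) :=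
          ENNReal.ofReal_mul (by positivity)
        _ ≤ _ := by
          gcongr
          exact le_iSup (fun n => ENNReal.ofReal (1 + logSum n decay t)) (n + 1)
    calc _ ≤ ENNReal.ofReal (1 / (c.q ^ 2 * √(2 * c.q))) *
          ENNReal.ofReal (√(2 * c.q) * ‖F (c.point t) - c.center‖) := by
          rw [← ofReal_norm, ← ENNReal.ofReal_mul (by positivity),
            ← ENNReal.ofReal_mul (by positivity)]
          refine ENNReal.ofReal_le_ofReal ?_
          rw [show 1 / ((c.q : ℝ) ^ 2 * √(2 * c.q)) * (√(2 * c.q) * ‖F (c.point t) - c.center‖) =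
            1 / (c.q : ℝ) ^ 2 * ‖F (c.point t) - c.center‖ by field_simp]
          gcongr
          have : 0 ≤ (c.s : ℝ) * t := by positivity
          linarith
      _ ≤ ENNReal.ofReal (1 / (c.q ^ 2 * √(2 * c.q))) *
          (ENNReal.ofReal (C + 1) * ⨆ n, ENNReal.ofReal (1 + logSum n decay t)) := by gcongr
      _ = _ := by
          rw [← mul_assoc, ← ENNReal.ofReal_mul (by positivity)]
          congr 2; ring
  calc _ ≤ ∫⁻ t in Set.Ioo (0 : ℝ) 1, ENNReal.ofReal ((C + 1) / (c.q ^ 2 * √(2 * c.q))) *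
          ⨆ n, ENNReal.ofReal (1 + logSum n decay t) := by
        refine lintegral_mono_ae ?_
        exact (ae_restrict_iff' measurableSet_Ioo).mpr hpt
    _ = ENNReal.ofReal ((C + 1) / (c.q ^ 2 * √(2 * c.q))) * ∫⁻ t in Set.Ioo (0 : ℝ) 1,
          ⨆ n, ENNReal.ofReal (1 + logSum n decay t) :=
        lintegral_const_mul' _ _ ENNReal.ofReal_ne_top
    _ ≤ ENNReal.ofReal ((C + 1) / (c.q ^ 2 * √(2 * c.q))) * ENNReal.ofReal C' := by gcongr
    _ = _ := by
        rw [← ENNReal.ofReal_mul (by positivity)]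
        congr 1; ring

lemma volume_interval_le (c : Cylinder) : volume c.interval ≤ ENNReal.ofReal (1 / (c.q : ℝ) ^ 2) := by
  simpa [interval] using c.volume_image_le measurableSet_Ioo subset_rfl

lemma le_volume_interval (c : Cylinder) :
    ENNReal.ofReal (1 / (4 * (c.q : ℝ) ^ 2)) ≤ volume c.interval := by
  simpa only [interval, Real.volume_Ioo, sub_zero, ENNReal.ofReal_one, mul_one] using
    c.le_volume_image measurableSet_Ioo subset_rfl

lemma volume_real_interval_le (c : Cylinder) : volume.real c.interval ≤ 1 / (c.q : ℝ) ^ 2 :=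
  ENNReal.toReal_le_of_le_ofReal (by have := c.q_pos_real; positivity) c.volume_interval_le

lemma le_volume_real_interval (c : Cylinder) : 1 / (4 * (c.q : ℝ) ^ 2) ≤ volume.real c.interval :=
  (ENNReal.ofReal_le_iff_le_toReal (c.volume_interval_le.trans_lt ENNReal.ofReal_lt_top).ne).mp
    c.le_volume_interval

lemma exists_average_sub_center_le : ∃ B : ℝ, 0 < B ∧ ∀ c : Cylinder, IntegrableOn F c.interval →
    √(2 * c.q) * ‖(⨍ x in c.interval, F x) - c.center‖ ≤ B := by
  obtain ⟨C, hC, H⟩ := exists_lintegral_sub_center_le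
  refine ⟨4 * C, by positivity, fun c hint => ?_⟩
  have hq := c.q_pos_real
  have hs : 0 < √(2 * (c.q : ℝ)) := Real.sqrt_pos.mpr (by positivity)
  have hv := c.le_volume_real_interval
  have hv0 : 0 < volume.real c.interval := lt_of_lt_of_le (by positivity) hv
  have hfin : volume c.interval ≠ ⊤ := (c.volume_interval_le.trans_lt ENNReal.ofReal_lt_top).ne
  have e : (⨍ x in c.interval, F x) - c.center =
      (volume.real c.interval)⁻¹ • ∫ x in c.interval, (F x - c.center) := by
    rw [setAverage_eq, integral_sub hint (integrableOn_const hfin), setIntegral_const, smul_sub,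
      inv_smul_smul₀ hv0.ne']
  have hI : ‖∫ x in c.interval, (F x - c.center)‖ ≤ C / (c.q ^ 2 * √(2 * c.q)) := by
    refine (norm_integral_le_lintegral_norm _).trans ?_
    simp_rw [ofReal_norm]
    exact ENNReal.toReal_le_of_le_ofReal (by positivity) (H c)
  rw [e, norm_smul, norm_inv, Real.norm_of_nonneg hv0.le]
  calc _ ≤ √(2 * c.q) * ((1 / (4 * (c.q : ℝ) ^ 2))⁻¹ * (C / (c.q ^ 2 * √(2 * c.q)))) := by gcongr
    _ = _ := by field_simp

/-! ### Level sets on a cylinder -/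

lemma ae_of_ae_point (c : Cylinder) {P : ℝ → Prop} (h : ∀ᵐ t : ℝ, t ∈ Set.Ioo (0 : ℝ) 1 → P t) :
    ∀ᵐ x : ℝ, ∀ t ∈ Set.Ioo (0 : ℝ) 1, x = c.point t → P t := by
  set N : Set ℝ := toMeasurable volume {t | ¬ (t ∈ Set.Ioo (0 : ℝ) 1 → P t)} with hN
  have hN0 : volume (N ∩ Set.Ioo (0 : ℝ) 1) = 0 :=
    measure_mono_null Set.inter_subset_left (by rw [hN, measure_toMeasurable]; exact h)
  have h1 := c.volume_image_le ((measurableSet_toMeasurable volume _).inter measurableSet_Ioo)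
    (Set.inter_subset_right : N ∩ Set.Ioo (0 : ℝ) 1 ⊆ _)
  rw [hN0, mul_zero, nonpos_iff_eq_zero] at h1
  filter_upwards [measure_eq_zero_iff_ae_notMem.mp h1] with x hx t ht hxt
  by_contra hcon
  exact hx ⟨t, ⟨subset_toMeasurable _ _ (fun hh => hcon (hh ht)), ht⟩, hxt.symm⟩

lemma exists_le_volume_of_gauss (B α : ℝ) (hα : 0 < α) : ∃ δ : ℝ, 0 < δ ∧
    ∀ (c : Cylinder) (κ : ℂ) (lam : ℝ), 0 < lam → √(2 * c.q) * ‖κ - c.center‖ ≤ B →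
      α ≤ √(2 * c.q) * (‖c.gauss‖ / (2 * c.q)) →
      ENNReal.ofReal (δ / c.q ^ 2 * Real.exp (-(√(2 * c.q) * lam / α))) ≤
        volume {x | x ∈ c.interval ∧ lam < ‖F x - κ‖} := by
  obtain ⟨C, hC, H⟩ := exists_ae_expansion
  obtain ⟨M, hM, H'⟩ := le_volume_logSum_le 8
  set ω : ℕ → ℝ := fun k => decay (k + 1) with hω
  refine ⟨Real.exp (-((B + C + M) / α)) / 48, by positivity, fun c κ lam hlam hκ hg => ?_⟩
  have hq := c.q_pos_real
  have hs : 0 < √(2 * (c.q : ℝ)) := Real.sqrt_pos.mpr (by positivity)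
  have hB : 0 ≤ B := le_trans (by positivity) hκ
  set E : ℝ := (√(2 * c.q) * lam + (B + C + M)) / α with hE
  have hE0 : 0 ≤ E := by positivity
  set A : ℕ := ⌈Real.exp E⌉₊ with hA
  have hA1 : Real.exp E ≤ A := Nat.le_ceil _
  have hA2 : (A : ℝ) ≤ 2 * Real.exp E := by
    have := Nat.ceil_lt_add_one (Real.exp_pos E).le
    have := Real.one_le_exp hE0
    linarith
  have hApos : (0 : ℝ) < A := (Real.exp_pos E).trans_le hA1
  have hvol := H' ω (fun k => decay_nonneg _) (fun k => decay_le_one _) sum_decay_succ_le A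
    (by exact_mod_cast hApos)
  set S : Set ℝ := {t | t < 1 / (A : ℝ) ∧ ∀ n, logSum n ω (gaussMap t) ≤ M} ∩ Set.Ioo (0 : ℝ) 1
    with hS
  have hSm : MeasurableSet S := by
    refine MeasurableSet.inter (measurableSet_Iio.inter ?_) measurableSet_Ioo
    change MeasurableSet {t | ∀ n, logSum n ω (gaussMap t) ≤ M}
    rw [Set.ofPred_forall]
    exact MeasurableSet.iInter fun n =>
      measurableSet_le ((measurable_logSum n ω).comp measurable_gaussMap) measurable_const
  have hsub : volume (c.point '' S) ≤ volume {x | x ∈ c.interval ∧ lam < ‖F x - κ‖} := by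
    refine measure_mono_ae ?_
    filter_upwards [c.ae_of_ae_point (H c)] with x hx
    rintro ⟨t, ⟨⟨htA, htM⟩, ht⟩, rfl⟩
    refine ⟨⟨t, ht, rfl⟩, ?_⟩
    have h1 := hx t ht rfl ω (fun k => c.weight_le_decay t (k + 1)) M htM
    have hlog : E < -Real.log t := by
      rw [← Real.log_inv, Real.lt_log_iff_exp_lt (inv_pos.mpr ht.1)]
      refine hA1.trans_lt ?_
      rwa [lt_inv_comm₀ hApos ht.1, ← one_div]
    have h2 : √(2 * c.q) * lam + (B + C + M) <
        √(2 * c.q) * ‖c.gauss / (2 * c.q) * ((-Real.log t : ℝ) : ℂ)‖ := by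
      have hl : 0 ≤ -Real.log t := hE0.trans hlog.le
      rw [norm_mul, norm_div, norm_mul, Complex.norm_ofNat, Complex.norm_natCast, Complex.norm_real,
        Real.norm_of_nonneg hl, ← mul_assoc]
      rw [hE, div_lt_iff₀ hα, mul_comm (-Real.log t)] at hlog
      exact hlog.trans_le (mul_le_mul_of_nonneg_right hg hl)
    have h3 := norm_add₃_le (a := F (c.point t) - κ) (b := κ - c.center)
      (c := -(F (c.point t) - c.center - c.gauss / (2 * c.q) * ((-Real.log t : ℝ) : ℂ)))
    rw [norm_neg, show F (c.point t) - κ + (κ - c.center) +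
      -(F (c.point t) - c.center - c.gauss / (2 * c.q) * ((-Real.log t : ℝ) : ℂ)) =
      c.gauss / (2 * c.q) * ((-Real.log t : ℝ) : ℂ) by ring] at h3
    have h4 := mul_le_mul_of_nonneg_left h3 hs.le
    have h5 : √(2 * c.q) * lam < √(2 * c.q) * ‖F (c.point t) - κ‖ := by linarith
    exact lt_of_mul_lt_mul_left h5 hs.le
  refine le_trans ?_ hsub
  refine le_trans ?_ (c.le_volume_image hSm Set.inter_subset_right)
  refine le_trans ?_ (mul_le_mul_right hvol _)
  rw [← ENNReal.ofReal_mul (by positivity)]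
  refine ENNReal.ofReal_le_ofReal ?_
  calc _ = 1 / (4 * (c.q : ℝ) ^ 2) * (1 / (6 * (2 * Real.exp E))) := by
        rw [hE, show (√(2 * (c.q : ℝ)) * lam + (B + C + M)) / α =
          (√(2 * c.q) * lam / α) + ((B + C + M) / α) by ring, Real.exp_add, Real.exp_neg, Real.exp_neg]
        field_simp
        norm_num
    _ ≤ _ := by gcongr

/-- Both centers are compared with vertical integrals at the common point of parameter `gaussBranch
0 (1/2)` = 2/3, where the leading term is O(q^{-1/2}). -/
lemma exists_center_child : ∃ C : ℝ, 0 < C ∧ ∀ c : Cylinder,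
    ‖(c.child 0).center - c.center‖ ≤ C / √c.q := by
  obtain ⟨C₁, hC₁, H₁⟩ := exists_thetaInt_step
  obtain ⟨C₂, hC₂, H₂⟩ := exists_center_bound
  refine ⟨C₂ + C₁ + 1 + C₂, by positivity, fun c => ?_⟩
  have hq := c.q_pos_real
  have hs : 0 < √(c.q : ℝ) := Real.sqrt_pos.mpr hq
  have hu : (1 / 2 : ℝ) ∈ Set.Ioo (0 : ℝ) 1 := by constructor <;> norm_num
  have hqq : (c.q : ℝ) ≤ (c.child 0).q := by exact_mod_cast (c.child 0).s_le
  have h1 := H₁ c 0 (1 / 2) hu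
  have h2 := H₂ c _ (gaussBranch_mem 0 hu)
  have h3 := H₂ (c.child 0) _ hu
  rw [← c.point_branch 0 hu.1] at h3
  have h3' : C₂ / √((c.child 0).q : ℝ) ≤ C₂ / √c.q := by gcongr
  have hl : -Real.log (gaussBranch 0 (1 / 2)) ≤ 1 := by
    rw [gaussBranch, Real.log_inv, neg_neg]
    refine (Real.log_le_sub_one_of_pos (by norm_num)).trans (by norm_num)
  have hl0 : 0 ≤ -Real.log (gaussBranch 0 (1 / 2)) :=
    neg_nonneg.mpr (Real.log_nonpos (gaussBranch_mem 0 hu).1.le (gaussBranch_mem 0 hu).2.le)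
  have hg : ‖c.gauss / (2 * c.q)‖ ≤ (√c.q)⁻¹ := norm_gaussSum_div_le c.isUnit_p
  have h4 : ‖c.gauss / (2 * c.q) * ((-Real.log (gaussBranch 0 (1 / 2)) : ℝ) : ℂ)‖ ≤ 1 / √c.q := by
    rw [norm_mul, Complex.norm_real, Real.norm_of_nonneg hl0, one_div (√(c.q : ℝ))]
    exact (mul_le_of_le_one_right (norm_nonneg _) hl).trans hg
  generalize thetaInt (((c.child 0).q : ℝ) ^ 2)⁻¹ (c.point (gaussBranch 0 (1 / 2))) = X at *
  generalize thetaInt ((c.q : ℝ) ^ 2)⁻¹ (c.point (gaussBranch 0 (1 / 2))) = Y at *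
  generalize c.gauss / (2 * c.q) * ((-Real.log (gaussBranch 0 (1 / 2)) : ℝ) : ℂ) = Z at *
  rw [show (c.child 0).center - c.center =
    -(X - (c.child 0).center) + (X - Y - Z) + Z + (Y - c.center) by ring]
  refine (norm_add_le _ _).trans ?_
  have h5 := norm_add₃_le (a := -(X - (c.child 0).center)) (b := X - Y - Z) (c := Z)
  rw [norm_neg] at h5
  rw [add_div, add_div, add_div]
  linarith

lemma odd_s_of_even_q (c : Cylinder) (h : 2 ∣ c.q) : ¬ 2 ∣ c.s := by
  rintro ⟨b, hb⟩
  obtain ⟨a, ha⟩ := h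
  have hd := c.det
  rw [ha, hb] at hd
  push_cast at hd
  have e : (c.r * (2 * a) : ℤ) - c.p * (2 * b) = 2 * (c.r * a - c.p * b) := by ring
  rw [e] at hd
  omega

/-- By the determinant relation q and s are not both even. This parity fact lowers the second weight
when 4 ∣ q and provides an odd denominator when q ≡ 2 mod 4. -/
lemma odd_child_q (c : Cylinder) (h : 2 ∣ c.q) (a : ℕ) : ¬ 2 ∣ (c.child a).q := by
  intro h'
  refine c.odd_s_of_even_q h ?_
  exact (Nat.dvd_add_right (h.mul_left (a + 1))).mp h'

lemma norm_gauss_of_odd (c : Cylinder) (h : ¬ 2 ∣ c.q) : ‖c.gauss‖ = √c.q :=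
  norm_gaussSum_odd c.isUnit_p h

lemma norm_gauss_of_four_dvd (c : Cylinder) (h : 4 ∣ c.q) : ‖c.gauss‖ = √(2 * c.q) :=
  norm_gaussSum_four_dvd c.isUnit_p h

lemma weight_of_four_dvd (c : Cylinder) (h : 4 ∣ c.q) :
    √(2 * c.q) * (‖c.gauss‖ / (2 * c.q)) = 1 := by
  have hq := c.q_pos_real
  rw [c.norm_gauss_of_four_dvd h, mul_div_assoc', Real.mul_self_sqrt (by positivity),
    div_self (by positivity)]

lemma weight_of_odd (c : Cylinder) (h : ¬ 2 ∣ c.q) :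
    √(2 * c.q) * (‖c.gauss‖ / (2 * c.q)) = (√2)⁻¹ := by
  have hq := c.q_pos_real
  rw [c.norm_gauss_of_odd h, Real.sqrt_mul (by norm_num), mul_div_assoc', mul_assoc,
    Real.mul_self_sqrt hq.le]
  have h2 : √2 * √2 = (2 : ℝ) := Real.mul_self_sqrt (by norm_num)
  field_simp
  linarith

lemma interval_child_subset (c : Cylinder) (a : ℕ) : (c.child a).interval ⊆ c.interval := by
  rintro _ ⟨u, hu, rfl⟩
  exact ⟨gaussBranch a u, gaussBranch_mem a hu, c.point_branch a hu.1⟩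

/-- The lower bound for the level sets on cylinders. -/
lemma exists_le_volume_levelSet (B : ℝ) : ∃ δ : ℝ, 0 < δ ∧
    ∀ (C : Cylinder) (κ : ℂ) (lam : ℝ), 0 < lam → √(2 * C.q) * ‖κ - C.center‖ ≤ B →
      ENNReal.ofReal (δ / C.q ^ 2 * Real.exp (-(SquareSeries.c C.q * lam * √(C.q : ℝ)))) ≤
        volume {x | x ∈ C.interval ∧ lam < ‖F x - κ‖} := by
  obtain ⟨δ₁, hδ₁, H₁⟩ := exists_le_volume_of_gauss B 1 one_pos
  obtain ⟨δ₂, hδ₂, H₂⟩ := exists_le_volume_of_gauss B (√2)⁻¹ (by positivity)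
  obtain ⟨D, hD, HD⟩ := exists_center_child
  obtain ⟨δ₃, hδ₃, H₃⟩ := exists_le_volume_of_gauss (√2 * (B + √2 * D)) (√2)⁻¹ (by positivity)
  have h22 : √2 * √2 = (2 : ℝ) := Real.mul_self_sqrt (by norm_num)
  refine ⟨min δ₁ (min δ₂ (δ₃ / 4)), by positivity, fun C κ lam hlam hκ => ?_⟩
  have hq := C.q_pos_real
  have hs : 0 < √(C.q : ℝ) := Real.sqrt_pos.mpr hq
  by_cases h4 : 4 ∣ C.q
  · refine le_trans (ENNReal.ofReal_le_ofReal ?_) (H₁ C κ lam hlam hκ (C.weight_of_four_dvd h4).ge)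
    rw [SquareSeries.c, if_pos h4, Real.sqrt_mul (by norm_num),
      show √2 * lam * √(C.q : ℝ) = √2 * √C.q * lam / 1 by ring]
    gcongr
    exact min_le_left _ _
  -- For q ≡ 2 mod 4, work on the child with partial quotient 1. Its denominator q' = q + s is odd
  -- and at most 2q, so the odd exponent 2√q' becomes at most 2√2·√q, while q'² ≤ 4q² costs the
  -- factor 1/4.
  by_cases h2 : 2 ∣ C.q
  · have hodd := C.odd_child_q h2 0
    have hqq : (C.q : ℝ) ≤ (C.child 0).q := by exact_mod_cast (C.child 0).s_le
    have hqq2 : ((C.child 0).q : ℝ) ≤ 2 * C.q := by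
      have h5 : (C.child 0).q = (0 + 1) * C.q + C.s := rfl
      have h6 := C.s_le
      have : (C.child 0).q ≤ 2 * C.q := by omega
      exact_mod_cast this
    have hq1 := (C.child 0).q_pos_real
    have hsq : √((C.child 0).q : ℝ) ≤ √2 * √C.q := by
      rw [← Real.sqrt_mul (by norm_num)]; exact Real.sqrt_le_sqrt hqq2
    have hκ' : √(2 * (C.child 0).q) * ‖κ - (C.child 0).center‖ ≤ √2 * (B + √2 * D) := by
      have h7 : ‖κ - (C.child 0).center‖ ≤ ‖κ - C.center‖ + D / √C.q := by
        have := norm_sub_le_norm_sub_add_norm_sub κ C.center (C.child 0).center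
        rw [norm_sub_rev C.center] at this
        linarith [HD C]
      calc _ ≤ √2 * (√2 * √C.q) * (‖κ - C.center‖ + D / √C.q) := by
            rw [Real.sqrt_mul (by norm_num)]; gcongr
        _ = √2 * (√(2 * C.q) * ‖κ - C.center‖ + √2 * D) := by
            rw [Real.sqrt_mul (by norm_num)]; field_simp
        _ ≤ _ := by gcongr
    refine le_trans (ENNReal.ofReal_le_ofReal ?_) ((H₃ (C.child 0) κ lam hlam hκ'
      ((C.child 0).weight_of_odd hodd).ge).trans
        (measure_mono fun x hx => ⟨C.interval_child_subset 0 hx.1, hx.2⟩))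
    rw [SquareSeries.c, if_neg h4, if_neg (not_not.mpr h2)]
    calc _ ≤ δ₃ / 4 / C.q ^ 2 * Real.exp (-(2 * √2 * lam * √C.q)) := by
          gcongr; exact (min_le_right _ _).trans (min_le_right _ _)
      _ = δ₃ / (2 * C.q) ^ 2 * Real.exp (-(2 * √2 * lam * √C.q)) := by
          congr 1; field_simp; norm_num
      _ ≤ _ := by
          gcongr
          rw [Real.sqrt_mul (by norm_num), div_inv_eq_mul]
          calc √2 * √((C.child 0).q : ℝ) * lam * √2 = (√2 * √2) * √((C.child 0).q : ℝ) * lam := by ring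
            _ ≤ (√2 * √2) * (√2 * √C.q) * lam := by gcongr
            _ = _ := by rw [h22]; ring
  · refine le_trans (ENNReal.ofReal_le_ofReal ?_) (H₂ C κ lam hlam hκ (C.weight_of_odd h2).ge)
    rw [SquareSeries.c, if_neg h4, if_pos h2, Real.sqrt_mul (by norm_num), div_inv_eq_mul,
      show √2 * √(C.q : ℝ) * lam * √2 = (√2 * √2) * lam * √(C.q : ℝ) by ring, h22]
    gcongr
    exact (min_le_right _ _).trans (min_le_left _ _)

/-- The upper bound for the level sets on cylinders whose denominator is divisible by four. -/
lemma exists_volume_levelSet_le (B : ℝ) : ∃ C₀ : ℝ, 0 < C₀ ∧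
    ∀ (c : Cylinder) (κ : ℂ) (lam : ℝ), 4 ∣ c.q → √(2 * c.q) * ‖κ - c.center‖ ≤ B →
      volume {x | x ∈ c.interval ∧ lam < ‖F x - κ‖} ≤
        ENNReal.ofReal (C₀ / c.q ^ 2 * Real.exp (-(√(2 * c.q) * lam))) := by
  obtain ⟨C, hC, H⟩ := exists_ae_lt_logSum
  obtain ⟨C', hC', H'⟩ := volume_log_add_logSum_gt_le 8
  -- The second entry gives summability, the first the moment of order 5/4. For k = 0 the bound
  -- 18/25 does not follow from `decay 1` = 1 but from the oddness of the next denominator.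
  set ω : ℕ → ℝ := fun k => min (18 / 25) (decay (k + 1)) with hω
  have hω0 : ∀ k, 0 ≤ ω k := fun k => le_min (by norm_num) (decay_nonneg _)
  refine ⟨C' * Real.exp (C + B), by positivity, fun c κ lam h4 hκ => ?_⟩
  have hq := c.q_pos_real
  have hs : 0 < √(2 * (c.q : ℝ)) := Real.sqrt_pos.mpr (by positivity)
  have h2 : 2 ∣ c.q := Dvd.dvd.trans (by norm_num) h4
  have hw : ∀ t k, √(2 * c.q) *
      (‖(c.orbit t (k + 1)).gauss‖ / (2 * (c.orbit t (k + 1)).q)) ≤ ω k := by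
    intro t k
    refine le_min ?_ (c.weight_le_decay t (k + 1))
    cases k with
    | zero =>
      have hodd : ¬ 2 ∣ (c.orbit t 1).q := c.odd_child_q h2 _
      have hqq : (c.q : ℝ) ≤ (c.orbit t 1).q := by exact_mod_cast c.q_le_orbit_succ t 0
      calc _ ≤ √(2 * (c.orbit t 1).q) * (‖(c.orbit t 1).gauss‖ / (2 * (c.orbit t 1).q)) := by gcongr
        _ = (√2)⁻¹ := (c.orbit t 1).weight_of_odd hodd
        _ ≤ _ := inv_sqrt_two_le
    | succ k => exact (c.weight_le_decay t (k + 2)).trans (decay_le k)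
  set D : ℝ := √(2 * c.q) * lam - B - C with hD
  set S : ℕ → Set ℝ := fun n =>
    {t | D < -Real.log t + logSum n ω (gaussMap t)} ∩ Set.Ioo (0 : ℝ) 1 with hS
  have hSm : ∀ n, MeasurableSet (S n) := fun n =>
    (measurableSet_lt measurable_const (Real.measurable_log.neg.add
      ((measurable_logSum n ω).comp measurable_gaussMap))).inter measurableSet_Ioo
  have hmono : Monotone S := by
    intro m n hmn t ht
    have h1 : D < -Real.log t + logSum m ω (gaussMap t) := ht.1
    refine ⟨?_, ht.2⟩
    change D < _
    have := logSum_mono hω0 (t := gaussMap t) ⟨Int.fract_nonneg _, Int.fract_lt_one _⟩ hmn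
    simp only at this
    linarith
  have hvol : volume (⋃ n, S n) ≤ ENNReal.ofReal (C' * Real.exp (-D)) := by
    rw [hmono.measure_iUnion]
    exact iSup_le fun n => H' ω hω0 (fun k => min_le_left _ _)
      (fun n => (Finset.sum_le_sum fun k _ => min_le_right _ _).trans (sum_decay_succ_le n)) n D
  have hsub : volume {x | x ∈ c.interval ∧ lam < ‖F x - κ‖} ≤ volume (c.point '' ⋃ n, S n) := by
    refine measure_mono_ae ?_
    filter_upwards [c.ae_of_ae_point (H c)] with x hx
    rintro ⟨⟨t, ht, rfl⟩, hl⟩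
    have h3 := norm_sub_le_norm_sub_add_norm_sub (F (c.point t)) c.center κ
    rw [norm_sub_rev c.center κ] at h3
    have h5 := mul_lt_mul_of_pos_left (hl.trans_le h3) hs
    rw [mul_add] at h5
    obtain ⟨n, hn⟩ := hx t ht rfl ω (hw t) (√(2 * c.q) * lam - B) (by linarith)
    exact ⟨t, Set.mem_iUnion.mpr ⟨n, ⟨by change D < _; linarith, ht⟩⟩, rfl⟩
  refine hsub.trans ((c.volume_image_le (MeasurableSet.iUnion hSm)
    (Set.iUnion_subset fun n => Set.inter_subset_right)).trans ?_)
  refine (mul_le_mul_right hvol _).trans ?_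
  rw [← ENNReal.ofReal_mul (by positivity)]
  refine ENNReal.ofReal_le_ofReal (le_of_eq ?_)
  rw [hD, show -(√(2 * (c.q : ℝ)) * lam - B - C) = (C + B) + -(√(2 * c.q) * lam) by ring, Real.exp_add]
  ring

end Cylinder

/-! ### Transfer to the intervals `I` -/

lemma I_subset (p q j : ℕ) : I p q j ⊆ Set.Ico (0 : ℝ) 1 := fun _ hx => hx.1

lemma levelSet_subset (p q j : ℕ) (lam : ℝ) : levelSet p q j lam ⊆ I p q j := fun _ hx => hx.1

lemma levelSet_ae_eq {p q j : ℕ} {c : Cylinder} (h : I p q j =ᵐ[volume] c.interval) (lam : ℝ) :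
    levelSet p q j lam =ᵐ[volume] {x | x ∈ c.interval ∧ lam < ‖F x - avg p q j‖} := by
  filter_upwards [h] with x hx
  have hx' : (x ∈ I p q j) = (x ∈ c.interval) := hx
  change (x ∈ I p q j ∧ lam < ‖F x - avg p q j‖) = (x ∈ c.interval ∧ lam < ‖F x - avg p q j‖)
  rw [hx']

lemma exists_avg_sub_center_le : ∃ B : ℝ, 0 < B ∧ ∀ (p q j : ℕ) (c : Cylinder),
    I p q j =ᵐ[volume] c.interval → √(2 * c.q) * ‖avg p q j - c.center‖ ≤ B := by
  obtain ⟨B, hB, H⟩ := Cylinder.exists_average_sub_center_le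
  refine ⟨B, hB, fun p q j c h => ?_⟩
  rw [avg, setAverage_congr h]
  exact H c ((integrableOn_F.mono_set (I_subset p q j)).congr_set_ae h.symm)

lemma volume_levelSet_ne_top (p q j : ℕ) (lam : ℝ) : volume (levelSet p q j lam) ≠ ⊤ :=
  ((measure_mono ((levelSet_subset p q j lam).trans (I_subset p q j))).trans_lt
    (by rw [Real.volume_Ico]; exact ENNReal.ofReal_lt_top)).ne

lemma exists_le_volume_real_levelSet : ∃ C : ℝ, 0 < C ∧
    ∀ p q j : ℕ, 0 < q → Nat.Coprime p q → ∀ lam : ℝ, 0 < lam →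
      C * volume.real (I p q j) * Real.exp (-(c q * lam * √(q : ℝ))) ≤
        volume.real (levelSet p q j lam) := by
  obtain ⟨B, _, HB⟩ := exists_avg_sub_center_le
  obtain ⟨δ, hδ, H⟩ := Cylinder.exists_le_volume_levelSet B
  refine ⟨δ, hδ, fun p q j hq hpq lam hlam => ?_⟩
  -- This covers every j for which p/q has no expansion of length j; the estimate is then trivial.
  by_cases hI : volume (I p q j) = 0
  · rw [Measure.real, hI, ENNReal.toReal_zero, mul_zero, zero_mul]; exact measureReal_nonneg
  obtain ⟨C, rfl, rfl, hae⟩ := exists_cylinder_I hq hpq j hI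
  have h1 := H C _ lam hlam (HB _ _ j C hae)
  rw [← measure_congr (levelSet_ae_eq hae lam),
    ENNReal.ofReal_le_iff_le_toReal (volume_levelSet_ne_top _ _ j lam)] at h1
  refine le_trans ?_ h1
  rw [measureReal_congr hae, div_eq_mul_one_div]
  gcongr
  exact C.volume_real_interval_le

lemma exists_volume_real_levelSet_le : ∃ C₀ : ℝ, 0 < C₀ ∧
    ∀ p q j : ℕ, 0 < q → Nat.Coprime p q → 4 ∣ q → ∀ lam : ℝ,
      volume.real (levelSet p q j lam) ≤
        C₀ * (volume.real (I p q j) * Real.exp (-(lam * √(2 * (q : ℝ))))) := by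
  obtain ⟨B, _, HB⟩ := exists_avg_sub_center_le
  obtain ⟨C₀, hC₀, H⟩ := Cylinder.exists_volume_levelSet_le B
  refine ⟨4 * C₀, by positivity, fun p q j hq hpq h4 lam => ?_⟩
  by_cases hI : volume (I p q j) = 0
  · rw [Measure.real, measure_mono_null (levelSet_subset p q j lam) hI, ENNReal.toReal_zero]
    positivity
  obtain ⟨C, rfl, rfl, hae⟩ := exists_cylinder_I hq hpq j hI
  have h1 := H C _ lam h4 (HB _ _ j C hae)
  rw [← measure_congr (levelSet_ae_eq hae lam)] at h1
  have hq := C.q_pos_real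
  refine (ENNReal.toReal_le_of_le_ofReal (by positivity) h1).trans ?_
  rw [measureReal_congr hae, mul_comm lam]
  calc _ = 4 * C₀ * (1 / (4 * (C.q : ℝ) ^ 2) * Real.exp (-(√(2 * C.q) * lam))) := by ring
    _ ≤ _ := by gcongr; exact C.le_volume_real_interval

end SquareSeries

theorem theorem4 :
    (∀ᵐ x : ℝ, Tendsto (fun N : ℕ => SquareSeries.partialSum N x) atTop
      (𝓝 (SquareSeries.F x))) ∧
    IntegrableOn SquareSeries.F (Set.Ico (0 : ℝ) 1) ∧
    (∃ C : ℝ, 0 < C ∧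
      ∀ p q j : ℕ, 0 < q → Nat.Coprime p q → ∀ lam : ℝ, 0 < lam →
        C * volume.real (SquareSeries.I p q j) * Real.exp (-(SquareSeries.c q * lam * √(q : ℝ)))
          ≤ volume.real (SquareSeries.levelSet p q j lam)) ∧
    (∃ c₁ c₂ : ℝ, 0 < c₁ ∧ 0 < c₂ ∧
      ∀ p q j : ℕ, 0 < q → Nat.Coprime p q → 4 ∣ q → ∀ lam : ℝ, 0 < lam →
        c₁ * (volume.real (SquareSeries.I p q j) * Real.exp (-(lam * √(2 * (q : ℝ)))))
          ≤ volume.real (SquareSeries.levelSet p q j lam) ∧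
        volume.real (SquareSeries.levelSet p q j lam)
          ≤ c₂ * (volume.real (SquareSeries.I p q j) * Real.exp (-(lam * √(2 * (q : ℝ)))))) := by
  obtain ⟨C, hC, H⟩ := SquareSeries.exists_le_volume_real_levelSet
  obtain ⟨C₀, hC₀, H₀⟩ := SquareSeries.exists_volume_real_levelSet_le
  refine ⟨SquareSeries.ae_tendsto_F, SquareSeries.integrableOn_F, ⟨C, hC, H⟩, C, C₀, hC, hC₀,
    fun p q j hq hpq h4 lam hlam => ⟨?_, H₀ p q j hq hpq h4 lam⟩⟩
  have h := H p q j hq hpq lam hlam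
  -- For 4 ∣ q one has c_q √q = √(2q), so the general lower bound is already the sharp one.
  rwa [SquareSeries.c, if_pos h4, mul_assoc C, mul_comm √2 lam, mul_assoc lam,
    ← Real.sqrt_mul (by norm_num)] at h
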